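/- Let $\dot H^1(\mathbf R^4)$ be the space of $f\in L^4(\mathbf R^4;\mathbf C)$ whose distributional gradient lies in $L^2$, with norm $\|\nabla f\|_{L^2}$. Let $F(u)=-|u|^2u$ and let $u:\mathbf R\times\mathbf R^4\to\mathbf C$ be a global solution of the focusing cubic nonlinear Schrödinger equation $$i u_t+\Delta u=F(u),\qquad u(0)\in\dot H^1(\mathbf R^4),$$ that is, $u\in C(\mathbf R;\dot H^1(\mathbf R^4))$, $\int_J\int_{\mathbf R^4}|u(t,x)|^6\,dx\,dt<\infty$ for every compact $J\subset\mathbf R$, and for all $t_0,t\in\mathbf R$ $$u(t)=e^{i(t-t_0)\Delta}u(t_0)-i\int_{t_0}^{t}e^{i(t-\tau)\Delta}F(u(\tau))\,d\tau$$ as tempered distributions. Suppose that $u$ is almost periodic: there are functions $N:\mathbf R\to(0,\infty)$, $x:\mathbf R\to\mathbf R^4$ and a compact set $K\subset\dot H^1(\mathbf R^4)$ such that $$\frac1{N(t)}\,u\Big(t,\frac{\,\cdot-x(t)}{N(t)}\Big)\in K\qquad\text{for all }t\in\mathbf R .$$ If $N(t)\ge 1$ for all $t\in\mathbf R$, then $u\in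 L^\infty_tL^3_x(\mathbf R\times\mathbf R^4)$, and in fact $$\sup_{t\in\mathbf R}\|u(t)\|_{L^3_x(\mathbf R^4)}<\infty .$$ -/

import Mathlib

open MeasureTheory Set Filter Topology
open scoped ENNReal NNReal SchwartzMap LineDeriv

noncomputable section

namespace NLS

/-- Physical space `ℝ⁴` with the Euclidean norm and Lebesgue measure. -/
abbrev R4 : Type := EuclideanSpace ℝ (Fin 4)

instance fact_one_le_four : Fact ((1 : ℝ≥0∞) ≤ 4) := ⟨by norm_num⟩

instance fact_one_le_four_thirds : Fact ((1 : ℝ≥0∞) ≤ 4 / 3) :=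
  ⟨by rw [ENNReal.le_div_iff_mul_le (by simp) (by simp)]; norm_num⟩

/-! ### The homogeneous Sobolev space `Ḣ¹(ℝ⁴)` -/

/-- The `i`-th standard unit vector of `ℝ⁴`. -/
abbrev unitVec (i : Fin 4) : R4 := EuclideanSpace.single i 1

/-- The functions in `L⁴(ℝ⁴)` all of whose first order distributional derivatives lie in
`L²(ℝ⁴)`. Here `4 = 2d/(d-2)` is the Sobolev exponent in dimension `d = 4`. -/
def hdotSubmodule : Submodule ℂ (Lp ℂ 4 (volume : Measure R4)) where
  carrier := {f | ∀ i : Fin 4, ∃ g : Lp ℂ 2 (volume : Measure R4),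
    ∂_{unitVec i} (f : 𝓢'(R4, ℂ)) = (g : 𝓢'(R4, ℂ))}
  add_mem' := by
    intro f₁ f₂ h₁ h₂ i
    obtain ⟨g₁, e₁⟩ := h₁ i
    obtain ⟨g₂, e₂⟩ := h₂ i
    refine ⟨g₁ + g₂, ?_⟩
    simp only [← Lp.toTemperedDistributionCLM_apply, map_add, LineDeriv.lineDerivOp_add] at e₁ e₂ ⊢
    rw [e₁, e₂]
  zero_mem' := by
    intro i
    refine ⟨0, ?_⟩
    simp only [← Lp.toTemperedDistributionCLM_apply, map_zero, LineDeriv.lineDerivOp_zero]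
  smul_mem' := by
    intro c f h i
    obtain ⟨g, e⟩ := h i
    refine ⟨c • g, ?_⟩
    simp only [← Lp.toTemperedDistributionCLM_apply, map_smul, LineDeriv.lineDerivOp_smul] at e ⊢
    rw [e]

/-- The homogeneous Sobolev space `Ḣ¹(ℝ⁴)`: the `L⁴` functions with distributional gradient in
`L²`. Its topology is *not* the one of `L⁴`: it is given below by `‖∇f‖_{L²}`. -/
def HDot1 : Type := ↥hdotSubmodule

instance : AddCommGroup HDot1 := inferInstanceAs (AddCommGroup ↥hdotSubmodule)

instance : Module ℂ HDot1 := inferInstanceAs (Module ℂ ↥hdotSubmodule)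

/-- The underlying function of an element of `Ḣ¹(ℝ⁴)`, as an element of `L⁴(ℝ⁴)`. -/
def HDot1.toL4 : HDot1 →ₗ[ℂ] Lp ℂ 4 (volume : Measure R4) := hdotSubmodule.subtype

instance : CoeFun HDot1 (fun _ => R4 → ℂ) := ⟨fun f => (HDot1.toL4 f : R4 → ℂ)⟩

/-- The `i`-th distributional partial derivative of `f ∈ Ḣ¹`, as an element of `L²`. -/
def HDot1.partialFun (i : Fin 4) (f : HDot1) : Lp ℂ 2 (volume : Measure R4) :=
  Classical.choose (f.2 i)

theorem HDot1.partialFun_spec (i : Fin 4) (f : HDot1) :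
    ∂_{unitVec i} (HDot1.toL4 f : 𝓢'(R4, ℂ)) = (HDot1.partialFun i f : 𝓢'(R4, ℂ)) :=
  Classical.choose_spec (f.2 i)

theorem toTemperedDistribution_L2_injective {f g : Lp ℂ 2 (volume : Measure R4)}
    (h : (f : 𝓢'(R4, ℂ)) = (g : 𝓢'(R4, ℂ))) : f = g := by
  have hk := LinearMap.ker_eq_bot.mp
    (Lp.ker_toTemperedDistributionCLM_eq_bot (F := ℂ) (μ := (volume : Measure R4)) (p := 2))
  exact hk h

/-- The distributional gradient `∇ : Ḣ¹(ℝ⁴) → L²(ℝ⁴)⁴`. The target carries the Hilbert norm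
`(∑ᵢ ‖gᵢ‖²_{L²})^{1/2}`. -/
def HDot1.grad : HDot1 →ₗ[ℂ] PiLp 2 (fun _ : Fin 4 => Lp ℂ 2 (volume : Measure R4)) where
  toFun f := WithLp.toLp 2 (fun i => HDot1.partialFun i f)
  map_add' f g := by
    ext1 i
    apply toTemperedDistribution_L2_injective
    rw [← HDot1.partialFun_spec]
    simp only [PiLp.add_apply, ← Lp.toTemperedDistributionCLM_apply, map_add, LineDeriv.lineDerivOp_add]
    simp only [Lp.toTemperedDistributionCLM_apply, HDot1.partialFun_spec]
  map_smul' c f := by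
    ext1 i
    apply toTemperedDistribution_L2_injective
    rw [← HDot1.partialFun_spec]
    simp only [PiLp.smul_apply, ← Lp.toTemperedDistributionCLM_apply, map_smul, LineDeriv.lineDerivOp_smul,
      RingHom.id_apply]
    simp only [Lp.toTemperedDistributionCLM_apply, HDot1.partialFun_spec]

/-- The norm of `Ḣ¹(ℝ⁴)`, `‖f‖ = ‖∇f‖_{L²}`, and the topology it defines. -/
instance : SeminormedAddCommGroup HDot1 :=
  SeminormedAddCommGroup.induced HDot1 (PiLp 2 (fun _ : Fin 4 => Lp ℂ 2 (volume : Measure R4)))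
    HDot1.grad

theorem HDot1.norm_def (f : HDot1) : ‖f‖ = ‖HDot1.grad f‖ := rfl

/-! ### The free Schrödinger group and the nonlinearity -/

/-- The symbol of `e^{itΔ}` is smooth with polynomially bounded derivatives, so that the Fourier
multiplier below is the genuine one. -/
theorem schrodingerSymbol_hasTemperateGrowth (t : ℝ) :
    Function.HasTemperateGrowth
      (fun ξ : R4 => Complex.exp (-(Complex.I * t * (2 * Real.pi * ‖ξ‖ : ℝ) ^ 2))) := by
  have hexp : Function.HasTemperateGrowth
      (fun s : ℝ => Complex.exp (-Complex.I * (s : ℂ))) := by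
    refine ⟨(contDiff_const.mul Complex.ofRealCLM.contDiff).cexp, fun n => ⟨0, 1, fun s => ?_⟩⟩
    rw [norm_iteratedFDeriv_eq_norm_iteratedDeriv]
    have key : ∀ n : ℕ, iteratedDeriv n (fun s : ℝ => Complex.exp (-Complex.I * (s : ℂ))) =
        fun s : ℝ => (-Complex.I) ^ n * Complex.exp (-Complex.I * (s : ℂ)) := by
      intro n
      induction n with
      | zero => ext s; simp
      | succ n ih =>
        rw [iteratedDeriv_succ, ih]
        ext s
        have h1 : HasDerivAt (fun s : ℝ => -Complex.I * (s : ℂ)) (-Complex.I * 1) s :=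
          (Complex.ofRealCLM.hasDerivAt (x := s)).const_mul _
        rw [(h1.cexp.const_mul _).deriv]
        ring
    rw [key n]
    simp [Complex.norm_exp]
  have hpoly : Function.HasTemperateGrowth
      (fun ξ : R4 => t * (2 * Real.pi) ^ 2 * ‖ξ‖ ^ 2) :=
    (Function.HasTemperateGrowth.const _).mul (Function.hasTemperateGrowth_norm_sq R4)
  have h := hexp.comp hpoly
  refine cast (congrArg _ ?_) h
  ext ξ
  simp only [Function.comp]
  congr 1
  push_cast
  ring

/-- The free Schrödinger group `e^{itΔ}` on tempered distributions: the Fourier multiplier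
`exp(-it|2πξ|²)`. (Mathlib's Fourier transform has the kernel `exp(-2πi x·ξ)`, so that `Δ` has
the symbol `-|2πξ|²`.) -/
def schrodingerGroup (t : ℝ) : 𝓢'(R4, ℂ) →L[ℂ] 𝓢'(R4, ℂ) :=
  TemperedDistribution.fourierMultiplierCLM ℂ
    (fun ξ : R4 => Complex.exp (-(Complex.I * t * (2 * Real.pi * ‖ξ‖ : ℝ) ^ 2)))

theorem memLp_cubic (f : Lp ℂ 4 (volume : Measure R4)) :
    MemLp (fun x => -((‖f x‖ : ℂ) ^ 2 * f x)) (4 / 3) (volume : Measure R4) := by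
  have h := (Lp.memLp f).norm_rpow_div (3 : ℝ≥0∞)
  refine h.congr_norm ?_ ?_
  · have := (Lp.memLp f).1
    fun_prop
  · filter_upwards with x
    simp only [norm_neg, norm_mul, norm_pow, Complex.norm_real, norm_norm, ENNReal.toReal_ofNat]
    rw [Real.norm_of_nonneg (by positivity)]
    norm_cast

/-- The focusing cubic nonlinearity `F(f) = -|f|² f`. It maps `L⁴` to `L^{4/3}`. -/
def focusingCubic (f : Lp ℂ 4 (volume : Measure R4)) : Lp ℂ (4 / 3) (volume : Measure R4) :=
  (memLp_cubic f).toLp _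

/-! ### Solutions, almost periodicity, mixed norms -/

/-- The scattering size `S_J(u) = ∫_J ∫_{ℝ⁴} |u(t,x)|⁶ dx dt`; here `6 = 2(d+2)/(d-2)` with
`d = 4`. -/
def scatteringSize (u : ℝ → HDot1) (J : Set ℝ) : ℝ≥0∞ :=
  ∫⁻ t in J, ∫⁻ x : R4, ‖u t x‖ₑ ^ 6

/-- A global (strong) solution of `i uₜ + Δu = F(u) = -|u|²u` on `ℝ × ℝ⁴` with data in `Ḣ¹`:
`u ∈ C(ℝ; Ḣ¹)`, the scattering size is finite on compact time intervals, and the Duhamel formula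
`u(t) = e^{i(t-t₀)Δ} u(t₀) - i ∫_{t₀}^t e^{i(t-τ)Δ} F(u(τ)) dτ`
holds for all `t₀, t`, as an identity of tempered distributions. -/
structure IsGlobalSolution (u : ℝ → HDot1) : Prop where
  continuous : Continuous u
  scatteringSize_lt_top : ∀ J : Set ℝ, IsCompact J → scatteringSize u J < ∞
  duhamel : ∀ (t₀ t : ℝ) (φ : 𝓢(R4, ℂ)),
    (HDot1.toL4 (u t) : 𝓢'(R4, ℂ)) φ =
      schrodingerGroup (t - t₀) (HDot1.toL4 (u t₀) : 𝓢'(R4, ℂ)) φ -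
        Complex.I * ∫ τ in t₀..t,
          schrodingerGroup (t - τ) (focusingCubic (HDot1.toL4 (u τ)) : 𝓢'(R4, ℂ)) φ

/-- `u` is almost periodic on `ℝ` with frequency scale function `N : ℝ → (0,∞)`: for some
`x₀ : ℝ → ℝ⁴` the rescaled functions `N(t)⁻¹ u(t, (x - x₀(t)) / N(t))`, `t ∈ ℝ`, all lie in one
compact subset of `Ḣ¹(ℝ⁴)`. -/
def IsAlmostPeriodic (u : ℝ → HDot1) (N : ℝ → ℝ) : Prop :=
  (∀ t, 0 < N t) ∧ ∃ (x₀ : ℝ → R4) (K : Set HDot1), IsCompact K ∧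
    ∀ t, ∃ v ∈ K, (v : R4 → ℂ) =ᵐ[volume]
      fun x => ((N t)⁻¹ : ℂ) * u t ((N t)⁻¹ • (x - x₀ t))

/-- The norm of `L^∞_t L^p_x(ℝ × ℝ⁴)`, as a supremum over all times. -/
def normLinftyLp (p : ℝ≥0∞) (u : ℝ → HDot1) : ℝ≥0∞ :=
  ⨆ t : ℝ, eLpNorm (u t : R4 → ℂ) p volume

end NLS

end

noncomputable section

namespace NLS

open FourierTransform

/-! ### Gaussian Schwartz functions -/

/-! Write e^{zΔ} for convolution with the Gaussian kernel at complex time z, Re z > 0. Everything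
reduces to a decay bound s·|e^{sΔ}u(t)(x)| ≤ B, uniform in s > 0, t and x. Given this bound, a
refined Sobolev inequality (`EnergyBound.lintegral_pow_three_le_of_forall`) gives ∫|u|³ ≤ 64·B·E,
with E a bound for ‖∇u‖². Indeed, if |u(x)| = r, then for σ > 2B/r the flow e^{σΔ}u(x) has dropped
below r/2. The square function ∫|u − e^{σΔ}u|² dσ/σ² is therefore at least r³/(32B) at x, while its
integral over x is at most 2E.

The decay comes from Duhamel's formula started at time T → +∞ and smoothed by e^{sΔ} − e^{2sΔ}. The
linear term vanishes in the limit: the orbit is compact modulo scaling and translation, and N ≥ 1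
keeps it away from frequency zero (`tendsto_heat_sub_heat`). The integrand is e^{(s+i(t−τ))Δ}
applied to F − e^{sΔ}F. The kernel is at most (16π²(s²+(t−τ)²))⁻¹, which is integrable in τ because
the dimension is 4. Hence s·‖e^{sΔ}u − e^{2sΔ}u‖_∞ is controlled by the supremum over time of the L¹
norm of F(u) − e^{sΔ}F(u) (`mul_norm_heat_sub_heat_two_mul_le`).

This L¹ norm is in turn controlled by the decay itself
(`EnergyBound.lintegral_cubic_sub_heat_le_of_decay`): if σ·|e^{σΔ}f| ≤ β, it is at most a constant
times β·E. The estimate is applied to the low-frequency part e^{s₀Δ}u only, whose energy is as small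
as desired by compactness and N ≥ 1. The high-frequency part u − e^{s₀Δ}u lies in L² and changes F
by a bounded amount in L¹. This turns a decay constant β into (7/8)β + 2C. As Sobolev gives only
|e^{sΔ}u| ≲ s^{-1/2} to begin with, the bootstrap runs on bounds of the form β(1+δ√s), which hold a
priori for some β. Iterating and then letting δ → 0 gives B = 16C
(`exists_decay_of_smoothed_bound`).

The gradient enters only through `EnergyBound`, a package of estimates stable under pointwise
limits, heat flow, differences and scaling. The sign of the nonlinearity plays no role. -/

theorem norm_iteratedDeriv_exp_neg (b : ℝ) (n : ℕ) (s : ℝ) :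
    ‖iteratedFDeriv ℝ n (fun s : ℝ => Complex.exp (-(b * s : ℝ))) s‖ = |b| ^ n * Real.exp (-(b * s)) := by
  rw [norm_iteratedFDeriv_eq_norm_iteratedDeriv]
  have key : ∀ n : ℕ, iteratedDeriv n (fun s : ℝ => Complex.exp (-(b * s : ℝ))) =
      fun s : ℝ => (-b : ℂ) ^ n * Complex.exp (-(b * s : ℝ)) := by
    intro n
    induction n with
    | zero => ext s; simp
    | succ n ih =>
      rw [iteratedDeriv_succ, ih]
      ext s
      have h1 : HasDerivAt (fun s : ℝ => (-(b * s : ℝ) : ℂ)) (-b * 1) s := by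
        have := (Complex.ofRealCLM.hasDerivAt (x := s)).const_mul (-b : ℂ)
        refine this.congr_of_eventuallyEq (Eventually.of_forall fun r => ?_)
        simp
      rw [(h1.cexp.const_mul _).deriv]
      ring
  rw [key n]
  simp [Complex.norm_exp]

theorem exists_pow_mul_exp_neg_le (a : ℝ) (ha : 0 < a) (m : ℕ) :
    ∃ C, ∀ r : ℝ, 0 ≤ r → (1 + r) ^ m * Real.exp (-(a * r ^ 2)) ≤ C := by
  have h1 : Tendsto (fun r : ℝ => (1 + r) ^ m * Real.exp (-(a * r ^ 2))) atTop (𝓝 0) := by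
    have h2 : Tendsto (fun r : ℝ => Real.exp a * ((1 + r) ^ m * Real.exp (-a * (1 + r))))
        atTop (𝓝 (Real.exp a * 0)) := by
      refine Tendsto.const_mul _ ?_
      have h3 := Real.tendsto_pow_mul_exp_neg_atTop_nhds_zero m
      have h4 : Tendsto (fun r : ℝ => (a⁻¹) ^ m * ((a * (1 + r)) ^ m * Real.exp (-(a * (1 + r)))))
          atTop (𝓝 (a⁻¹ ^ m * 0)) := by
        refine Tendsto.const_mul _ (h3.comp ?_)
        exact (tendsto_atTop_add_const_left _ _ tendsto_id).const_mul_atTop ha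
      rw [mul_zero] at h4
      refine h4.congr fun r => ?_
      rw [mul_pow, ← mul_assoc, ← mul_assoc, ← mul_pow, inv_mul_cancel₀ ha.ne', one_pow, one_mul]
      ring_nf
    rw [mul_zero] at h2
    refine squeeze_zero' ?_ ?_ h2
    · filter_upwards [eventually_ge_atTop 0] with r hr
      positivity
    · filter_upwards [eventually_ge_atTop 1] with r hr
      have : Real.exp (-(a * r ^ 2)) ≤ Real.exp a * Real.exp (-a * (1 + r)) := by
        rw [← Real.exp_add]
        apply Real.exp_le_exp.mpr
        nlinarith [mul_nonneg ha.le (mul_nonneg (by linarith : (0:ℝ) ≤ r) (by linarith : 0 ≤ r - 1))]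
      calc (1 + r) ^ m * Real.exp (-(a * r ^ 2))
          ≤ (1 + r) ^ m * (Real.exp a * Real.exp (-a * (1 + r))) := by gcongr
        _ = _ := by ring
  have hc : ContinuousOn (fun r : ℝ => (1 + r) ^ m * Real.exp (-(a * r ^ 2))) (Ici 0) := by
    fun_prop
  obtain ⟨R, hR⟩ := eventually_atTop.mp (h1.eventually (gt_mem_nhds (zero_lt_one' ℝ)))
  obtain ⟨C, hC⟩ := (isCompact_Icc (a := (0:ℝ)) (b := R)).bddAbove_image
    (hc.mono (fun x hx => hx.1))
  refine ⟨max C 1, fun r hr => ?_⟩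
  by_cases h : r ≤ R
  · exact le_max_of_le_left (hC ⟨r, ⟨hr, h⟩, rfl⟩)
  · exact le_max_of_le_right (hR r (le_of_not_ge h)).le

/-- The Gaussian `exp (-b ‖y‖²)`, `b > 0`, as a Schwartz function. -/
def gaussianSchwartz (b : ℝ) (hb : 0 < b) : 𝓢(R4, ℂ) where
  toFun y := Complex.exp (-(b * ‖y‖ ^ 2 : ℝ))
  smooth' := by
    have : ContDiff ℝ (⊤ : ℕ∞) (fun y : R4 => b * ‖y‖ ^ 2) := contDiff_const.mul (contDiff_norm_sq ℝ)
    exact (Complex.ofRealCLM.contDiff.comp this).neg.cexp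
  decay' := by
    intro m n
    obtain ⟨k, C, hC0, hC⟩ := (Function.hasTemperateGrowth_norm_sq R4).norm_iteratedFDeriv_le_uniform n
    -- The n-th derivative of the composition costs up to n factors (1+‖x‖)^k from the inner
    -- derivatives, besides the m powers of the Schwartz weight.
    obtain ⟨C', hC'⟩ := exists_pow_mul_exp_neg_le b hb (m + k * n)
    have hD : ∀ x : R4, 1 ≤ (1 + C) * (1 + ‖x‖) ^ k := fun x =>
      one_le_mul_of_one_le_of_one_le (by linarith) (one_le_pow₀ (by linarith [norm_nonneg x]))
    refine ⟨n.factorial * (max 1 |b|) ^ n * (1 + C) ^ n * C', fun x => ?_⟩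
    have h1 := norm_iteratedFDeriv_comp_le (𝕜 := ℝ) (n := n) (N := (⊤ : ℕ∞))
      (g := fun s : ℝ => Complex.exp (-(b * s : ℝ))) (f := fun y : R4 => ‖y‖ ^ 2)
      (by
        have : ContDiff ℝ (⊤ : ℕ∞) (fun s : ℝ => b * s) := contDiff_const.mul contDiff_id
        exact (Complex.ofRealCLM.contDiff.comp this).neg.cexp)
      (contDiff_norm_sq ℝ) (by exact_mod_cast le_top) x
      (C := (max 1 |b|) ^ n * Real.exp (-(b * ‖x‖ ^ 2))) (D := (1 + C) * (1 + ‖x‖) ^ k)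
      (by
        intro i hi
        rw [norm_iteratedDeriv_exp_neg]
        gcongr
        calc |b| ^ i ≤ (max 1 |b|) ^ i := by gcongr; exact le_max_right _ _
          _ ≤ _ := pow_le_pow_right₀ (le_max_left _ _) hi)
      (by
        intro i h1i hi
        calc _ ≤ C * (1 + ‖x‖) ^ k := hC i hi x
          _ ≤ (1 + C) * (1 + ‖x‖) ^ k := by gcongr; linarith
          _ ≤ _ := le_self_pow₀ (hD x) (by omega))
    calc ‖x‖ ^ m * _ ≤ (1 + ‖x‖) ^ m * _ :=
          mul_le_mul (by gcongr; linarith) h1 (norm_nonneg _) (by positivity)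
      _ = n.factorial * (max 1 |b|) ^ n * (1 + C) ^ n *
          ((1 + ‖x‖) ^ (m + k * n) * Real.exp (-(b * ‖x‖ ^ 2))) := by
        rw [mul_pow, ← pow_mul, pow_add]; ring
      _ ≤ _ := by gcongr; exact hC' _ (norm_nonneg _)

theorem gaussianSchwartz_apply (b : ℝ) (hb : 0 < b) (y : R4) :
    gaussianSchwartz b hb y = Complex.exp (-(b * ‖y‖ ^ 2 : ℝ)) := rfl

/-! ### The heat kernel with complex time -/

/-- The kernel `(4πz)⁻² exp (-‖x‖² / 4z)` of `e^{zΔ}` on `ℝ⁴`. -/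
def heatKernel (z : ℂ) (x : R4) : ℂ :=
  ((4 * Real.pi * z) ^ 2)⁻¹ * Complex.exp (-(‖x‖ : ℂ) ^ 2 / (4 * z))

/-- The kernel of `e^{sΔ}` for real `s`, as a real function. -/
def realHeatKernel (s : ℝ) (x : R4) : ℝ :=
  ((4 * Real.pi * s) ^ 2)⁻¹ * Real.exp (-‖x‖ ^ 2 / (4 * s))

theorem heatKernel_ofReal (s : ℝ) (x : R4) : heatKernel s x = realHeatKernel s x := by
  simp [heatKernel, realHeatKernel]

theorem realHeatKernel_nonneg (s : ℝ) (x : R4) : 0 ≤ realHeatKernel s x := by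
  unfold realHeatKernel; positivity

theorem continuous_heatKernel (z : ℂ) : Continuous (heatKernel z) := by
  unfold heatKernel; fun_prop

theorem continuous_realHeatKernel (s : ℝ) : Continuous (realHeatKernel s) := by
  unfold realHeatKernel; fun_prop

theorem realHeatKernel_le {s : ℝ} (hs : 0 < s) (x : R4) :
    realHeatKernel s x ≤ ((4 * Real.pi * s) ^ 2)⁻¹ := by
  unfold realHeatKernel
  refine mul_le_of_le_one_right (by positivity) (Real.exp_le_one_iff.mpr ?_)
  rw [neg_div]
  exact neg_nonpos.mpr (by positivity)

/-- Because Re(1/z) = Re z/|z|², the modulus is again Gaussian, of real time |z|²/Re z. Every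
absolute convergence question at complex time is reduced to real times by this identity. -/
theorem norm_heatKernel {z : ℂ} (hz : 0 < z.re) (x : R4) :
    ‖heatKernel z x‖ = (‖z‖ / z.re) ^ 2 * realHeatKernel (‖z‖ ^ 2 / z.re) x := by
  have hz0 : z ≠ 0 := by rintro rfl; simp at hz
  have hn : 0 < ‖z‖ := norm_pos_iff.mpr hz0
  have h1 : (-(‖x‖ : ℂ) ^ 2 / (4 * z)).re = -‖x‖ ^ 2 / (4 * (‖z‖ ^ 2 / z.re)) := by
    have : -(‖x‖ : ℂ) ^ 2 / (4 * z) = ((-‖x‖ ^ 2 / 4 : ℝ) : ℂ) * z⁻¹ := by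
      push_cast; field_simp
    rw [this, Complex.re_ofReal_mul, Complex.inv_re, Complex.normSq_eq_norm_sq]
    field_simp
  rw [heatKernel, norm_mul, Complex.norm_exp, h1, realHeatKernel, ← mul_assoc]
  congr 1
  simp only [norm_inv, norm_pow, norm_mul, Complex.norm_ofNat, Complex.norm_real,
    Real.norm_of_nonneg Real.pi_pos.le]
  field_simp

theorem finrank_R4 : Module.finrank ℝ R4 = 4 := by simp [R4]

theorem integrable_realHeatKernel {s : ℝ} (hs : 0 < s) : Integrable (realHeatKernel s) := by
  have h := GaussianFourier.integrable_cexp_neg_mul_sq_norm_add (V := R4)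
    (b := ((1 / (4 * s) : ℝ) : ℂ)) (by rw [Complex.ofReal_re]; positivity) 0 0
  refine (h.norm.const_mul ((4 * Real.pi * s) ^ 2)⁻¹).congr (ae_of_all _ fun x => ?_)
  simp only [zero_mul, add_zero, Complex.norm_exp, realHeatKernel]
  congr 2
  rw [← Complex.ofReal_pow, ← Complex.ofReal_neg, ← Complex.ofReal_mul, Complex.ofReal_re]
  ring

theorem integral_realHeatKernel {s : ℝ} (hs : 0 < s) : ∫ x, realHeatKernel s x = 1 := by
  have h := GaussianFourier.integral_rexp_neg_mul_sq_norm (V := R4) (b := 1 / (4 * s)) (by positivity)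
  rw [finrank_R4] at h
  have h2 : ∀ x : R4, realHeatKernel s x =
      ((4 * Real.pi * s) ^ 2)⁻¹ * Real.exp (-(1 / (4 * s)) * ‖x‖ ^ 2) := by
    intro x; unfold realHeatKernel; congr 2; ring
  simp_rw [h2]
  rw [integral_const_mul, h]
  norm_num
  field_simp

theorem lintegral_realHeatKernel {s : ℝ} (hs : 0 < s) :
    ∫⁻ x, ENNReal.ofReal (realHeatKernel s x) = 1 := by
  rw [← ofReal_integral_eq_lintegral_ofReal (integrable_realHeatKernel hs)
    (ae_of_all _ (realHeatKernel_nonneg s)), integral_realHeatKernel hs, ENNReal.ofReal_one]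

theorem integrable_heatKernel {z : ℂ} (hz : 0 < z.re) : Integrable (heatKernel z) := by
  have hz0 : z ≠ 0 := by rintro rfl; simp at hz
  have hn : 0 < ‖z‖ := norm_pos_iff.mpr hz0
  refine ((integrable_realHeatKernel (s := ‖z‖ ^ 2 / z.re) (by positivity)).const_mul
    ((‖z‖ / z.re) ^ 2)).mono' (continuous_heatKernel z).aestronglyMeasurable (ae_of_all _ fun x => ?_)
  exact (norm_heatKernel hz x).le

/-- The semigroup law, as a single Gaussian integral after completing the square. In dimension 4 the
determinant factor carries the exponent 4/2 = 2, so no branch of a complex root intervenes. -/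
theorem integral_heatKernel_mul_heatKernel {z w : ℂ} (hz : 0 < z.re) (hw : 0 < w.re) (x : R4) :
    ∫ y, heatKernel z (x - y) * heatKernel w y = heatKernel (z + w) x := by
  have hz0 : z ≠ 0 := by rintro rfl; simp at hz
  have hw0 : w ≠ 0 := by rintro rfl; simp at hw
  have hzw0 : z + w ≠ 0 := by
    intro h; have := congrArg Complex.re h; simp at this; linarith
  have hre : ∀ {z : ℂ}, 0 < z.re → 0 < (1 / (4 * z)).re := by
    intro z hz
    have hz0 : z ≠ 0 := by rintro rfl; simp at hz
    rw [one_div, Complex.inv_re]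
    have : 0 < Complex.normSq (4 * z) := Complex.normSq_pos.mpr (by simpa using hz0)
    have h4 : (4 * z).re = 4 * z.re := by simp
    rw [h4]; positivity
  have hb : 0 < (1 / (4 * z) + 1 / (4 * w)).re := by
    rw [Complex.add_re]; exact add_pos (hre hz) (hre hw)
  have h := GaussianFourier.integral_cexp_neg_mul_sq_norm_add (V := R4) hb (1 / (2 * z)) x
  have h2 : ∀ y : R4, heatKernel z (x - y) * heatKernel w y =
      (((4 * Real.pi * z) ^ 2)⁻¹ * ((4 * Real.pi * w) ^ 2)⁻¹ *
        Complex.exp (-(‖x‖ : ℂ) ^ 2 / (4 * z))) *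
      Complex.exp (-(1 / (4 * z) + 1 / (4 * w)) * ‖y‖ ^ 2 + 1 / (2 * z) * (inner ℝ x y : ℝ)) := by
    intro y
    have hxy : ((‖x - y‖ : ℝ) : ℂ) ^ 2 = ‖x‖ ^ 2 - 2 * (inner ℝ x y : ℝ) + ‖y‖ ^ 2 := by
      have := norm_sub_sq_real x y
      exact_mod_cast congrArg (fun r : ℝ => (r : ℂ)) this
    unfold heatKernel
    rw [hxy]
    have : ∀ a b c d : ℂ, a * b * (c * d) = a * c * (b * d) := by intros; ring
    rw [this, ← Complex.exp_add, mul_assoc (_ * _), ← Complex.exp_add]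
    congr 2
    field_simp
    ring
  simp_rw [h2]
  rw [integral_const_mul, h, finrank_R4]
  have hpow : ((Real.pi : ℂ) / (1 / (4 * z) + 1 / (4 * w))) ^ (((4 : ℕ) : ℂ) / 2) =
      (Real.pi / (1 / (4 * z) + 1 / (4 * w))) ^ 2 := by
    rw [show (((4 : ℕ) : ℂ) / 2) = ((2 : ℕ) : ℂ) by norm_num, Complex.cpow_natCast]
  have hpi : (Real.pi : ℂ) ≠ 0 := by exact_mod_cast Real.pi_ne_zero
  rw [hpow]
  have hsum : 1 / (4 * z) + 1 / (4 * w) = (z + w) / (4 * z * w) := by field_simp; ring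
  rw [hsum]
  have : ∀ a b c d : ℂ, a * b * (c * d) = a * c * (b * d) := by intros; ring
  rw [this, ← Complex.exp_add, heatKernel]
  congr 1
  · field_simp
  · congr 1
    field_simp
    ring

theorem integral_realHeatKernel_mul_realHeatKernel {s r : ℝ} (hs : 0 < s) (hr : 0 < r) (x : R4) :
    ∫ y, realHeatKernel s (x - y) * realHeatKernel r y = realHeatKernel (s + r) x := by
  have h := integral_heatKernel_mul_heatKernel (z := s) (w := r) (by simpa) (by simpa) x
  simp only [← Complex.ofReal_add, heatKernel_ofReal] at h
  exact_mod_cast h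

/-- Half of the Gaussian exponent pays for the weight, by t ≤ e^t with t = ‖y‖²/(8s). The constant
is 8·4, the 4 coming from the normalisation at time 2s. -/
theorem norm_sq_mul_realHeatKernel_le {s : ℝ} (hs : 0 < s) (y : R4) :
    ‖y‖ ^ 2 * realHeatKernel s y ≤ 32 * s * realHeatKernel (2 * s) y := by
  have h1 : ‖y‖ ^ 2 / (8 * s) ≤ Real.exp (‖y‖ ^ 2 / (8 * s)) :=
    le_trans (by linarith) (Real.add_one_le_exp _)
  have h2 : Real.exp (-‖y‖ ^ 2 / (4 * (2 * s))) =
      Real.exp (‖y‖ ^ 2 / (8 * s)) * Real.exp (-‖y‖ ^ 2 / (4 * s)) := by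
    rw [← Real.exp_add]; congr 1; field_simp; ring
  unfold realHeatKernel
  rw [h2]
  calc _ = ‖y‖ ^ 2 / (8 * s) * (8 * s * ((4 * Real.pi * s) ^ 2)⁻¹ *
        Real.exp (-‖y‖ ^ 2 / (4 * s))) := by field_simp
    _ ≤ Real.exp (‖y‖ ^ 2 / (8 * s)) * (8 * s * ((4 * Real.pi * s) ^ 2)⁻¹ *
        Real.exp (-‖y‖ ^ 2 / (4 * s))) := by gcongr
    _ = _ := by field_simp; ring

/-! ### The Schrödinger group acting on heat kernels -/

/-- The heat kernel `y ↦ heatKernel s (x - y)`, `s > 0`, as a Schwartz function. -/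
def heatSchwartz (s : ℝ) (hs : 0 < s) (x : R4) : 𝓢(R4, ℂ) :=
  ((4 * Real.pi * s : ℂ) ^ 2)⁻¹ •
    SchwartzMap.compSubConstCLM ℂ x (gaussianSchwartz (1 / (4 * s)) (by positivity))

theorem heatSchwartz_apply (s : ℝ) (hs : 0 < s) (x y : R4) :
    heatSchwartz s hs x y = heatKernel s (x - y) := by
  simp only [heatSchwartz, smul_apply, SchwartzMap.compSubConstCLM_apply,
    gaussianSchwartz_apply, smul_eq_mul, heatKernel]
  congr 2
  rw [norm_sub_rev]
  push_cast
  ring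

theorem fourier_gaussian_modulated {z : ℂ} (hz : 0 < z.re) (x : R4) :
    FourierTransform.fourier (fun ξ : R4 => Complex.exp
      (-(4 * Real.pi ^ 2 * z) * (‖ξ‖ : ℂ) ^ 2 + 2 * Real.pi * Complex.I * (inner ℝ x ξ : ℝ))) =
    fun y => heatKernel z (x - y) := by
  have hz0 : z ≠ 0 := by rintro rfl; simp at hz
  have hpi : (Real.pi : ℂ) ≠ 0 := by exact_mod_cast Real.pi_ne_zero
  have hb : 0 < (4 * Real.pi ^ 2 * z : ℂ).re := by
    rw [show (4 * Real.pi ^ 2 * z : ℂ) = ((4 * Real.pi ^ 2 : ℝ) : ℂ) * z by push_cast; ring,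
      Complex.re_ofReal_mul]
    positivity
  ext y
  rw [fourier_gaussian_innerProductSpace' hb, finrank_R4,
    show (((4 : ℕ) : ℂ) / 2) = ((2 : ℕ) : ℂ) by norm_num, Complex.cpow_natCast, heatKernel]
  congr 1
  · field_simp
  · congr 1; field_simp

theorem integrable_gaussian_modulated {z : ℂ} (hz : 0 < z.re) (x : R4) :
    Integrable (fun ξ : R4 => Complex.exp
      (-(4 * Real.pi ^ 2 * z) * (‖ξ‖ : ℂ) ^ 2 + 2 * Real.pi * Complex.I * (inner ℝ x ξ : ℝ))) := by
  have hb : 0 < (4 * Real.pi ^ 2 * z : ℂ).re := by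
    rw [show (4 * Real.pi ^ 2 * z : ℂ) = ((4 * Real.pi ^ 2 : ℝ) : ℂ) * z by push_cast; ring,
      Complex.re_ofReal_mul]
    positivity
  exact GaussianFourier.integrable_cexp_neg_mul_sq_norm_add hb _ x

theorem fourierInv_heatSchwartz (s : ℝ) (hs : 0 < s) (x ξ : R4) :
    FourierTransformInv.fourierInv (heatSchwartz s hs x) ξ = Complex.exp
      (-(4 * Real.pi ^ 2 * s) * (‖ξ‖ : ℂ) ^ 2 + 2 * Real.pi * Complex.I * (inner ℝ x ξ : ℝ)) := by
  have hre : 0 < (s : ℂ).re := by simpa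
  rw [SchwartzMap.fourierInv_coe]
  have h1 : (heatSchwartz s hs x : R4 → ℂ) = FourierTransform.fourier (fun ξ : R4 => Complex.exp
      (-(4 * Real.pi ^ 2 * s) * (‖ξ‖ : ℂ) ^ 2 + 2 * Real.pi * Complex.I * (inner ℝ x ξ : ℝ))) := by
    rw [fourier_gaussian_modulated hre]
    ext y
    exact heatSchwartz_apply s hs x y
  rw [h1, Continuous.fourierInv_fourier_eq (by fun_prop) (integrable_gaussian_modulated hre x)]
  rw [← h1]
  exact (heatSchwartz s hs x).integrable

/-- On the Fourier side the heat factor e^{−4π²s|ξ|²} times the Schrödinger symbol is the Gaussian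
of complex time s + iθ. Testing against heat kernels thus turns the unitary group into an absolutely
convergent convolution, and tempered distributions into pointwise values. -/
theorem schrodingerGroup_heatSchwartz (T : 𝓢'(R4, ℂ)) (θ s : ℝ) (hs : 0 < s) (x : R4) :
    ∃ ψ : 𝓢(R4, ℂ), (∀ y, ψ y = heatKernel (s + θ * Complex.I) (x - y)) ∧
      schrodingerGroup θ T (heatSchwartz s hs x) = T ψ := by
  refine ⟨_, fun y => ?_, TemperedDistribution.fourierMultiplierCLM_apply_apply _ _ _⟩
  rw [SchwartzMap.fourier_coe, ← congrFun (fourier_gaussian_modulated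
    (z := s + θ * Complex.I) (by simpa) x) y]
  refine congrFun (congrArg FourierTransform.fourier (funext fun ξ => ?_)) y
  rw [SchwartzMap.smulLeftCLM_apply_apply (schrodingerSymbol_hasTemperateGrowth θ),
    fourierInv_heatSchwartz, smul_eq_mul, ← Complex.exp_add]
  congr 1
  push_cast
  ring

/-! ### The heat operator on functions -/

/-- `e^{zΔ} f`, given by convolution with the heat kernel. -/
def heat (z : ℂ) (f : R4 → ℂ) (x : R4) : ℂ := ∫ y, heatKernel z (x - y) * f y

theorem schrodingerGroup_Lp_heatSchwartz {p : ℝ≥0∞} [Fact (1 ≤ p)]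
    (f : Lp ℂ p (volume : Measure R4)) (θ s : ℝ) (hs : 0 < s) (x : R4) :
    schrodingerGroup θ (f : 𝓢'(R4, ℂ)) (heatSchwartz s hs x) = heat (s + θ * Complex.I) f x := by
  obtain ⟨ψ, hψ, h⟩ := schrodingerGroup_heatSchwartz (f : 𝓢'(R4, ℂ)) θ s hs x
  rw [h, Lp.toTemperedDistribution_apply]
  simp only [hψ, heat, smul_eq_mul]

theorem Lp_apply_heatSchwartz {p : ℝ≥0∞} [Fact (1 ≤ p)]
    (f : Lp ℂ p (volume : Measure R4)) (s : ℝ) (hs : 0 < s) (x : R4) :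
    (f : 𝓢'(R4, ℂ)) (heatSchwartz s hs x) = heat s f x := by
  rw [Lp.toTemperedDistribution_apply]
  simp only [heatSchwartz_apply, heat, smul_eq_mul]

theorem heat_congr_ae {f g : R4 → ℂ} (h : f =ᵐ[volume] g) (z : ℂ) : heat z f = heat z g := by
  ext x
  refine integral_congr_ae ?_
  filter_upwards [h] with y hy
  rw [hy]

/-- Measurable functions whose heat evolution is given by absolutely convergent integrals. -/
structure HeatAdmissible (f : R4 → ℂ) : Prop where
  measurable : Measurable f
  integrable : ∀ s : ℝ, 0 < s → ∀ x, Integrable (fun y => realHeatKernel s (x - y) * ‖f y‖)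

theorem integrable_realHeatKernel_sub {s : ℝ} (hs : 0 < s) (x : R4) :
    Integrable (fun y => realHeatKernel s (x - y)) :=
  (integrable_realHeatKernel hs).comp_sub_left x

theorem integral_realHeatKernel_sub {s : ℝ} (hs : 0 < s) (x : R4) :
    ∫ y, realHeatKernel s (x - y) = 1 := by
  rw [integral_sub_left_eq_self (realHeatKernel s), integral_realHeatKernel hs]

theorem HeatAdmissible.of_integrable_pow {f : R4 → ℂ} (hf : Measurable f) {p : ℝ} (hp : 1 ≤ p)
    (h : Integrable (fun x => ‖f x‖ ^ p)) : HeatAdmissible f := by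
  refine ⟨hf, fun s hs x => ?_⟩
  refine ((integrable_realHeatKernel_sub hs x).add
    (h.const_mul ((4 * Real.pi * s) ^ 2)⁻¹)).mono' ?_ (ae_of_all _ fun y => ?_)
  · exact ((continuous_realHeatKernel s).comp (continuous_const.sub continuous_id)).aestronglyMeasurable.mul
      hf.norm.aestronglyMeasurable
  · have h0 := realHeatKernel_nonneg s (x - y)
    rw [Real.norm_of_nonneg (by positivity)]
    have h1 : ‖f y‖ ≤ 1 + ‖f y‖ ^ p := by
      rcases le_total ‖f y‖ 1 with h | h
      · have : 0 ≤ ‖f y‖ ^ p := by positivity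
        linarith
      · have := Real.self_le_rpow_of_one_le h hp
        linarith
    calc realHeatKernel s (x - y) * ‖f y‖ ≤ realHeatKernel s (x - y) * (1 + ‖f y‖ ^ p) := by gcongr
      _ = realHeatKernel s (x - y) + realHeatKernel s (x - y) * ‖f y‖ ^ p := by ring
      _ ≤ _ := by
        simp only [Pi.add_apply]
        gcongr
        exact realHeatKernel_le hs _

theorem HeatAdmissible.of_memLp {f : R4 → ℂ} (hf : Measurable f) {p : ℝ≥0∞} (hp : 1 ≤ p)
    (hp' : p ≠ ∞) (h : MemLp f p) : HeatAdmissible f :=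
  .of_integrable_pow hf (p := p.toReal) (by simpa using ENNReal.toReal_mono hp' hp)
    (h.integrable_norm_rpow (by positivity) hp')

theorem HeatAdmissible.mono {f g : R4 → ℂ} (hf : HeatAdmissible f) (hg : Measurable g)
    (h : ∀ x, ‖g x‖ ≤ ‖f x‖) : HeatAdmissible g := by
  refine ⟨hg, fun s hs x => (hf.integrable s hs x).mono' ?_ (ae_of_all _ fun y => ?_)⟩
  · exact ((continuous_realHeatKernel s).comp (continuous_const.sub continuous_id)).aestronglyMeasurable.mul
      hg.norm.aestronglyMeasurable
  · have h0 := realHeatKernel_nonneg s (x - y)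
    rw [Real.norm_of_nonneg (by positivity)]
    gcongr
    exact h y

theorem HeatAdmissible.add {f g : R4 → ℂ} (hf : HeatAdmissible f) (hg : HeatAdmissible g) :
    HeatAdmissible (fun x => f x + g x) := by
  refine ⟨hf.measurable.add hg.measurable, fun s hs x =>
    ((hf.integrable s hs x).add (hg.integrable s hs x)).mono' ?_ (ae_of_all _ fun y => ?_)⟩
  · exact ((continuous_realHeatKernel s).comp (continuous_const.sub continuous_id)).aestronglyMeasurable.mul
      (hf.measurable.add hg.measurable).norm.aestronglyMeasurable
  · have h0 := realHeatKernel_nonneg s (x - y)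
    rw [Real.norm_of_nonneg (by positivity)]
    simp only [Pi.add_apply]
    rw [← mul_add]
    gcongr
    exact norm_add_le _ _

theorem HeatAdmissible.const_mul {f : R4 → ℂ} (hf : HeatAdmissible f) (c : ℂ) :
    HeatAdmissible (fun x => c * f x) := by
  refine ⟨hf.measurable.const_mul c, fun s hs x => ?_⟩
  refine ((hf.integrable s hs x).const_mul ‖c‖).congr (ae_of_all _ fun y => ?_)
  simp only [norm_mul]
  ring

theorem HeatAdmissible.sub {f g : R4 → ℂ} (hf : HeatAdmissible f) (hg : HeatAdmissible g) :
    HeatAdmissible (fun x => f x - g x) := by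
  have := hf.add (hg.const_mul (-1))
  simpa [sub_eq_add_neg] using this

theorem pos_normSq_div_re {z : ℂ} (hz : 0 < z.re) : 0 < ‖z‖ ^ 2 / z.re := by
  have hz0 : z ≠ 0 := by rintro rfl; simp at hz
  have hn : 0 < ‖z‖ := norm_pos_iff.mpr hz0
  positivity

theorem HeatAdmissible.integrable_heatKernel {f : R4 → ℂ} (hf : HeatAdmissible f) {z : ℂ}
    (hz : 0 < z.re) (x : R4) : Integrable (fun y => heatKernel z (x - y) * f y) := by
  refine ((hf.integrable _ (pos_normSq_div_re hz) x).const_mul ((‖z‖ / z.re) ^ 2)).mono' ?_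
    (ae_of_all _ fun y => ?_)
  · exact ((continuous_heatKernel z).comp (continuous_const.sub continuous_id)).aestronglyMeasurable.mul
      hf.measurable.aestronglyMeasurable
  · rw [norm_mul, norm_heatKernel hz, mul_assoc]

theorem HeatAdmissible.heat_add {f g : R4 → ℂ} (hf : HeatAdmissible f) (hg : HeatAdmissible g)
    {z : ℂ} (hz : 0 < z.re) (x : R4) :
    heat z (fun y => f y + g y) x = heat z f x + heat z g x := by
  simp only [heat, mul_add]
  exact integral_add (hf.integrable_heatKernel hz x) (hg.integrable_heatKernel hz x)

theorem HeatAdmissible.heat_sub {f g : R4 → ℂ} (hf : HeatAdmissible f) (hg : HeatAdmissible g)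
    {z : ℂ} (hz : 0 < z.re) (x : R4) :
    heat z (fun y => f y - g y) x = heat z f x - heat z g x := by
  simp only [heat, mul_sub]
  exact integral_sub (hf.integrable_heatKernel hz x) (hg.integrable_heatKernel hz x)

theorem heat_translate (z : ℂ) (f : R4 → ℂ) (x y : R4) :
    heat z (fun w => f (w - y)) x = heat z f (x - y) := by
  unfold heat
  rw [← integral_sub_right_eq_self (fun w => heatKernel z (x - y - w) * f w) y]
  congr 1; ext w; congr 2; abel

theorem measurable_heat_uncurry {f : R4 → ℂ} (hf : Measurable f) :
    Measurable (fun p : R4 × ℝ => heat (p.2 : ℂ) f p.1) := by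
  have h : StronglyMeasurable (fun q : (R4 × ℝ) × R4 => heatKernel q.1.2 (q.1.1 - q.2) * f q.2) := by
    refine Measurable.stronglyMeasurable (Measurable.mul ?_ (hf.comp measurable_snd))
    unfold heatKernel
    fun_prop
  exact (StronglyMeasurable.integral_prod_right' h).measurable

theorem measurable_heat (z : ℂ) {f : R4 → ℂ} (hf : Measurable f) : Measurable (heat z f) := by
  have h : StronglyMeasurable (fun q : R4 × R4 => heatKernel z (q.1 - q.2) * f q.2) := by
    refine Measurable.stronglyMeasurable (Measurable.mul ?_ (hf.comp measurable_snd))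
    unfold heatKernel
    fun_prop
  exact (StronglyMeasurable.integral_prod_right' h).measurable

/-- After passing to moduli, the integral over the intermediate variable is a real heat kernel at
the sum of the two effective times. This justifies the Fubini step behind e^{zΔ}e^{wΔ} = e^{(z+w)Δ}.
-/
theorem HeatAdmissible.integrable_prod {f : R4 → ℂ} (hf : HeatAdmissible f) {z w : ℂ}
    (hz : 0 < z.re) (hw : 0 < w.re) (x : R4) :
    Integrable (fun p : R4 × R4 => heatKernel z (x - p.1) * (heatKernel w (p.1 - p.2) * f p.2))
      (volume.prod volume) := by
  have hm : AEStronglyMeasurable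
      (fun p : R4 × R4 => heatKernel z (x - p.1) * (heatKernel w (p.1 - p.2) * f p.2))
      (volume.prod volume) := by
    refine Measurable.aestronglyMeasurable (Measurable.mul ?_ (Measurable.mul ?_
      (hf.measurable.comp measurable_snd)))
    · exact (continuous_heatKernel z).measurable.comp (by fun_prop)
    · exact (continuous_heatKernel w).measurable.comp (by fun_prop)
  have hz' := pos_normSq_div_re hz
  have hw' := pos_normSq_div_re hw
  set Z := ‖z‖ ^ 2 / z.re
  set W := ‖w‖ ^ 2 / w.re
  have hcomp : ∀ y, ∫ v, realHeatKernel Z (x - v) * realHeatKernel W (v - y) =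
      realHeatKernel (Z + W) (x - y) := by
    intro y
    rw [← integral_realHeatKernel_mul_realHeatKernel hz' hw' (x - y),
      ← integral_sub_right_eq_self (fun v => realHeatKernel Z (x - y - v) * realHeatKernel W v) y]
    congr 1; ext v; congr 2; abel
  have hcint : ∀ y, Integrable (fun v => realHeatKernel Z (x - v) * realHeatKernel W (v - y)) := by
    intro y
    refine ((integrable_realHeatKernel_sub hz' x).mul_const ((4 * Real.pi * W) ^ 2)⁻¹).mono' ?_
      (ae_of_all _ fun v => ?_)
    · refine Continuous.aestronglyMeasurable (Continuous.mul ?_ ?_)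
      · exact (continuous_realHeatKernel _).comp (by fun_prop)
      · exact (continuous_realHeatKernel _).comp (by fun_prop)
    · rw [Real.norm_of_nonneg (mul_nonneg (realHeatKernel_nonneg _ _) (realHeatKernel_nonneg _ _))]
      exact mul_le_mul_of_nonneg_left (realHeatKernel_le hw' _) (realHeatKernel_nonneg _ _)
  have hnorm : ∀ v y, ‖heatKernel z (x - v) * (heatKernel w (v - y) * f y)‖ =
      (‖z‖ / z.re) ^ 2 * (‖w‖ / w.re) ^ 2 * ‖f y‖ *
        (realHeatKernel Z (x - v) * realHeatKernel W (v - y)) := by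
    intro v y
    rw [norm_mul, norm_mul, norm_heatKernel hz, norm_heatKernel hw]
    ring
  rw [integrable_prod_iff' hm]
  constructor
  · refine ae_of_all _ fun y => ?_
    refine (((hcint y).const_mul ((‖z‖ / z.re) ^ 2 * (‖w‖ / w.re) ^ 2 * ‖f y‖))).mono' ?_
      (ae_of_all _ fun v => (hnorm v y).le)
    refine Continuous.aestronglyMeasurable (Continuous.mul ?_ (Continuous.mul ?_ (continuous_const (y := f y))))
    · exact (continuous_heatKernel z).comp (by fun_prop)
    · exact (continuous_heatKernel w).comp (by fun_prop)
  · simp only [hnorm, integral_const_mul, hcomp]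
    refine ((hf.integrable _ (add_pos hz' hw') x).const_mul
      ((‖z‖ / z.re) ^ 2 * (‖w‖ / w.re) ^ 2)).congr (ae_of_all _ fun y => ?_)
    simp only
    ring

theorem HeatAdmissible.heat_heat {f : R4 → ℂ} (hf : HeatAdmissible f) {z w : ℂ}
    (hz : 0 < z.re) (hw : 0 < w.re) (x : R4) :
    heat z (heat w f) x = heat (z + w) f x := by
  simp only [heat, ← integral_const_mul]
  rw [integral_integral_swap (hf.integrable_prod hz hw x)]
  congr 1
  ext y
  simp only [← mul_assoc, integral_mul_const]
  congr 1
  rw [← integral_heatKernel_mul_heatKernel hz hw (x - y),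
    ← integral_sub_right_eq_self (fun v => heatKernel z (x - y - v) * heatKernel w v) y]
  congr 1; ext v; congr 2; abel

theorem HeatAdmissible.heat {f : R4 → ℂ} (hf : HeatAdmissible f) {w : ℂ} (hw : 0 < w.re) :
    HeatAdmissible (heat w f) := by
  refine ⟨measurable_heat w hf.measurable, fun s hs x => ?_⟩
  have h := (hf.integrable_prod (z := s) (by simpa) hw x).norm.integral_prod_left
  refine h.mono' ?_ (ae_of_all _ fun y => ?_)
  · exact ((continuous_realHeatKernel s).comp (continuous_const.sub continuous_id)).aestronglyMeasurable.mul
      (measurable_heat w hf.measurable).norm.aestronglyMeasurable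
  · have h0 := realHeatKernel_nonneg s (x - y)
    rw [Real.norm_of_nonneg (by positivity)]
    simp only [norm_mul, heatKernel_ofReal, Complex.norm_real, Real.norm_of_nonneg h0,
      integral_const_mul]
    gcongr
    simp only [← norm_mul]
    exact norm_integral_le_integral_norm _

/-! ### Mapping properties of the heat operator -/

/-- Cauchy–Schwarz in the probability measure w dx. It gives the L² contraction of the heat flow
and, used twice, the L⁴ one. -/
theorem lintegral_mul_sq_le {w g : R4 → ℝ≥0∞} (hw : Measurable w) (hg : Measurable g)
    (h1 : ∫⁻ x, w x = 1) : (∫⁻ x, w x * g x) ^ 2 ≤ ∫⁻ x, w x * g x ^ 2 := by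
  have h := ENNReal.lintegral_mul_le_Lp_mul_Lq (volume.withDensity w) (p := 2) (q := 2)
    Real.HolderConjugate.two_two (f := g) (g := fun _ => 1) hg.aemeasurable aemeasurable_const
  simp only [Pi.mul_apply, mul_one, ENNReal.one_rpow, lintegral_const, withDensity_apply _ MeasurableSet.univ,
    Measure.restrict_univ, h1] at h
  rw [lintegral_withDensity_eq_lintegral_mul _ hw hg,
    lintegral_withDensity_eq_lintegral_mul _ hw (by fun_prop)] at h
  simp only [Pi.mul_apply, ENNReal.rpow_two] at h
  calc _ ≤ ((∫⁻ x, w x * g x ^ 2) ^ (1 / 2 : ℝ)) ^ 2 := by gcongr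
    _ = _ := by
      rw [← ENNReal.rpow_two, ← ENNReal.rpow_mul]
      norm_num

theorem measurable_heatWeight (s : ℝ) (x : R4) :
    Measurable fun y => ENNReal.ofReal (realHeatKernel s (x - y)) :=
  ENNReal.measurable_ofReal.comp ((continuous_realHeatKernel s).measurable.comp (by fun_prop))

theorem lintegral_heatWeight {s : ℝ} (hs : 0 < s) (x : R4) :
    ∫⁻ y, ENNReal.ofReal (realHeatKernel s (x - y)) = 1 := by
  rw [lintegral_sub_left_eq_self (fun y => ENNReal.ofReal (realHeatKernel s y)),
    lintegral_realHeatKernel hs]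

theorem enorm_heat_le (z : ℂ) (hz : 0 < z.re) (f : R4 → ℂ) (x : R4) :
    ‖heat z f x‖ₑ ≤ ENNReal.ofReal ((‖z‖ / z.re) ^ 2) *
      ∫⁻ y, ENNReal.ofReal (realHeatKernel (‖z‖ ^ 2 / z.re) (x - y)) * ‖f y‖ₑ := by
  refine (enorm_integral_le_lintegral_enorm _).trans_eq ?_
  rw [← lintegral_const_mul' _ _ ENNReal.ofReal_ne_top]
  congr 1
  ext y
  rw [enorm_mul, ← ofReal_norm (heatKernel z (x - y)), norm_heatKernel hz,
    ENNReal.ofReal_mul (by positivity), mul_assoc]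

theorem enorm_heat_ofReal_le {s : ℝ} (hs : 0 < s) (f : R4 → ℂ) (x : R4) :
    ‖heat s f x‖ₑ ≤ ∫⁻ y, ENNReal.ofReal (realHeatKernel s (x - y)) * ‖f y‖ₑ := by
  refine (enorm_heat_le s (by simpa) f x).trans_eq ?_
  have h1 : ‖(s : ℂ)‖ = s := by simp [abs_of_pos hs]
  have h2 : s ^ 2 / s = s := by field_simp
  rw [h1, Complex.ofReal_re, div_self hs.ne', h2]
  simp

theorem enorm_heat_sq_le {s : ℝ} (hs : 0 < s) {f : R4 → ℂ} (hf : Measurable f) (x : R4) :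
    ‖heat s f x‖ₑ ^ 2 ≤ ∫⁻ y, ENNReal.ofReal (realHeatKernel s (x - y)) * ‖f y‖ₑ ^ 2 :=
  (by gcongr; exact enorm_heat_ofReal_le hs f x : _ ≤ _).trans
    (lintegral_mul_sq_le (measurable_heatWeight s x) hf.enorm (lintegral_heatWeight hs x))

theorem enorm_heat_pow_four_le {s : ℝ} (hs : 0 < s) {f : R4 → ℂ} (hf : Measurable f) (x : R4) :
    ‖heat s f x‖ₑ ^ 4 ≤ ∫⁻ y, ENNReal.ofReal (realHeatKernel s (x - y)) * ‖f y‖ₑ ^ 4 := by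
  calc ‖heat s f x‖ₑ ^ 4 = (‖heat s f x‖ₑ ^ 2) ^ 2 := by ring
    _ ≤ (∫⁻ y, ENNReal.ofReal (realHeatKernel s (x - y)) * ‖f y‖ₑ ^ 2) ^ 2 := by
      gcongr; exact enorm_heat_sq_le hs hf x
    _ ≤ ∫⁻ y, ENNReal.ofReal (realHeatKernel s (x - y)) * (‖f y‖ₑ ^ 2) ^ 2 :=
      lintegral_mul_sq_le (measurable_heatWeight s x) (hf.enorm.pow_const 2) (lintegral_heatWeight hs x)
    _ = _ := by simp only [← pow_mul]

theorem lintegral_heatWeight_le {s : ℝ} (hs : 0 < s) (g : R4 → ℝ≥0∞) (x : R4) :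
    ∫⁻ y, ENNReal.ofReal (realHeatKernel s (x - y)) * g y ≤
      ENNReal.ofReal (((4 * Real.pi * s) ^ 2)⁻¹) * ∫⁻ y, g y := by
  rw [← lintegral_const_mul' _ _ ENNReal.ofReal_ne_top]
  gcongr
  exact realHeatKernel_le hs _

theorem lintegral_lintegral_heatWeight {s : ℝ} (hs : 0 < s) {g : R4 → ℝ≥0∞} (hg : Measurable g) :
    ∫⁻ x, ∫⁻ y, ENNReal.ofReal (realHeatKernel s (x - y)) * g y = ∫⁻ y, g y := by
  rw [lintegral_lintegral_swap]
  · congr 1; ext y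
    have hm : Measurable fun x => ENNReal.ofReal (realHeatKernel s (x - y)) :=
      ENNReal.measurable_ofReal.comp ((continuous_realHeatKernel s).measurable.comp (by fun_prop))
    rw [lintegral_mul_const _ hm, lintegral_sub_right_eq_self (fun y => ENNReal.ofReal (realHeatKernel s y)),
      lintegral_realHeatKernel hs, one_mul]
  · refine Measurable.aemeasurable (Measurable.mul ?_ (hg.comp measurable_snd))
    exact ENNReal.measurable_ofReal.comp ((continuous_realHeatKernel s).measurable.comp (by fun_prop))

theorem lintegral_enorm_heat_le {s : ℝ} (hs : 0 < s) {f : R4 → ℂ} (hf : Measurable f) :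
    ∫⁻ x, ‖heat s f x‖ₑ ≤ ∫⁻ x, ‖f x‖ₑ :=
  (lintegral_mono (enorm_heat_ofReal_le hs f)).trans_eq (lintegral_lintegral_heatWeight hs hf.enorm)

theorem lintegral_enorm_heat_sq_le {s : ℝ} (hs : 0 < s) {f : R4 → ℂ} (hf : Measurable f) :
    ∫⁻ x, ‖heat s f x‖ₑ ^ 2 ≤ ∫⁻ x, ‖f x‖ₑ ^ 2 :=
  (lintegral_mono (enorm_heat_sq_le hs hf)).trans_eq
    (lintegral_lintegral_heatWeight hs (hf.enorm.pow_const 2))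

theorem lintegral_enorm_heat_pow_four_le {s : ℝ} (hs : 0 < s) {f : R4 → ℂ} (hf : Measurable f) :
    ∫⁻ x, ‖heat s f x‖ₑ ^ 4 ≤ ∫⁻ x, ‖f x‖ₑ ^ 4 :=
  (lintegral_mono (enorm_heat_pow_four_le hs hf)).trans_eq
    (lintegral_lintegral_heatWeight hs (hf.enorm.pow_const 4))

/-- The dispersive estimate, for complex times. -/
theorem enorm_heat_le_lintegral {z : ℂ} (hz : 0 < z.re) (f : R4 → ℂ) (x : R4) :
    ‖heat z f x‖ₑ ≤ ENNReal.ofReal (((4 * Real.pi * ‖z‖) ^ 2)⁻¹) * ∫⁻ y, ‖f y‖ₑ := by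
  refine (enorm_heat_le z hz f x).trans ?_
  refine (mul_le_mul_right (lintegral_heatWeight_le (pos_normSq_div_re hz) _ x) _).trans_eq ?_
  have hz0 : z ≠ 0 := by rintro rfl; simp at hz
  have hn : 0 < ‖z‖ := norm_pos_iff.mpr hz0
  rw [← mul_assoc, ← ENNReal.ofReal_mul (by positivity)]
  congr 2
  field_simp

/-- The powers of |z| lost in taking moduli cancel, so this L² to L^∞ bound depends on Re z alone.
It gains from smoothing but has no decay in Im z. -/
theorem enorm_heat_sq_le_lintegral {z : ℂ} (hz : 0 < z.re) {f : R4 → ℂ} (hf : Measurable f) (x : R4) :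
    ‖heat z f x‖ₑ ^ 2 ≤ ENNReal.ofReal (((4 * Real.pi * z.re) ^ 2)⁻¹) * ∫⁻ y, ‖f y‖ₑ ^ 2 := by
  have hz0 : z ≠ 0 := by rintro rfl; simp at hz
  have hn : 0 < ‖z‖ := norm_pos_iff.mpr hz0
  have hZ := pos_normSq_div_re hz
  calc ‖heat z f x‖ₑ ^ 2 ≤ (ENNReal.ofReal ((‖z‖ / z.re) ^ 2) *
      ∫⁻ y, ENNReal.ofReal (realHeatKernel (‖z‖ ^ 2 / z.re) (x - y)) * ‖f y‖ₑ) ^ 2 := by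
        gcongr; exact enorm_heat_le z hz f x
    _ ≤ ENNReal.ofReal ((‖z‖ / z.re) ^ 2) ^ 2 *
        (ENNReal.ofReal (((4 * Real.pi * (‖z‖ ^ 2 / z.re)) ^ 2)⁻¹) * ∫⁻ y, ‖f y‖ₑ ^ 2) := by
      rw [mul_pow]
      gcongr
      exact (lintegral_mul_sq_le (measurable_heatWeight _ x) hf.enorm (lintegral_heatWeight hZ x)).trans
        (lintegral_heatWeight_le hZ _ x)
    _ = _ := by
      rw [← mul_assoc, ← ENNReal.ofReal_pow (by positivity), ← ENNReal.ofReal_mul (by positivity)]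
      congr 2
      field_simp

/-! ### Scaling -/

/-- The rescaled function `x ↦ N f (N x + a)`. -/
def rescale (N : ℝ) (a : R4) (f : R4 → ℂ) (x : R4) : ℂ := N * f (N • x + a)

theorem measurable_rescale (N : ℝ) (a : R4) {f : R4 → ℂ} (hf : Measurable f) :
    Measurable (rescale N a f) :=
  (hf.comp (by fun_prop)).const_mul _

theorem lintegral_comp_affine {N : ℝ} (hN : 0 < N) (a : R4) (g : R4 → ℝ≥0∞) :
    ∫⁻ x, g (N • x + a) = ENNReal.ofReal ((N ^ 4)⁻¹) * ∫⁻ x, g x := by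
  have e : MeasurableEmbedding (fun x : R4 => N • x) :=
    (Homeomorph.smulOfNeZero N hN.ne').measurableEmbedding
  rw [← lintegral_add_right_eq_self g a, ← e.lintegral_map (fun x => g (x + a)),
    Measure.map_addHaar_smul _ hN.ne', lintegral_smul_measure, finrank_R4,
    abs_of_pos (by positivity), smul_eq_mul]

theorem integral_comp_affine {N : ℝ} (hN : 0 < N) (a : R4) (g : R4 → ℂ) :
    ∫ x, g (N • x + a) = ((N ^ 4)⁻¹ : ℝ) * ∫ x, g x := by
  rw [← integral_add_right_eq_self g a, Measure.integral_comp_smul volume (fun x => g (x + a)),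
    finrank_R4, abs_of_pos (by positivity), Complex.real_smul]

theorem heatKernel_scale {N : ℝ} (hN : 0 < N) (s : ℝ) (x : R4) :
    heatKernel (N ^ 2 * s : ℝ) (N • x) = ((N ^ 4)⁻¹ : ℝ) * heatKernel s x := by
  have hN0 : (N : ℂ) ≠ 0 := by exact_mod_cast hN.ne'
  simp only [heatKernel, norm_smul, Real.norm_of_nonneg hN.le]
  have h1 : -((N * ‖x‖ : ℝ) : ℂ) ^ 2 / (4 * (N ^ 2 * s : ℝ)) = -(‖x‖ : ℂ) ^ 2 / (4 * s) := by
    push_cast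
    by_cases hs : (s : ℂ) = 0
    · simp [hs]
    field_simp
  have h2 : ((4 * Real.pi * (N ^ 2 * s : ℝ) : ℂ) ^ 2)⁻¹ =
      ((N ^ 4)⁻¹ : ℝ) * ((4 * Real.pi * s : ℂ) ^ 2)⁻¹ := by
    push_cast
    rw [← mul_inv]
    congr 1
    ring
  rw [h1, h2, mul_assoc]

theorem heat_rescale {N : ℝ} (hN : 0 < N) (a : R4) (s : ℝ) (f : R4 → ℂ) :
    heat s (rescale N a f) = rescale N a (heat (N ^ 2 * s : ℝ) f) := by
  ext x
  simp only [heat, rescale]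
  have h := integral_comp_affine hN a (fun y => heatKernel (N ^ 2 * s : ℝ) (N • x + a - y) * f y)
  have hN4 : ((N ^ 4 : ℝ) : ℂ) ≠ 0 := by exact_mod_cast (by positivity : N ^ 4 ≠ 0)
  have h2 : ∀ y, heatKernel (N ^ 2 * s : ℝ) (N • x + a - (N • y + a)) =
      ((N ^ 4)⁻¹ : ℝ) * heatKernel s (x - y) := by
    intro y
    rw [← heatKernel_scale hN, smul_sub]
    congr 1; abel
  simp only [h2, mul_assoc, integral_const_mul] at h
  have h3 := mul_left_cancel₀ (by push_cast; simpa using hN4) h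
  rw [← h3, ← integral_const_mul]
  congr 1; ext y; ring

theorem HeatAdmissible.rescale {f : R4 → ℂ} (hf : HeatAdmissible f) {N : ℝ} (hN : 0 < N) (a : R4) :
    HeatAdmissible (rescale N a f) := by
  refine ⟨measurable_rescale N a hf.measurable, fun s hs x => ?_⟩
  have h := hf.integrable (N ^ 2 * s) (by positivity) (N • x + a)
  have h1 := (h.comp_add_right a).comp_smul hN.ne'
  refine (h1.const_mul (N ^ 5)).congr (ae_of_all _ fun y => ?_)
  have h2 : realHeatKernel (N ^ 2 * s) (N • x + a - (N • y + a)) =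
      (N ^ 4)⁻¹ * realHeatKernel s (x - y) := by
    have := heatKernel_scale hN s (x - y)
    rw [heatKernel_ofReal, heatKernel_ofReal] at this
    have h3 : N • x + a - (N • y + a) = N • (x - y) := by rw [smul_sub]; abel
    rw [h3]
    exact_mod_cast this
  simp only [h2, NLS.rescale, norm_mul, Complex.norm_real, Real.norm_of_nonneg hN.le]
  field_simp

/-! ### Fourier analysis of `L¹ ∩ L²` functions -/

theorem integral_fourier_mul_schwartz {f : R4 → ℂ} (hf : Integrable f) (φ : 𝓢(R4, ℂ)) :
    ∫ ξ, 𝓕 f ξ * φ ξ = ∫ x, f x * 𝓕 φ x := by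
  have := VectorFourier.integral_fourierIntegral_smul_eq_flip (L := innerₗ R4)
    Real.continuous_fourierChar continuous_inner hf (φ.integrable (μ := volume))
  simp only [smul_eq_mul] at this
  rw [SchwartzMap.fourier_coe]
  convert! this using 4
  rw [flip_innerₗ]
  rfl

theorem ae_eq_of_integral_mul_schwartz_eq {f g : R4 → ℂ} (hf : LocallyIntegrable f)
    (hg : LocallyIntegrable g) (h : ∀ φ : 𝓢(R4, ℂ), ∫ x, f x * φ x = ∫ x, g x * φ x) :
    f =ᵐ[volume] g := by
  refine ae_eq_of_integral_contDiff_smul_eq hf hg fun φ hφ hφc => ?_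
  have hc : HasCompactSupport (fun x => (φ x : ℂ)) := hφc.comp_left (g := fun r : ℝ => (r : ℂ)) (by simp)
  have := h (hc.toSchwartzMap (Complex.ofRealCLM.contDiff.comp hφ))
  simp only [Complex.real_smul]
  calc ∫ x, (φ x : ℂ) * f x = ∫ x, f x * (φ x : ℂ) := by simp only [mul_comm]
    _ = ∫ x, g x * (φ x : ℂ) := this
    _ = _ := by simp only [mul_comm]

theorem eLpNorm_two_sq (f : R4 → ℂ) : eLpNorm f 2 volume ^ 2 = ∫⁻ x, ‖f x‖ₑ ^ 2 := by
  rw [eLpNorm_eq_lintegral_rpow_enorm_toReal (by simp) (by simp), ← ENNReal.rpow_two, ← ENNReal.rpow_mul]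
  norm_num

theorem continuous_fourier {f : R4 → ℂ} (hf : Integrable f) : Continuous (𝓕 f) :=
  VectorFourier.fourierIntegral_continuous (L := innerₗ R4) Real.continuous_fourierChar
    continuous_inner hf

/-- Plancherel's identity for the Fourier integral. -/
theorem lintegral_enorm_fourier_sq {f : R4 → ℂ} (hf : Integrable f) (hf2 : MemLp f 2) :
    ∫⁻ ξ, ‖𝓕 f ξ‖ₑ ^ 2 = ∫⁻ x, ‖f x‖ₑ ^ 2 := by
  -- The L² Fourier transform and the Fourier integral agree because they have the same pairing with
  -- every Schwartz function.
  have key : (𝓕 (hf2.toLp f) : Lp ℂ 2 (volume : Measure R4)) =ᵐ[volume] 𝓕 f := by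
    refine ae_eq_of_integral_mul_schwartz_eq
      ((Lp.memLp _).locallyIntegrable (by norm_num)) (continuous_fourier hf).locallyIntegrable
      fun φ => ?_
    rw [integral_fourier_mul_schwartz hf]
    have h1 := Lp.toTemperedDistribution_apply (𝓕 (hf2.toLp f)) φ
    rw [← Lp.fourier_toTemperedDistribution_eq, TemperedDistribution.fourier_apply,
      Lp.toTemperedDistribution_apply] at h1
    simp only [smul_eq_mul, mul_comm (φ _)] at h1
    rw [← h1]
    refine integral_congr_ae ?_
    filter_upwards [hf2.coeFn_toLp] with x hx
    rw [hx, mul_comm]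
  have h2 := Lp.norm_fourier_eq (hf2.toLp f)
  rw [← eLpNorm_two_sq, ← eLpNorm_two_sq, ← eLpNorm_congr_ae key, ← eLpNorm_congr_ae hf2.coeFn_toLp]
  rw [Lp.norm_def, Lp.norm_def, ENNReal.toReal_eq_toReal_iff' (Lp.eLpNorm_ne_top _)
    (Lp.eLpNorm_ne_top _)] at h2
  rw [h2]

theorem fourier_heatKernel {s : ℝ} (hs : 0 < s) (ξ : R4) :
    𝓕 (heatKernel s) ξ = Real.exp (-(s * (2 * Real.pi * ‖ξ‖) ^ 2)) := by
  have hb : 0 < (1 / (4 * s : ℂ)).re := by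
    rw [show (1 / (4 * s : ℂ)) = ((1 / (4 * s) : ℝ) : ℂ) by push_cast; rfl, Complex.ofReal_re]
    positivity
  have hs0 : (s : ℂ) ≠ 0 := by exact_mod_cast hs.ne'
  have hpi : (Real.pi : ℂ) ≠ 0 := by exact_mod_cast Real.pi_ne_zero
  have h := fourier_gaussian_innerProductSpace (V := R4) hb ξ
  rw [finrank_R4, show (((4 : ℕ) : ℂ) / 2) = ((2 : ℕ) : ℂ) by norm_num, Complex.cpow_natCast] at h
  have h2 : heatKernel s = fun x => ((4 * Real.pi * s : ℂ) ^ 2)⁻¹ *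
      Complex.exp (-(1 / (4 * s : ℂ)) * (‖x‖ : ℂ) ^ 2) := by
    ext x
    rw [heatKernel]
    congr 2
    field_simp
  rw [Real.fourier_eq] at h ⊢
  have h4 : ∀ v : R4, Real.fourierChar (-inner ℝ v ξ) • heatKernel s v =
      ((4 * Real.pi * s : ℂ) ^ 2)⁻¹ * (Real.fourierChar (-inner ℝ v ξ) •
        Complex.exp (-(1 / (4 * s : ℂ)) * (‖v‖ : ℂ) ^ 2)) := by
    intro v
    rw [h2, Circle.smul_def, Circle.smul_def, smul_eq_mul, smul_eq_mul]
    ring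
  simp only [h4]
  rw [integral_const_mul, h, ← mul_assoc]
  have h3 : ((4 * Real.pi * s : ℂ) ^ 2)⁻¹ * (Real.pi / (1 / (4 * s))) ^ 2 = 1 := by field_simp
  rw [h3, one_mul]
  push_cast
  congr 1
  field_simp
  ring

theorem fourier_heat {s : ℝ} (hs : 0 < s) {f : R4 → ℂ} (hf : Integrable f) (ξ : R4) :
    𝓕 (heat s f) ξ = Real.exp (-(s * (2 * Real.pi * ‖ξ‖) ^ 2)) * 𝓕 f ξ := by
  have h := Real.fourier_mul_convolution_eq hf (integrable_heatKernel (z := s) (by simpa)) ξ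
  rw [fourier_heatKernel hs, mul_comm] at h
  rw [← h]
  refine congrFun (congrArg 𝓕 (funext fun x => ?_)) ξ
  simp only [heat, convolution, ContinuousLinearMap.mul_apply', mul_comm (f _)]

theorem fourier_translate (f : R4 → ℂ) (y ξ : R4) :
    𝓕 (fun x => f (x - y)) ξ = Complex.exp (Complex.I * (-(2 * Real.pi * inner ℝ y ξ) : ℝ)) * 𝓕 f ξ := by
  have h := congrFun (VectorFourier.fourierIntegral_comp_add_right Real.fourierChar volume
    (innerₗ R4) f (-y)) ξ
  have h2 : 𝓕 (fun x => f (x - y)) ξ = VectorFourier.fourierIntegral Real.fourierChar volume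
    (innerₗ R4) (f ∘ fun v => v + -y) ξ := by
    simp only [sub_eq_add_neg]; rfl
  rw [h2, h, Circle.smul_def, Real.fourierChar_apply, smul_eq_mul]
  congr 2
  simp only [map_neg, LinearMap.neg_apply, innerₗ_apply_apply]
  push_cast
  ring

/-- This is the symbol of the square function, with a = |2πξ|². Splitting at σ = 1/a, the bound 1 −
e^{−σa} ≤ σa below and 1 − e^{−σa} ≤ 1 above each contribute a. -/
theorem lintegral_heat_multiplier_le {a : ℝ} (ha : 0 ≤ a) :
    ∫⁻ σ in Ioi (0 : ℝ), ENNReal.ofReal ((1 - Real.exp (-(σ * a))) ^ 2) * ENNReal.ofReal ((σ ^ 2)⁻¹)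
      ≤ ENNReal.ofReal (2 * a) := by
  rcases ha.eq_or_lt with rfl | ha
  · simp
  have h1 : ∀ σ : ℝ, 0 < σ → 0 ≤ 1 - Real.exp (-(σ * a)) ∧ 1 - Real.exp (-(σ * a)) ≤ 1 ∧
      1 - Real.exp (-(σ * a)) ≤ σ * a := by
    intro σ hσ
    refine ⟨?_, ?_, ?_⟩
    · rw [sub_nonneg, Real.exp_le_one_iff]; nlinarith [mul_pos hσ ha]
    · linarith [Real.exp_pos (-(σ * a))]
    · linarith [Real.add_one_le_exp (-(σ * a))]
  have hc : 0 < a⁻¹ := inv_pos.mpr ha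
  rw [← Ioc_union_Ioi_eq_Ioi hc.le]
  refine (lintegral_union_le _ _ _).trans ?_
  rw [two_mul, ENNReal.ofReal_add ha.le ha.le]
  refine add_le_add ?_ ?_
  · calc _ ≤ ∫⁻ σ in Ioc (0 : ℝ) a⁻¹, ENNReal.ofReal (a ^ 2) := by
          refine setLIntegral_mono measurable_const fun σ hσ => ?_
          rw [← ENNReal.ofReal_mul (by positivity)]
          refine ENNReal.ofReal_le_ofReal ?_
          obtain ⟨h0, -, h2⟩ := h1 σ hσ.1
          have := hσ.1
          rw [← div_eq_mul_inv, div_le_iff₀ (by positivity)]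
          calc _ ≤ (σ * a) ^ 2 := by gcongr
            _ = _ := by ring
      _ = _ := by
          rw [setLIntegral_const, Real.volume_Ioc, ← ENNReal.ofReal_mul (by positivity)]
          congr 1; field_simp; ring
  · calc _ ≤ ∫⁻ σ in Ioi a⁻¹, ENNReal.ofReal (σ ^ (-2 : ℝ)) := by
          refine setLIntegral_mono (by fun_prop) fun σ hσ => ?_
          have hσ0 : 0 < σ := hc.trans hσ
          obtain ⟨h0, h2, -⟩ := h1 σ hσ0
          rw [← ENNReal.ofReal_mul (by positivity), Real.rpow_neg hσ0.le, Real.rpow_two]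
          refine ENNReal.ofReal_le_ofReal ?_
          exact mul_le_of_le_one_left (by positivity) (pow_le_one₀ h0 h2)
      _ = _ := by
          rw [← ofReal_integral_eq_lintegral_ofReal (integrableOn_Ioi_rpow_of_lt (by norm_num) hc),
            integral_Ioi_rpow_of_lt (by norm_num) hc]
          · congr 1
            norm_num
            rw [Real.rpow_neg_one, inv_inv]
          · refine (ae_restrict_mem measurableSet_Ioi).mono fun σ hσ => ?_
            have hσ0 : 0 < σ := hc.trans hσ
            positivity

/-! ### The energy -/

/-- The (squared) square function of the heat flow. -/
def squareFunction (f : R4 → ℂ) (x : R4) : ℝ≥0∞ :=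
  ∫⁻ σ in Ioi (0 : ℝ), ‖f x - heat σ f x‖ₑ ^ 2 * ENNReal.ofReal ((σ ^ 2)⁻¹)

/-- `f` has energy at most `E`: the three consequences of `‖∇f‖²_{L²} ≤ E` that are used below, for
translations, for the heat flow, and for the square function of the heat flow. -/
structure EnergyBound (f : R4 → ℂ) (E : ℝ≥0∞) : Prop where
  translate : ∀ y, ∫⁻ x, ‖f x - f (x - y)‖ₑ ^ 2 ≤ ‖y‖ₑ ^ 2 * E
  heat : ∀ s : ℝ, 0 < s → ∫⁻ x, ‖f x - heat s f x‖ₑ ^ 2 ≤ ENNReal.ofReal s * E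
  square : ∫⁻ x, squareFunction f x ≤ 2 * E

theorem EnergyBound.mono {f : R4 → ℂ} {E E' : ℝ≥0∞} (h : EnergyBound f E) (hE : E ≤ E') :
    EnergyBound f E' :=
  ⟨fun y => (h.translate y).trans (by gcongr), fun s hs => (h.heat s hs).trans (by gcongr),
    h.square.trans (by gcongr)⟩

theorem measurable_square_integrand {f : R4 → ℂ} (hf : Measurable f) :
    Measurable (fun p : R4 × ℝ => ‖f p.1 - heat p.2 f p.1‖ₑ ^ 2 * ENNReal.ofReal ((p.2 ^ 2)⁻¹)) := by
  have := measurable_heat_uncurry hf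
  exact ((((hf.comp measurable_fst).sub this).enorm).pow_const 2).mul (by fun_prop)

theorem measurable_squareFunction {f : R4 → ℂ} (hf : Measurable f) :
    Measurable (squareFunction f) :=
  Measurable.lintegral_prod_right' (ν := volume.restrict (Ioi (0 : ℝ)))
    (measurable_square_integrand hf)

theorem lintegral_square_swap {f : R4 → ℂ} (hf : Measurable f) :
    ∫⁻ x, squareFunction f x =
    ∫⁻ σ in Ioi (0 : ℝ), (∫⁻ x, ‖f x - heat σ f x‖ₑ ^ 2) * ENNReal.ofReal ((σ ^ 2)⁻¹) := by
  unfold squareFunction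
  rw [lintegral_lintegral_swap (measurable_square_integrand hf).aemeasurable]
  congr 1; ext σ
  rw [lintegral_mul_const' _ _ ENNReal.ofReal_ne_top]

/-- `f` and `G j`, `j : Fin 4`, lie in `L¹ ∩ L²` and `G j` is the `j`-th weak derivative of `f`,
expressed on the Fourier side. -/
structure HasFourierGradient (f : R4 → ℂ) (G : Fin 4 → R4 → ℂ) : Prop where
  measurable : Measurable f
  integrable : Integrable f
  memLp : MemLp f 2
  measurable_grad : ∀ j, Measurable (G j)
  integrable_grad : ∀ j, Integrable (G j)
  memLp_grad : ∀ j, MemLp (G j) 2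
  fourier_grad : ∀ j, ∀ᵐ ξ : R4, 𝓕 (G j) ξ = 2 * Real.pi * Complex.I * (ξ j : ℂ) * 𝓕 f ξ

/-- `∑ⱼ ‖Gⱼ‖²_{L²}`. -/
def gradEnergy (G : Fin 4 → R4 → ℂ) : ℝ≥0∞ := ∑ j, ∫⁻ x, ‖G j x‖ₑ ^ 2

/-! ### Energy bounds from Plancherel's identity -/

theorem integrable_heat {s : ℝ} (hs : 0 < s) {f : R4 → ℂ} (hf : Measurable f)
    (h : Integrable f) : Integrable (heat s f) :=
  ⟨(measurable_heat s hf).aestronglyMeasurable,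
    (lintegral_enorm_heat_le hs hf).trans_lt h.hasFiniteIntegral⟩

theorem memLp_two_iff {f : R4 → ℂ} (hf : Measurable f) : MemLp f 2 ↔ ∫⁻ x, ‖f x‖ₑ ^ 2 < ∞ := by
  rw [← eLpNorm_two_sq]
  refine ⟨fun h => ENNReal.pow_lt_top h.2, fun h => ⟨hf.aestronglyMeasurable, ?_⟩⟩
  by_contra h2
  simp [not_lt_top_iff.mp h2] at h

theorem memLp_heat {s : ℝ} (hs : 0 < s) {f : R4 → ℂ} (hf : Measurable f)
    (h : MemLp f 2) : MemLp (heat s f) 2 :=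
  (memLp_two_iff (measurable_heat s hf)).mpr
    ((lintegral_enorm_heat_sq_le hs hf).trans_lt ((memLp_two_iff hf).mp h))

theorem HasFourierGradient.heat {f : R4 → ℂ} {G : Fin 4 → R4 → ℂ} (h : HasFourierGradient f G)
    {s : ℝ} (hs : 0 < s) : HasFourierGradient (heat s f) (fun j => NLS.heat s (G j)) where
  measurable := measurable_heat s h.measurable
  integrable := integrable_heat hs h.measurable h.integrable
  memLp := memLp_heat hs h.measurable h.memLp
  measurable_grad j := measurable_heat s (h.measurable_grad j)
  integrable_grad j := integrable_heat hs (h.measurable_grad j) (h.integrable_grad j)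
  memLp_grad j := memLp_heat hs (h.measurable_grad j) (h.memLp_grad j)
  fourier_grad j := by
    filter_upwards [h.fourier_grad j] with ξ hξ
    rw [fourier_heat hs (h.integrable_grad j), fourier_heat hs h.integrable, hξ]
    ring

theorem HasFourierGradient.lintegral_fourier {f : R4 → ℂ} {G : Fin 4 → R4 → ℂ}
    (h : HasFourierGradient f G) :
    ∫⁻ ξ, ENNReal.ofReal ((2 * Real.pi * ‖ξ‖) ^ 2) * ‖𝓕 f ξ‖ₑ ^ 2 = gradEnergy G := by
  have h1 : ∀ᵐ ξ : R4, ∀ j, 𝓕 (G j) ξ = 2 * Real.pi * Complex.I * (ξ j : ℂ) * 𝓕 f ξ :=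
    ae_all_iff.mpr h.fourier_grad
  unfold gradEnergy
  simp only [← lintegral_enorm_fourier_sq (h.integrable_grad _) (h.memLp_grad _)]
  rw [← lintegral_finsetSum' _ fun j _ =>
    ((continuous_fourier (h.integrable_grad j)).measurable.enorm.pow_const 2).aemeasurable]
  refine lintegral_congr_ae ?_
  filter_upwards [h1] with ξ hξ
  simp only [hξ, enorm_mul, mul_pow, ← Finset.sum_mul]
  congr 1
  have h2 : ∀ j, ‖(2 : ℂ)‖ₑ ^ 2 * ‖(Real.pi : ℂ)‖ₑ ^ 2 * ‖Complex.I‖ₑ ^ 2 * ‖(ξ j : ℂ)‖ₑ ^ 2 =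
      ENNReal.ofReal ((2 * Real.pi) ^ 2 * ‖ξ j‖ ^ 2) := by
    intro j
    simp only [← mul_pow, ← enorm_mul]
    rw [← ofReal_norm, ← ENNReal.ofReal_pow (norm_nonneg _)]
    congr 2
    simp [abs_of_pos Real.pi_pos]
  simp only [h2]
  rw [← ENNReal.ofReal_sum_of_nonneg (fun j _ => by positivity), ← Finset.mul_sum,
    ← EuclideanSpace.norm_sq_eq, ← mul_pow]

theorem lintegral_fourier_multiplier_le {f D : R4 → ℂ} (hD : Integrable D) (hD2 : MemLp D 2)
    {m : R4 → ℝ} {c : ℝ} (hc : 0 ≤ c)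
    (h : ∀ ξ, ‖𝓕 D ξ‖ = m ξ * ‖𝓕 f ξ‖) (hm : ∀ ξ, m ξ ^ 2 ≤ c * (2 * Real.pi * ‖ξ‖) ^ 2) :
    ∫⁻ x, ‖D x‖ₑ ^ 2 ≤ ENNReal.ofReal c *
      ∫⁻ ξ, ENNReal.ofReal ((2 * Real.pi * ‖ξ‖) ^ 2) * ‖𝓕 f ξ‖ₑ ^ 2 := by
  rw [← lintegral_enorm_fourier_sq hD hD2, ← lintegral_const_mul' _ _ ENNReal.ofReal_ne_top]
  refine lintegral_mono fun ξ => ?_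
  rw [← ofReal_norm (𝓕 D ξ), h, ← ENNReal.ofReal_pow (by rw [← h]; positivity), ← ofReal_norm (𝓕 f ξ),
    ← ENNReal.ofReal_pow (by positivity), ← ENNReal.ofReal_mul (by positivity),
    ← ENNReal.ofReal_mul hc, mul_pow, ← mul_assoc]
  gcongr
  exact hm ξ

theorem fourier_sub {f g : R4 → ℂ} (hf : Integrable f) (hg : Integrable g) (ξ : R4) :
    𝓕 (fun x => f x - g x) ξ = 𝓕 f ξ - 𝓕 g ξ := by
  simp only [Real.fourier_eq, smul_sub]
  exact integral_sub (by simpa using (Real.fourierIntegral_convergent_iff ξ).mpr hf)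
    (by simpa using (Real.fourierIntegral_convergent_iff ξ).mpr hg)

theorem HasFourierGradient.norm_fourier_sub_heat {f : R4 → ℂ} {G : Fin 4 → R4 → ℂ}
    (h : HasFourierGradient f G) {s : ℝ} (hs : 0 < s) (ξ : R4) :
    ‖𝓕 (fun x => f x - NLS.heat s f x) ξ‖ =
      (1 - Real.exp (-(s * (2 * Real.pi * ‖ξ‖) ^ 2))) * ‖𝓕 f ξ‖ := by
  rw [fourier_sub h.integrable (h.heat hs).integrable, fourier_heat hs h.integrable, ← one_sub_mul,
    norm_mul]
  congr 1
  rw [← Complex.ofReal_one, ← Complex.ofReal_sub, Complex.norm_real, Real.norm_of_nonneg]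
  rw [sub_nonneg, Real.exp_le_one_iff]
  exact neg_nonpos.mpr (by positivity)

/-- All three quantities are Fourier multipliers dominated by |2πξ|²: |e^{iθ} − 1| ≤ |θ| for
translations, (1 − e^{−a})² ≤ a for the heat flow, and the integral of the latter against dσ/σ² for
the square function. -/
theorem HasFourierGradient.energyBound {f : R4 → ℂ} {G : Fin 4 → R4 → ℂ}
    (h : HasFourierGradient f G) : EnergyBound f (gradEnergy G) := by
  rw [← h.lintegral_fourier]
  have hheat : ∀ s : ℝ, 0 < s → ∫⁻ x, ‖f x - NLS.heat s f x‖ₑ ^ 2 =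
      ∫⁻ ξ, ENNReal.ofReal ((1 - Real.exp (-(s * (2 * Real.pi * ‖ξ‖) ^ 2))) ^ 2) * ‖𝓕 f ξ‖ₑ ^ 2 := by
    intro s hs
    rw [← lintegral_enorm_fourier_sq (f := fun x => f x - NLS.heat s f x)
      (h.integrable.sub (h.heat hs).integrable) (h.memLp.sub (h.heat hs).memLp)]
    congr 1; ext ξ
    have h1 := h.norm_fourier_sub_heat hs ξ
    have h2 : 0 ≤ 1 - Real.exp (-(s * (2 * Real.pi * ‖ξ‖) ^ 2)) := by
      rw [sub_nonneg, Real.exp_le_one_iff]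
      exact neg_nonpos.mpr (by positivity)
    rw [← ofReal_norm, ← ofReal_norm, ← ENNReal.ofReal_pow (norm_nonneg _),
      ← ENNReal.ofReal_pow (norm_nonneg _), ← ENNReal.ofReal_mul (by positivity), ← mul_pow, ← h1]
  refine ⟨fun y => ?_, fun s hs => ?_, ?_⟩
  · have hi : Integrable (fun x => f (x - y)) := h.integrable.comp_sub_right y
    have hm : MemLp (fun x => f (x - y)) 2 :=
      h.memLp.comp_measurePreserving (measurePreserving_sub_right volume y)
    have := lintegral_fourier_multiplier_le (f := f) (D := fun x => f x - f (x - y))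
      (m := fun ξ => ‖Complex.exp (Complex.I * (-(2 * Real.pi * inner ℝ y ξ) : ℝ)) - 1‖)
      (c := ‖y‖ ^ 2) (h.integrable.sub hi) (h.memLp.sub hm) (by positivity) ?_ ?_
    · rw [ENNReal.ofReal_pow (norm_nonneg _), ofReal_norm] at this
      exact this
    · intro ξ
      rw [fourier_sub h.integrable hi, fourier_translate, ← one_sub_mul, norm_mul, norm_sub_rev]
    · intro ξ
      have h1 := Real.norm_exp_I_mul_ofReal_sub_one_le (x := -(2 * Real.pi * inner ℝ y ξ))
      have h2 : ‖-(2 * Real.pi * inner ℝ y ξ)‖ ≤ ‖y‖ * (2 * Real.pi * ‖ξ‖) := by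
        rw [norm_neg, norm_mul, Real.norm_of_nonneg (by positivity)]
        have := norm_inner_le_norm (𝕜 := ℝ) y ξ
        nlinarith [Real.pi_pos]
      rw [← mul_pow]
      exact pow_le_pow_left₀ (norm_nonneg _) (h1.trans h2) 2
  · refine lintegral_fourier_multiplier_le (h.integrable.sub (h.heat hs).integrable)
      (h.memLp.sub (h.heat hs).memLp) hs.le (h.norm_fourier_sub_heat hs) fun ξ => ?_
    have h0 : 0 ≤ s * (2 * Real.pi * ‖ξ‖) ^ 2 := by positivity
    have h1 : Real.exp (-(s * (2 * Real.pi * ‖ξ‖) ^ 2)) ≤ 1 := by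
      rw [Real.exp_le_one_iff]; linarith
    have h2 := Real.add_one_le_exp (-(s * (2 * Real.pi * ‖ξ‖) ^ 2))
    have h3 := Real.exp_pos (-(s * (2 * Real.pi * ‖ξ‖) ^ 2))
    nlinarith
  · rw [lintegral_square_swap h.measurable]
    have hmeas : Measurable (fun p : ℝ × R4 => ENNReal.ofReal
        ((1 - Real.exp (-(p.1 * (2 * Real.pi * ‖p.2‖) ^ 2))) ^ 2) * ‖𝓕 f p.2‖ₑ ^ 2 *
        ENNReal.ofReal ((p.1 ^ 2)⁻¹)) := by
      have := (continuous_fourier h.integrable).measurable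
      fun_prop
    calc _ = ∫⁻ σ in Ioi (0 : ℝ), ∫⁻ ξ, ENNReal.ofReal
          ((1 - Real.exp (-(σ * (2 * Real.pi * ‖ξ‖) ^ 2))) ^ 2) * ‖𝓕 f ξ‖ₑ ^ 2 *
            ENNReal.ofReal ((σ ^ 2)⁻¹) := by
          refine setLIntegral_congr_fun measurableSet_Ioi fun σ hσ => ?_
          rw [hheat σ hσ, lintegral_mul_const' _ _ ENNReal.ofReal_ne_top]
      _ = ∫⁻ ξ, ∫⁻ σ in Ioi (0 : ℝ), ENNReal.ofReal
          ((1 - Real.exp (-(σ * (2 * Real.pi * ‖ξ‖) ^ 2))) ^ 2) * ‖𝓕 f ξ‖ₑ ^ 2 *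
            ENNReal.ofReal ((σ ^ 2)⁻¹) := lintegral_lintegral_swap hmeas.aemeasurable
      _ ≤ ∫⁻ ξ, ENNReal.ofReal (2 * (2 * Real.pi * ‖ξ‖) ^ 2) * ‖𝓕 f ξ‖ₑ ^ 2 := by
          refine lintegral_mono fun ξ => ?_
          simp only [mul_right_comm _ (‖𝓕 f ξ‖ₑ ^ 2)]
          rw [lintegral_mul_const' _ _ (by finiteness)]
          gcongr
          exact lintegral_heat_multiplier_le (by positivity)
      _ = _ := by
          rw [← lintegral_const_mul' _ _ (by simp)]
          congr 1; ext ξ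
          rw [ENNReal.ofReal_mul (by norm_num), ENNReal.ofReal_ofNat, mul_assoc]

/-- Energy bounds pass to pointwise limits. -/
theorem EnergyBound.of_tendsto {f : R4 → ℂ} {fn : ℕ → R4 → ℂ} {En : ℕ → ℝ≥0∞} {E : ℝ≥0∞}
    (hm : ∀ n, Measurable (fn n)) (hE : ∀ n, EnergyBound (fn n) (En n))
    (hlim : ∀ x, Tendsto (fun n => fn n x) atTop (𝓝 (f x)))
    (hheat : ∀ s : ℝ, 0 < s → ∀ x, Tendsto (fun n => NLS.heat s (fn n) x) atTop (𝓝 (NLS.heat s f x)))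
    (hEn : Tendsto En atTop (𝓝 E)) : EnergyBound f E := by
  have hsq : ∀ {a : ℕ → ℂ} {b : ℂ}, Tendsto a atTop (𝓝 b) →
      ‖b‖ₑ ^ 2 = liminf (fun n => ‖a n‖ₑ ^ 2) atTop := fun h =>
    ((ENNReal.continuous_pow 2).tendsto _ |>.comp h.enorm).liminf_eq.symm
  -- Each bound is Fatou's lemma for squares of convergent differences. The square function needs it
  -- twice, in σ and then in x.
  refine ⟨fun y => ?_, fun s hs => ?_, ?_⟩
  · calc _ = ∫⁻ x, liminf (fun n => ‖fn n x - fn n (x - y)‖ₑ ^ 2) atTop := by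
          congr 1; ext x; exact hsq ((hlim x).sub (hlim (x - y)))
      _ ≤ liminf (fun n => ∫⁻ x, ‖fn n x - fn n (x - y)‖ₑ ^ 2) atTop :=
          lintegral_liminf_le fun n =>
            ((hm n).sub ((hm n).comp (measurable_id.sub_const y))).enorm.pow_const 2
      _ ≤ liminf (fun n => ‖y‖ₑ ^ 2 * En n) atTop :=
          liminf_le_liminf (Eventually.of_forall fun n => (hE n).translate y)
      _ = _ := (ENNReal.Tendsto.const_mul hEn (Or.inr (by simp))).liminf_eq
  · calc _ = ∫⁻ x, liminf (fun n => ‖fn n x - NLS.heat s (fn n) x‖ₑ ^ 2) atTop := by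
          congr 1; ext x; exact hsq ((hlim x).sub (hheat s hs x))
      _ ≤ liminf (fun n => ∫⁻ x, ‖fn n x - NLS.heat s (fn n) x‖ₑ ^ 2) atTop :=
          lintegral_liminf_le fun n => ((hm n).sub (measurable_heat s (hm n))).enorm.pow_const 2
      _ ≤ liminf (fun n => ENNReal.ofReal s * En n) atTop :=
          liminf_le_liminf (Eventually.of_forall fun n => (hE n).heat s hs)
      _ = _ := (ENNReal.Tendsto.const_mul hEn (Or.inr (by simp))).liminf_eq
  · have hpt : ∀ x, ∫⁻ σ in Ioi (0 : ℝ), ‖f x - NLS.heat σ f x‖ₑ ^ 2 * ENNReal.ofReal ((σ ^ 2)⁻¹) ≤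
        liminf (fun n => squareFunction (fn n) x) atTop := by
      intro x
      have hmeas : ∀ n, Measurable fun σ : ℝ =>
          ‖fn n x - NLS.heat σ (fn n) x‖ₑ ^ 2 * ENNReal.ofReal ((σ ^ 2)⁻¹) := fun n =>
        Measurable.of_uncurry_left
          (f := fun x (σ : ℝ) => ‖fn n x - NLS.heat σ (fn n) x‖ₑ ^ 2 * ENNReal.ofReal ((σ ^ 2)⁻¹))
          (measurable_square_integrand (hm n))
      refine le_trans (le_of_eq ?_)
        (lintegral_liminf_le (μ := volume.restrict (Ioi (0 : ℝ))) hmeas)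
      refine setLIntegral_congr_fun measurableSet_Ioi fun σ hσ => ?_
      refine (Tendsto.liminf_eq ?_).symm
      refine ENNReal.Tendsto.mul_const ?_ (Or.inr ENNReal.ofReal_ne_top)
      exact (ENNReal.continuous_pow 2).tendsto _ |>.comp ((hlim x).sub (hheat σ hσ x)).enorm
    calc _ ≤ ∫⁻ x, liminf (fun n => squareFunction (fn n) x) atTop := lintegral_mono hpt
      _ ≤ liminf (fun n => ∫⁻ x, squareFunction (fn n) x) atTop :=
          lintegral_liminf_le fun n => measurable_squareFunction (hm n)
      _ ≤ liminf (fun n => 2 * En n) atTop :=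
          liminf_le_liminf (Eventually.of_forall fun n => (hE n).square)
      _ = _ := (ENNReal.Tendsto.const_mul hEn (Or.inr (by simp))).liminf_eq

/-! ### Weak gradients -/

/-- `f ∈ L⁴` with weak partial derivatives `g j ∈ L²`. -/
structure HasWeakGradient (f : R4 → ℂ) (g : Fin 4 → R4 → ℂ) : Prop where
  measurable : Measurable f
  memLp : MemLp f 4
  measurable_grad : ∀ j, Measurable (g j)
  memLp_grad : ∀ j, MemLp (g j) 2
  integral_eq : ∀ j (φ : 𝓢(R4, ℂ)), ∫ x, f x * ∂_{unitVec j} φ x = -∫ x, g j x * φ x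

theorem HasWeakGradient.heatAdmissible {f : R4 → ℂ} {g : Fin 4 → R4 → ℂ} (h : HasWeakGradient f g) :
    HeatAdmissible f :=
  .of_memLp h.measurable (by norm_num) (by norm_num) h.memLp

instance holderTriple_four_four_two : ENNReal.HolderTriple 4 4 2 where
  inv_add_inv_eq_inv := by
    rw [← ENNReal.toReal_eq_toReal_iff' (by simp) (by simp)]
    rw [ENNReal.toReal_add (by simp) (by simp)]
    norm_num

theorem integrable_schwartz_mul {f : R4 → ℂ} {p : ℝ≥0∞} (hp : 1 ≤ p) (hf : MemLp f p)
    (φ : 𝓢(R4, ℂ)) : Integrable (fun x => f x * φ x) := by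
  have : ENNReal.HolderTriple p.conjExponent p 1 := by
    have : ENNReal.HolderConjugate p p.conjExponent := .conjExponent hp
    exact ENNReal.HolderTriple.symm
  have := MemLp.mul' hf (φ.memLp p.conjExponent (μ := volume)) (r := 1)
  simpa [mul_comm] using memLp_one_iff_integrable.mp this

/-- Multiplication of a function with a weak gradient by a Schwartz function. -/
theorem HasWeakGradient.schwartz_mul {f : R4 → ℂ} {g : Fin 4 → R4 → ℂ} (h : HasWeakGradient f g)
    (χ : 𝓢(R4, ℂ)) : HasFourierGradient (fun x => χ x * f x)
      (fun j x => χ x * g j x + ∂_{unitVec j} χ x * f x) := by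
  have hχ : ∀ χ : 𝓢(R4, ℂ), Measurable χ := fun χ => χ.continuous.measurable
  have hi : ∀ χ : 𝓢(R4, ℂ), Integrable (fun x => χ x * f x) := fun χ => by
    simpa [mul_comm] using integrable_schwartz_mul (by norm_num) h.memLp χ
  have hi' : ∀ (χ : 𝓢(R4, ℂ)) j, Integrable (fun x => χ x * g j x) := fun χ j => by
    simpa [mul_comm] using integrable_schwartz_mul (by norm_num) (h.memLp_grad j) χ
  have hm : ∀ χ : 𝓢(R4, ℂ), MemLp (fun x => χ x * f x) 2 := fun χ =>
    MemLp.mul' h.memLp (χ.memLp 4)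
  have hm' : ∀ (χ : 𝓢(R4, ℂ)) j, MemLp (fun x => χ x * g j x) 2 := fun χ j =>
    MemLp.mul' (h.memLp_grad j) (χ.memLp ∞)
  have hG : ∀ j, Integrable (fun x => χ x * g j x + ∂_{unitVec j} χ x * f x) := fun j =>
    (hi' χ j).add (hi _)
  refine ⟨(hχ χ).mul h.measurable, hi χ, hm χ, fun j => ((hχ χ).mul (h.measurable_grad j)).add
    ((hχ _).mul h.measurable), hG, fun j => (hm' χ j).add (hm _), fun j => ?_⟩
  -- By duality: pairing with φ moves the factor 2πiξ_j onto φ, where it becomes −∂_j of 𝓕φ, and the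
  -- weak derivative of f is tested on the product χ·𝓕φ.
  refine ae_eq_of_integral_mul_schwartz_eq (continuous_fourier (hG j)).locallyIntegrable
    (Continuous.locallyIntegrable ?_) fun φ => ?_
  · have := continuous_fourier (hi χ)
    fun_prop
  set ψ := 𝓕 φ with hψ
  have hlin : (fun x : R4 => inner ℝ x (unitVec j)).HasTemperateGrowth :=
    ((innerSL ℝ).flip (unitVec j)).hasTemperateGrowth
  have hdψ : ∂_{unitVec j} ψ = 𝓕 (-(2 * Real.pi * Complex.I) •
      SchwartzMap.smulLeftCLM ℂ (fun x : R4 => inner ℝ x (unitVec j)) φ) :=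
    SchwartzMap.lineDerivOp_fourier_eq φ (unitVec j)
  set χψ := SchwartzMap.smulLeftCLM ℂ χ ψ with hχψ
  have hχψ_apply : ∀ x, χψ x = χ x * ψ x := fun x => by
    rw [hχψ, SchwartzMap.smulLeftCLM_apply_apply χ.hasTemperateGrowth, smul_eq_mul]
  have hdχψ : ∀ x, ∂_{unitVec j} χψ x = χ x * ∂_{unitVec j} ψ x + ∂_{unitVec j} χ x * ψ x := by
    intro x
    rw [SchwartzMap.lineDerivOp_apply_eq_fderiv, SchwartzMap.lineDerivOp_apply_eq_fderiv,
      SchwartzMap.lineDerivOp_apply_eq_fderiv]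
    have : (χψ : R4 → ℂ) = fun x => χ x * ψ x := funext hχψ_apply
    rw [this, fderiv_fun_mul χ.differentiableAt ψ.differentiableAt]
    simp [mul_comm]
  have hweak := h.integral_eq j χψ
  simp only [hdχψ, hχψ_apply] at hweak
  have hcomm : ∀ (χ ψ : 𝓢(R4, ℂ)), Integrable (fun x => f x * (χ x * ψ x)) := by
    intro χ ψ
    have := (integrable_schwartz_mul (by norm_num) h.memLp (SchwartzMap.smulLeftCLM ℂ χ ψ))
    simpa [SchwartzMap.smulLeftCLM_apply_apply χ.hasTemperateGrowth] using this
  have hcomm' : Integrable (fun x => g j x * (χ x * ψ x)) := by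
    have := (integrable_schwartz_mul (by norm_num) (h.memLp_grad j) (SchwartzMap.smulLeftCLM ℂ χ ψ))
    simpa [SchwartzMap.smulLeftCLM_apply_apply χ.hasTemperateGrowth] using this
  have hL : ∫ x, (χ x * g j x + ∂_{unitVec j} χ x * f x) * ψ x =
      -∫ x, χ x * f x * ∂_{unitVec j} ψ x := by
    have e1 : ∫ x, f x * (χ x * ∂_{unitVec j} ψ x + ∂_{unitVec j} χ x * ψ x) =
        (∫ x, χ x * f x * ∂_{unitVec j} ψ x) + ∫ x, f x * (∂_{unitVec j} χ x * ψ x) := by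
      rw [← integral_add]
      · congr 1; ext x; ring
      · exact (hcomm χ (∂_{unitVec j} ψ)).congr (ae_of_all _ fun x => by simp only; ring)
      · exact hcomm (∂_{unitVec j} χ) ψ
    have e2 : ∫ x, (χ x * g j x + ∂_{unitVec j} χ x * f x) * ψ x =
        (∫ x, g j x * (χ x * ψ x)) + ∫ x, f x * (∂_{unitVec j} χ x * ψ x) := by
      rw [← integral_add hcomm' (hcomm _ _)]
      congr 1; ext x; ring
    rw [e1] at hweak
    rw [e2]
    linear_combination hweak
  rw [integral_fourier_mul_schwartz (hG j), hL, hdψ, ← integral_fourier_mul_schwartz (hi χ),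
    ← integral_neg]
  congr 1
  ext ξ
  rw [smul_apply, SchwartzMap.smulLeftCLM_apply_apply hlin]
  simp only [smul_eq_mul, Complex.real_smul, unitVec, EuclideanSpace.inner_single_right]
  simp
  ring

/-- `e^{rΔ} f` for `r > 0`, and `f` for `r = 0`. -/
def heatOrSelf (r : ℝ) (f : R4 → ℂ) : R4 → ℂ := if 0 < r then heat r f else f

theorem heatOrSelf_zero (f : R4 → ℂ) : heatOrSelf 0 f = f := by simp [heatOrSelf]

theorem heatOrSelf_of_pos {r : ℝ} (hr : 0 < r) (f : R4 → ℂ) : heatOrSelf r f = heat r f := by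
  simp [heatOrSelf, hr]

theorem tendsto_heat {f : R4 → ℂ} {fn : ℕ → R4 → ℂ} (hf : HeatAdmissible f)
    (hm : ∀ n, Measurable (fn n)) (hle : ∀ n x, ‖fn n x‖ ≤ ‖f x‖)
    (hlim : ∀ x, Tendsto (fun n => fn n x) atTop (𝓝 (f x))) {z : ℂ} (hz : 0 < z.re) (x : R4) :
    Tendsto (fun n => heat z (fn n) x) atTop (𝓝 (heat z f x)) := by
  refine tendsto_integral_of_dominated_convergence _ (fun n => ?_)
    (hf.integrable_heatKernel hz x).norm (fun n => ae_of_all _ fun y => ?_)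
    (ae_of_all _ fun y => (hlim y).const_mul _)
  · exact ((continuous_heatKernel z).comp (continuous_const.sub continuous_id)).aestronglyMeasurable.mul
      (hm n).aestronglyMeasurable
  · rw [norm_mul, norm_mul]
    gcongr
    exact hle n y

theorem eLpNorm_heatOrSelf_le (r : ℝ) {f : R4 → ℂ} (hf : Measurable f) :
    eLpNorm (heatOrSelf r f) 2 volume ≤ eLpNorm f 2 volume := by
  unfold heatOrSelf
  split_ifs with hr
  · have := lintegral_enorm_heat_sq_le hr hf
    rw [← eLpNorm_two_sq, ← eLpNorm_two_sq] at this
    exact (ENNReal.pow_le_pow_left_iff (by norm_num)).mp this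
  · exact le_rfl

theorem heatOrSelf_sub (r : ℝ) {f g : R4 → ℂ} (hf : HeatAdmissible f) (hg : HeatAdmissible g) :
    heatOrSelf r (fun x => f x - g x) = fun x => heatOrSelf r f x - heatOrSelf r g x := by
  unfold heatOrSelf
  split_ifs with hr
  · ext x; exact hf.heat_sub hg (by simpa) x
  · rfl

theorem measurable_heatOrSelf (r : ℝ) {f : R4 → ℂ} (hf : Measurable f) :
    Measurable (heatOrSelf r f) := by
  unfold heatOrSelf
  split_ifs
  exacts [measurable_heat _ hf, hf]

theorem eLpNorm_heatOrSelf_le_add (r : ℝ) {f g : R4 → ℂ} (hf : HeatAdmissible f)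
    (hg : HeatAdmissible g) :
    eLpNorm (heatOrSelf r f) 2 volume ≤
      eLpNorm (heatOrSelf r g) 2 volume + eLpNorm (fun x => f x - g x) 2 volume := by
  have h1 : heatOrSelf r f = heatOrSelf r g + heatOrSelf r (fun x => f x - g x) := by
    rw [heatOrSelf_sub r hf hg]; ext x; simp
  calc eLpNorm (heatOrSelf r f) 2 volume ≤ eLpNorm (heatOrSelf r g) 2 volume +
        eLpNorm (heatOrSelf r (fun x => f x - g x)) 2 volume := by
        rw [h1]
        exact eLpNorm_add_le (measurable_heatOrSelf r hg.measurable).aestronglyMeasurable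
          (measurable_heatOrSelf r (hf.measurable.sub hg.measurable)).aestronglyMeasurable (by norm_num)
    _ ≤ _ := by gcongr; exact eLpNorm_heatOrSelf_le r (hf.measurable.sub hg.measurable)

/-! ### Gaussian cutoffs -/

/-- The Gaussian cutoff `exp (-‖x‖² / (n + 1))`. -/
def gaussianCutoff (n : ℕ) : 𝓢(R4, ℂ) := gaussianSchwartz (1 / (n + 1)) (by positivity)

theorem gaussianCutoff_apply (n : ℕ) (x : R4) :
    gaussianCutoff n x = (Real.exp (-(1 / (n + 1) * ‖x‖ ^ 2)) : ℝ) := by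
  simp [gaussianCutoff, gaussianSchwartz_apply]

theorem tendsto_one_div_succ : Tendsto (fun n : ℕ => 1 / ((n : ℝ) + 1)) atTop (𝓝 0) :=
  tendsto_one_div_add_atTop_nhds_zero_nat

theorem tendsto_gaussianCutoff (x : R4) : Tendsto (fun n => gaussianCutoff n x) atTop (𝓝 1) := by
  simp only [gaussianCutoff_apply]
  rw [← Complex.ofReal_one]
  refine (Complex.continuous_ofReal.tendsto _).comp ?_
  have := (Real.continuous_exp.tendsto _).comp ((tendsto_one_div_succ.mul_const (‖x‖ ^ 2)).neg)
  simpa [Function.comp_def] using this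

theorem norm_gaussianCutoff_le (n : ℕ) (x : R4) : ‖gaussianCutoff n x‖ ≤ 1 := by
  rw [gaussianCutoff_apply, Complex.norm_real, Real.norm_of_nonneg (by positivity), Real.exp_le_one_iff]
  exact neg_nonpos.mpr (by positivity)

theorem norm_gaussianCutoff_sub_one_le (n : ℕ) (x : R4) : ‖gaussianCutoff n x - 1‖ ≤ 1 := by
  have h1 : Real.exp (-(1 / ((n : ℝ) + 1) * ‖x‖ ^ 2)) ≤ 1 := by
    rw [Real.exp_le_one_iff]; exact neg_nonpos.mpr (by positivity)
  have h2 := Real.exp_pos (-(1 / ((n : ℝ) + 1) * ‖x‖ ^ 2))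
  rw [gaussianCutoff_apply, ← Complex.ofReal_one, ← Complex.ofReal_sub, Complex.norm_real,
    Real.norm_eq_abs, abs_le]
  constructor <;> linarith

theorem norm_lineDeriv_gaussianCutoff_le (n : ℕ) (j : Fin 4) (x : R4) :
    ‖∂_{unitVec j} (gaussianCutoff n) x‖ ≤
      2 * (1 / (n + 1)) * ‖x‖ * Real.exp (-(1 / (n + 1) * ‖x‖ ^ 2)) := by
  rw [SchwartzMap.lineDerivOp_apply_eq_fderiv]
  set b : ℝ := 1 / (n + 1) with hb
  have hb0 : 0 < b := by positivity
  have hfun : (gaussianCutoff n : R4 → ℂ) = fun x => ((Real.exp (-(b * ‖x‖ ^ 2)) : ℝ) : ℂ) :=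
    funext (gaussianCutoff_apply n)
  have h1 : HasFDerivAt (fun x : R4 => -(b * ‖x‖ ^ 2)) (-(b • (2 • innerSL ℝ x))) x :=
    ((hasStrictFDerivAt_norm_sq x).hasFDerivAt.const_mul b).neg
  have h2 : HasFDerivAt (gaussianCutoff n : R4 → ℂ)
      (Complex.ofRealCLM.comp (Real.exp (-(b * ‖x‖ ^ 2)) • -(b • (2 • innerSL ℝ x)))) x := by
    rw [hfun]
    exact Complex.ofRealCLM.hasFDerivAt.comp x h1.exp
  rw [h2.fderiv]
  simp only [ContinuousLinearMap.comp_apply, Complex.ofRealCLM_apply, Complex.norm_real,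
    _root_.smul_apply, _root_.neg_apply, norm_neg, innerSL_apply_apply, nsmul_eq_mul, smul_eq_mul,
    norm_mul]
  rw [Real.norm_of_nonneg (Real.exp_pos _).le, Real.norm_of_nonneg hb0.le]
  have h3 : ‖inner ℝ x (unitVec j)‖ ≤ ‖x‖ := by
    simpa using norm_inner_le_norm (𝕜 := ℝ) x (unitVec j)
  simp only [Nat.cast_ofNat, Real.norm_ofNat]
  calc _ ≤ Real.exp (-(b * ‖x‖ ^ 2)) * (b * (2 * ‖x‖)) := by gcongr
    _ = _ := by ring

/-- The cutoff gradients are bounded in L⁴ by scaling in dimension 4 but do not tend to zero there.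
Their square is at most m·(4b e^{−b|x|²}): the second factor is bounded in L² uniformly in n, while
m ≤ 1 tends to 0 pointwise, so |f|²m tends to 0 in L² and Cauchy–Schwarz concludes. -/
theorem tendsto_lintegral_lineDeriv_gaussianCutoff_mul {f : R4 → ℂ} (hf : Measurable f)
    (h4 : MemLp f 4) (j : Fin 4) :
    Tendsto (fun n => ∫⁻ x, ‖∂_{unitVec j} (gaussianCutoff n) x * f x‖ₑ ^ 2) atTop (𝓝 0) := by
  set b : ℕ → ℝ := fun n => 1 / (n + 1) with hb
  have hb0 : ∀ n, 0 < b n := fun n => by positivity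
  set m : ℕ → R4 → ℝ := fun n x => b n * ‖x‖ ^ 2 * Real.exp (-(b n * ‖x‖ ^ 2)) with hm
  have hm0 : ∀ n x, 0 ≤ m n x := fun n x => by have := hb0 n; positivity
  have hm1 : ∀ n x, m n x ≤ 1 := fun n x => by
    have h1 := Real.add_one_le_exp (b n * ‖x‖ ^ 2)
    simp only [hm]
    rw [Real.exp_neg, ← div_eq_mul_inv, div_le_one (Real.exp_pos _)]
    linarith
  have hmm : ∀ n, Measurable (m n) := fun n => by fun_prop
  have hml : ∀ x, Tendsto (fun n => m n x) atTop (𝓝 0) := fun x => by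
    have h1 : Tendsto (fun n => b n * ‖x‖ ^ 2) atTop (𝓝 0) := by
      simpa [hb] using tendsto_one_div_succ.mul_const (‖x‖ ^ 2)
    have h2 := h1.mul ((Real.continuous_exp.tendsto _).comp h1.neg)
    simpa using h2
  have hf4 : ∫⁻ x, ‖f x‖ₑ ^ 4 < ∞ := by
    have := lintegral_rpow_enorm_lt_top_of_eLpNorm_lt_top (by norm_num) (by norm_num) h4.2
    simpa using this
  have hI : Tendsto (fun n => ∫⁻ x, ‖f x‖ₑ ^ 4 * ENNReal.ofReal (m n x) ^ 2) atTop (𝓝 0) := by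
    have := tendsto_lintegral_of_dominated_convergence (μ := volume)
      (F := fun n x => ‖f x‖ₑ ^ 4 * ENNReal.ofReal (m n x) ^ 2) (f := fun _ => 0)
      (fun x => ‖f x‖ₑ ^ 4) (fun n => (hf.enorm.pow_const 4).mul
        ((ENNReal.measurable_ofReal.comp (hmm n)).pow_const 2))
      (fun n => ae_of_all _ fun x => by
        refine mul_le_of_le_one_right' ?_
        refine pow_le_one₀ (zero_le) ?_
        rw [ENNReal.ofReal_le_one]
        exact hm1 n x) hf4.ne (ae_of_all _ fun x => ?_)
    · simpa using this
    · have h1 : Tendsto (fun n => ENNReal.ofReal (m n x) ^ 2) atTop (𝓝 0) := by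
        have := (ENNReal.continuous_pow 2).tendsto _ |>.comp (ENNReal.tendsto_ofReal (hml x))
        simpa [Function.comp_def] using this
      simpa using ENNReal.Tendsto.const_mul h1 (Or.inr (by finiteness))
  have hK : ∀ n, ∫⁻ x : R4, ENNReal.ofReal (4 * b n * Real.exp (-(b n * ‖x‖ ^ 2))) ^ 2 ≤
      ENNReal.ofReal (16 * Real.pi ^ 2) := by
    intro n
    have hbn := hb0 n
    have h1 : ∀ x : R4, (4 * b n * Real.exp (-(b n * ‖x‖ ^ 2))) ^ 2 ≤
        16 * Real.pi ^ 2 * realHeatKernel (1 / (4 * b n)) x := by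
      intro x
      have e1 : Real.exp (-‖x‖ ^ 2 / (4 * (1 / (4 * b n)))) = Real.exp (-(b n * ‖x‖ ^ 2)) := by
        congr 1; field_simp
      have e2 : Real.exp (-(b n * ‖x‖ ^ 2)) ≤ 1 := by
        rw [Real.exp_le_one_iff]; exact neg_nonpos.mpr (by positivity)
      rw [realHeatKernel, e1]
      calc (4 * b n * Real.exp (-(b n * ‖x‖ ^ 2))) ^ 2
          = 16 * b n ^ 2 * (Real.exp (-(b n * ‖x‖ ^ 2)) * Real.exp (-(b n * ‖x‖ ^ 2))) := by ring
        _ ≤ 16 * b n ^ 2 * (Real.exp (-(b n * ‖x‖ ^ 2)) * 1) := by gcongr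
        _ = _ := by field_simp
    calc _ ≤ ∫⁻ x : R4, ENNReal.ofReal (16 * Real.pi ^ 2) *
          ENNReal.ofReal (realHeatKernel (1 / (4 * b n)) x) := by
          refine lintegral_mono fun x => ?_
          rw [← ENNReal.ofReal_pow (by positivity), ← ENNReal.ofReal_mul (by positivity)]
          exact ENNReal.ofReal_le_ofReal (h1 x)
      _ = _ := by
          rw [lintegral_const_mul' _ _ ENNReal.ofReal_ne_top, lintegral_realHeatKernel (by positivity),
            mul_one]
  have hbound : ∀ n, ∫⁻ x, ‖∂_{unitVec j} (gaussianCutoff n) x * f x‖ₑ ^ 2 ≤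
      (∫⁻ x, ‖f x‖ₑ ^ 4 * ENNReal.ofReal (m n x) ^ 2) ^ (1 / 2 : ℝ) *
        ENNReal.ofReal (16 * Real.pi ^ 2) ^ (1 / 2 : ℝ) := by
    intro n
    have hbn := hb0 n
    have hpt : ∀ x, ‖∂_{unitVec j} (gaussianCutoff n) x * f x‖ₑ ^ 2 ≤
        (‖f x‖ₑ ^ 2 * ENNReal.ofReal (m n x)) *
          ENNReal.ofReal (4 * b n * Real.exp (-(b n * ‖x‖ ^ 2))) := by
      intro x
      rw [enorm_mul, mul_pow, mul_comm, mul_assoc, ← ENNReal.ofReal_mul (hm0 n x)]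
      gcongr
      rw [← ofReal_norm, ← ENNReal.ofReal_pow (norm_nonneg _)]
      refine ENNReal.ofReal_le_ofReal ?_
      calc _ ≤ (2 * b n * ‖x‖ * Real.exp (-(b n * ‖x‖ ^ 2))) ^ 2 := by
            gcongr; exact norm_lineDeriv_gaussianCutoff_le n j x
        _ = _ := by simp only [hm]; ring
    have hH := ENNReal.lintegral_mul_le_Lp_mul_Lq volume Real.HolderConjugate.two_two
      (f := fun x => ‖f x‖ₑ ^ 2 * ENNReal.ofReal (m n x))
      (g := fun x : R4 => ENNReal.ofReal (4 * b n * Real.exp (-(b n * ‖x‖ ^ 2))))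
      ((hf.enorm.pow_const 2).mul (ENNReal.measurable_ofReal.comp (hmm n))).aemeasurable
      (by fun_prop)
    simp only [ENNReal.rpow_two, mul_pow, ← pow_mul] at hH
    refine (lintegral_mono hpt).trans (hH.trans ?_)
    gcongr
    exact hK n
  have hlim : Tendsto (fun n => (∫⁻ x, ‖f x‖ₑ ^ 4 * ENNReal.ofReal (m n x) ^ 2) ^ (1 / 2 : ℝ) *
        ENNReal.ofReal (16 * Real.pi ^ 2) ^ (1 / 2 : ℝ)) atTop (𝓝 0) := by
    have h1 := ((ENNReal.continuous_rpow_const (y := (1 / 2 : ℝ))).tendsto 0).comp hI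
    have h2 := ENNReal.Tendsto.mul_const (b := ENNReal.ofReal (16 * Real.pi ^ 2) ^ (1 / 2 : ℝ)) h1
      (Or.inr (ENNReal.rpow_ne_top_of_nonneg (by norm_num) ENNReal.ofReal_ne_top))
    simpa using h2
  exact tendsto_of_tendsto_of_tendsto_of_le_of_le tendsto_const_nhds hlim (fun n => zero_le) hbound

theorem tendsto_lintegral_gaussianCutoff_sub_one_mul {g : R4 → ℂ} (hg : Measurable g)
    (h2 : MemLp g 2) :
    Tendsto (fun n => ∫⁻ x, ‖(gaussianCutoff n x - 1) * g x‖ₑ ^ 2) atTop (𝓝 0) := by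
  have := tendsto_lintegral_of_dominated_convergence (μ := volume)
    (F := fun n x => ‖(gaussianCutoff n x - 1) * g x‖ₑ ^ 2) (f := fun _ => 0)
    (fun x => ‖g x‖ₑ ^ 2)
    (fun n => ((((gaussianCutoff n).continuous.measurable.sub_const 1).mul hg).enorm.pow_const 2))
    (fun n => ae_of_all _ fun x => by
      refine pow_le_pow_left₀ zero_le ?_ 2
      rw [enorm_le_iff_norm_le, norm_mul]
      exact mul_le_of_le_one_left (norm_nonneg _) (norm_gaussianCutoff_sub_one_le n x))
    ((memLp_two_iff hg).mp h2).ne (ae_of_all _ fun x => ?_)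
  · simpa using this
  · have h1 : Tendsto (fun n => (gaussianCutoff n x - 1) * g x) atTop (𝓝 0) := by
      simpa using ((tendsto_gaussianCutoff x).sub_const 1).mul_const (g x)
    have h2 := (ENNReal.continuous_pow 2).tendsto _ |>.comp h1.enorm
    simpa [Function.comp_def] using h2

/-- A function with a weak gradient, and its heat evolution, satisfy the energy bounds. -/
theorem HasWeakGradient.energyBound_heatOrSelf {f : R4 → ℂ} {g : Fin 4 → R4 → ℂ}
    (h : HasWeakGradient f g) {r : ℝ} (hr : 0 ≤ r) :
    EnergyBound (heatOrSelf r f) (gradEnergy fun j => heatOrSelf r (g j)) := by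
  -- The truncations lie in L¹ ∩ L², where Plancherel applies, and |fn| ≤ |f| gives dominated
  -- convergence of their heat flows.
  set fn : ℕ → R4 → ℂ := fun n x => gaussianCutoff n x * f x with hfn
  set G : ℕ → Fin 4 → R4 → ℂ := fun n j x =>
    gaussianCutoff n x * g j x + ∂_{unitVec j} (gaussianCutoff n) x * f x with hG
  have hgA : ∀ j, HeatAdmissible (g j) := fun j =>
    .of_memLp (h.measurable_grad j) (by norm_num) (by norm_num) (h.memLp_grad j)
  have hFG : ∀ n, HasFourierGradient (fn n) (G n) := fun n => h.schwartz_mul (gaussianCutoff n)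
  have hle : ∀ n x, ‖fn n x‖ ≤ ‖f x‖ := fun n x => by
    simp only [hfn, norm_mul]
    exact mul_le_of_le_one_left (norm_nonneg _) (norm_gaussianCutoff_le n x)
  have hlim : ∀ x, Tendsto (fun n => fn n x) atTop (𝓝 (f x)) := fun x => by
    simpa using (tendsto_gaussianCutoff x).mul_const (f x)
  have hfnA : ∀ n, HeatAdmissible (fn n) := fun n => h.heatAdmissible.mono (hFG n).measurable (hle n)
  have hGA : ∀ n j, HeatAdmissible (G n j) := fun n j =>
    .of_memLp ((hFG n).measurable_grad j) (by norm_num) (by norm_num) ((hFG n).memLp_grad j)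
  set e : ℕ → Fin 4 → ℝ≥0∞ := fun n j => eLpNorm (fun x => G n j x - g j x) 2 volume with he
  have he0 : ∀ j, Tendsto (fun n => e n j) atTop (𝓝 0) := by
    intro j
    have hsq : ∀ (F : R4 → ℂ), eLpNorm F 2 volume = (∫⁻ x, ‖F x‖ₑ ^ 2) ^ (1 / 2 : ℝ) := fun F => by
      rw [← eLpNorm_two_sq, ← ENNReal.rpow_two, ← ENNReal.rpow_mul]; norm_num
    have hroot : ∀ {a : ℕ → ℝ≥0∞}, Tendsto a atTop (𝓝 0) →
        Tendsto (fun n => a n ^ (1 / 2 : ℝ)) atTop (𝓝 0) := fun ha => by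
      simpa [Function.comp_def] using
        ((ENNReal.continuous_rpow_const (y := (1 / 2 : ℝ))).tendsto 0).comp ha
    have h1 := hroot (tendsto_lintegral_gaussianCutoff_sub_one_mul (h.measurable_grad j) (h.memLp_grad j))
    have h2 := hroot (tendsto_lintegral_lineDeriv_gaussianCutoff_mul h.measurable h.memLp j)
    have h3 := h1.add h2
    rw [add_zero] at h3
    refine tendsto_of_tendsto_of_tendsto_of_le_of_le tendsto_const_nhds h3 (fun n => zero_le) fun n => ?_
    simp only [he, ← hsq]
    have : (fun x => G n j x - g j x) = (fun x => (gaussianCutoff n x - 1) * g j x) +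
        fun x => ∂_{unitVec j} (gaussianCutoff n) x * f x := by
      ext x; simp only [hG, Pi.add_apply]; ring
    rw [this]
    refine eLpNorm_add_le ?_ ?_ (by norm_num)
    · exact (((gaussianCutoff n).continuous.measurable.sub_const 1).mul
        (h.measurable_grad j)).aestronglyMeasurable
    · exact ((∂_{unitVec j} (gaussianCutoff n)).continuous.measurable.mul
        h.measurable).aestronglyMeasurable
  -- En dominates the gradient energy of the truncation and converges to the claimed energy, since
  -- the truncated gradients converge in L² and the heat flow contracts L².
  set En : ℕ → ℝ≥0∞ := fun n => ∑ j, (eLpNorm (heatOrSelf r (g j)) 2 volume + e n j) ^ 2 with hEn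
  have hEnlim : Tendsto En atTop (𝓝 (gradEnergy fun j => heatOrSelf r (g j))) := by
    unfold gradEnergy
    refine tendsto_finsetSum _ fun j _ => ?_
    rw [← eLpNorm_two_sq]
    have := (ENNReal.continuous_pow 2).tendsto _ |>.comp
      ((tendsto_const_nhds (x := eLpNorm (heatOrSelf r (g j)) 2 volume)).add (he0 j))
    simpa [Function.comp_def] using this
  have hFG' : ∀ n, HasFourierGradient (heatOrSelf r (fn n)) (fun j => heatOrSelf r (G n j)) := by
    intro n
    rcases hr.eq_or_lt with rfl | hr
    · simpa only [heatOrSelf_zero] using hFG n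
    · simpa only [heatOrSelf_of_pos hr] using (hFG n).heat hr
  have hlim' : ∀ x, Tendsto (fun n => heatOrSelf r (fn n) x) atTop (𝓝 (heatOrSelf r f x)) := by
    rcases hr.eq_or_lt with rfl | hr
    · simpa only [heatOrSelf_zero] using hlim
    · simp only [heatOrSelf_of_pos hr]
      exact tendsto_heat h.heatAdmissible (fun n => (hFG n).measurable) hle hlim (by simpa)
  have hheat' : ∀ s : ℝ, 0 < s → ∀ x, Tendsto (fun n => heat s (heatOrSelf r (fn n)) x) atTop
      (𝓝 (heat s (heatOrSelf r f) x)) := by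
    intro s hs x
    rcases hr.eq_or_lt with rfl | hr
    · simp only [heatOrSelf_zero]
      exact tendsto_heat h.heatAdmissible (fun n => (hFG n).measurable) hle hlim (by simpa) x
    · simp only [heatOrSelf_of_pos hr]
      rw [h.heatAdmissible.heat_heat (by simpa) (by simpa)]
      simp only [(hfnA _).heat_heat (z := s) (w := r) (by simpa) (by simpa)]
      exact tendsto_heat h.heatAdmissible (fun n => (hFG n).measurable) hle hlim
        (by simpa using add_pos hs hr) x
  refine EnergyBound.of_tendsto (fun n => (hFG' n).measurable)
    (fun n => (hFG' n).energyBound.mono ?_) hlim' hheat' hEnlim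
  unfold gradEnergy
  simp only [hEn]
  gcongr with j
  rw [← eLpNorm_two_sq]
  gcongr
  exact eLpNorm_heatOrSelf_le_add r (hGA n j) (hgA j)

theorem HasWeakGradient.energyBound {f : R4 → ℂ} {g : Fin 4 → R4 → ℂ}
    (h : HasWeakGradient f g) : EnergyBound f (gradEnergy g) := by
  simpa only [heatOrSelf_zero] using h.energyBound_heatOrSelf le_rfl

theorem HasWeakGradient.energyBound_heat {f : R4 → ℂ} {g : Fin 4 → R4 → ℂ}
    (h : HasWeakGradient f g) {r : ℝ} (hr : 0 < r) :
    EnergyBound (heat r f) (gradEnergy fun j => heat r (g j)) := by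
  simpa only [heatOrSelf_of_pos hr] using h.energyBound_heatOrSelf hr.le

/-! ### Stability of energy bounds -/

theorem enorm_sub_sq_le (a b : ℂ) : ‖a - b‖ₑ ^ 2 ≤ 2 * ‖a‖ₑ ^ 2 + 2 * ‖b‖ₑ ^ 2 := by
  have h : ‖a - b‖ ^ 2 ≤ 2 * ‖a‖ ^ 2 + 2 * ‖b‖ ^ 2 := by
    have := norm_sub_le a b
    have h0 := norm_nonneg (a - b)
    nlinarith [sq_nonneg (‖a‖ - ‖b‖)]
  have := ENNReal.ofReal_le_ofReal h
  rw [ENNReal.ofReal_add (by positivity) (by positivity), ENNReal.ofReal_mul (by norm_num),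
    ENNReal.ofReal_mul (by norm_num)] at this
  simpa [ENNReal.ofReal_pow, ofReal_norm] using this

/-- The heat flow commutes with translations and with itself, and contracts L². -/
theorem EnergyBound.heat_flow {f : R4 → ℂ} (hf : HeatAdmissible f) {E : ℝ≥0∞} (h : EnergyBound f E)
    {s : ℝ} (hs : 0 < s) : EnergyBound (NLS.heat s f) E := by
  have hs' : 0 < (s : ℂ).re := by simpa
  have key : ∀ σ : ℝ, 0 < σ → ∫⁻ x, ‖NLS.heat s f x - NLS.heat σ (NLS.heat s f) x‖ₑ ^ 2 ≤
      ∫⁻ x, ‖f x - NLS.heat σ f x‖ₑ ^ 2 := by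
    intro σ hσ
    have hσ' : 0 < (σ : ℂ).re := by simpa
    refine le_trans (le_of_eq ?_) (lintegral_enorm_heat_sq_le hs
      (hf.measurable.sub (measurable_heat σ hf.measurable)))
    congr 1; ext x
    rw [hf.heat_heat hσ' hs', add_comm (σ : ℂ), ← hf.heat_heat hs' hσ',
      ← hf.heat_sub (hf.heat hσ') hs']
  refine ⟨fun y => ?_, fun σ hσ => (key σ hσ).trans (h.heat σ hσ), ?_⟩
  · refine le_trans (le_of_eq ?_) ((lintegral_enorm_heat_sq_le hs
      (hf.measurable.sub (hf.measurable.comp (measurable_id.sub_const y)))).trans (h.translate y))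
    have hty : HeatAdmissible (fun x => f (x - y)) := by
      refine ⟨hf.measurable.comp (measurable_id.sub_const y), fun r hr x => ?_⟩
      have := (hf.integrable r hr (x - y)).comp_sub_right y
      refine this.congr (ae_of_all _ fun w => ?_)
      simp only
      congr 2
      abel
    congr 1; ext x
    rw [← heat_translate, ← hf.heat_sub hty hs']
    rfl
  · rw [lintegral_square_swap (measurable_heat s hf.measurable)]
    refine le_trans ?_ h.square
    rw [lintegral_square_swap hf.measurable]
    refine setLIntegral_mono' measurableSet_Ioi fun σ hσ => ?_
    refine mul_le_mul' (key σ hσ) le_rfl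

theorem EnergyBound.sub {f g : R4 → ℂ} (hf : HeatAdmissible f) (hg : HeatAdmissible g) {E : ℝ≥0∞}
    (h : EnergyBound f E) (h' : EnergyBound g E) : EnergyBound (fun x => f x - g x) (4 * E) := by
  have hmul : ∀ {a b c : ℝ≥0∞}, a ≤ c * E → b ≤ c * E → 2 * a + 2 * b ≤ c * (4 * E) := by
    intro a b c h1 h2
    calc 2 * a + 2 * b ≤ 2 * (c * E) + 2 * (c * E) := by gcongr
      _ = _ := by ring
  refine ⟨fun y => ?_, fun s hs => ?_, ?_⟩
  · refine le_trans ?_ (hmul (h.translate y) (h'.translate y))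
    have hm : Measurable fun x => ‖f x - f (x - y)‖ₑ ^ 2 :=
      (hf.measurable.sub (hf.measurable.comp (measurable_id.sub_const y))).enorm.pow_const 2
    rw [← lintegral_const_mul' _ _ (by simp), ← lintegral_const_mul' _ _ (by simp),
      ← lintegral_add_left (hm.const_mul 2)]
    refine lintegral_mono fun x => ?_
    refine le_trans (le_of_eq ?_) (enorm_sub_sq_le (f x - f (x - y)) (g x - g (x - y)))
    congr 2; ring
  · refine le_trans ?_ (hmul (h.heat s hs) (h'.heat s hs))
    have hm : Measurable fun x => ‖f x - NLS.heat s f x‖ₑ ^ 2 :=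
      (hf.measurable.sub (measurable_heat s hf.measurable)).enorm.pow_const 2
    rw [← lintegral_const_mul' _ _ (by simp), ← lintegral_const_mul' _ _ (by simp),
      ← lintegral_add_left (hm.const_mul 2)]
    refine lintegral_mono fun x => ?_
    rw [hf.heat_sub hg (by simpa)]
    refine le_trans (le_of_eq ?_) (enorm_sub_sq_le (f x - NLS.heat s f x) (g x - NLS.heat s g x))
    congr 2; ring
  · refine le_trans ?_ (hmul h.square h'.square)
    rw [← lintegral_const_mul' _ _ (by simp), ← lintegral_const_mul' _ _ (by simp),
      ← lintegral_add_left ((measurable_squareFunction hf.measurable).const_mul 2)]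
    refine lintegral_mono fun x => ?_
    unfold squareFunction
    have hm : Measurable fun σ : ℝ => ‖f x - NLS.heat σ f x‖ₑ ^ 2 * ENNReal.ofReal ((σ ^ 2)⁻¹) :=
      Measurable.of_uncurry_left
        (f := fun x (σ : ℝ) => ‖f x - NLS.heat σ f x‖ₑ ^ 2 * ENNReal.ofReal ((σ ^ 2)⁻¹))
        (measurable_square_integrand hf.measurable)
    rw [← lintegral_const_mul' _ _ (by simp), ← lintegral_const_mul' _ _ (by simp),
      ← lintegral_add_left (hm.const_mul 2)]
    refine setLIntegral_mono' measurableSet_Ioi fun σ hσ => ?_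
    rw [hf.heat_sub hg (by simpa using hσ)]
    rw [← mul_assoc, ← mul_assoc, ← add_mul]
    gcongr
    refine le_trans (le_of_eq ?_) (enorm_sub_sq_le (f x - NLS.heat σ f x) (g x - NLS.heat σ g x))
    congr 2; ring

theorem lintegral_Ioi_comp_mul_left {c : ℝ} (hc : 0 < c) (g : ℝ → ℝ≥0∞) :
    ∫⁻ σ in Ioi (0 : ℝ), g (c * σ) = ENNReal.ofReal c⁻¹ * ∫⁻ σ in Ioi (0 : ℝ), g σ := by
  have e : MeasurableEmbedding (fun x : ℝ => c * x) :=
    (Homeomorph.mulLeft₀ c hc.ne').measurableEmbedding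
  rw [← lintegral_indicator measurableSet_Ioi, ← lintegral_indicator measurableSet_Ioi]
  have h1 : (Ioi (0 : ℝ)).indicator (fun σ => g (c * σ)) =
      fun σ => (Ioi (0 : ℝ)).indicator g (c * σ) := by
    ext σ
    simp only [indicator, mem_Ioi, mul_pos_iff_of_pos_left hc]
  rw [h1, ← e.lintegral_map, Real.map_volume_mul_left hc.ne', lintegral_smul_measure, smul_eq_mul,
    abs_of_pos (inv_pos.mpr hc)]

theorem enorm_rescale {N : ℝ} (hN : 0 < N) (a : R4) (f : R4 → ℂ) (x : R4) :
    ‖rescale N a f x‖ₑ = ENNReal.ofReal N * ‖f (N • x + a)‖ₑ := by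
  rw [rescale, enorm_mul, ← ofReal_norm (N : ℂ), Complex.norm_real, Real.norm_of_nonneg hN.le]

theorem lintegral_enorm_rescale_sq {N : ℝ} (hN : 0 < N) (a : R4) (f : R4 → ℂ) :
    ∫⁻ x, ‖rescale N a f x‖ₑ ^ 2 = ENNReal.ofReal ((N ^ 2)⁻¹) * ∫⁻ x, ‖f x‖ₑ ^ 2 := by
  simp only [enorm_rescale hN, mul_pow]
  rw [lintegral_const_mul' _ _ (by finiteness), lintegral_comp_affine hN a (fun x => ‖f x‖ₑ ^ 2),
    ← mul_assoc, ← ENNReal.ofReal_pow hN.le, ← ENNReal.ofReal_mul (by positivity)]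
  congr 2
  field_simp

theorem rescale_sub (N : ℝ) (a : R4) (f g : R4 → ℂ) :
    rescale N a (fun x => f x - g x) = fun x => rescale N a f x - rescale N a g x := by
  ext x; simp only [rescale, mul_sub]

theorem lintegral_rescale_sub_heat {N : ℝ} (hN : 0 < N) (a : R4) (f : R4 → ℂ) (s : ℝ) :
    ∫⁻ x, ‖rescale N a f x - heat s (rescale N a f) x‖ₑ ^ 2 =
      ENNReal.ofReal ((N ^ 2)⁻¹) * ∫⁻ x, ‖f x - heat (N ^ 2 * s : ℝ) f x‖ₑ ^ 2 := by
  rw [heat_rescale hN, ← lintegral_enorm_rescale_sq hN a, rescale_sub]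

/-- The energy is invariant under the scaling `f ↦ N f (N · + a)`. -/
theorem EnergyBound.rescale {f : R4 → ℂ} (hf : Measurable f) {E : ℝ≥0∞} (h : EnergyBound f E) {N : ℝ}
    (hN : 0 < N) (a : R4) : EnergyBound (rescale N a f) E := by
  refine ⟨fun y => ?_, fun s hs => ?_, ?_⟩
  · have h1 : ∀ x, NLS.rescale N a f x - NLS.rescale N a f (x - y) =
        NLS.rescale N a (fun x => f x - f (x - N • y)) x := by
      intro x
      simp only [NLS.rescale, smul_sub, mul_sub]
      congr 3
      abel
    simp only [h1]
    rw [lintegral_enorm_rescale_sq hN]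
    refine (mul_le_mul_right (h.translate (N • y)) _).trans_eq ?_
    rw [← mul_assoc]
    congr 1
    rw [← ofReal_norm, ← ofReal_norm, norm_smul, ← ENNReal.ofReal_pow (by positivity),
      ← ENNReal.ofReal_pow (by positivity), ← ENNReal.ofReal_mul (by positivity),
      Real.norm_of_nonneg hN.le]
    congr 1
    field_simp
  · rw [lintegral_rescale_sub_heat hN]
    refine (mul_le_mul_right (h.heat (N ^ 2 * s) (by positivity)) _).trans_eq ?_
    rw [← mul_assoc, ← ENNReal.ofReal_mul (by positivity)]
    congr 2
    field_simp
  · rw [lintegral_square_swap (measurable_rescale N a hf)]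
    refine le_trans (le_of_eq ?_) h.square
    rw [lintegral_square_swap hf]
    -- The L² scaling gives N⁻²σ⁻² = N²(N²σ)⁻², and the substitution σ ↦ N²σ then removes the factor
    -- N².
    have h1 : ∀ σ : ℝ, (∫⁻ x, ‖NLS.rescale N a f x - NLS.heat σ (NLS.rescale N a f) x‖ₑ ^ 2) *
          ENNReal.ofReal ((σ ^ 2)⁻¹) = ENNReal.ofReal (N ^ 2) *
        ((∫⁻ x, ‖f x - NLS.heat (N ^ 2 * σ : ℝ) f x‖ₑ ^ 2) *
          ENNReal.ofReal (((N ^ 2 * σ) ^ 2)⁻¹)) := by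
      intro σ
      rw [lintegral_rescale_sub_heat hN, mul_comm (ENNReal.ofReal _), mul_assoc,
        ← ENNReal.ofReal_mul (by positivity), mul_left_comm, ← ENNReal.ofReal_mul (by positivity)]
      congr 2
      rw [mul_pow, mul_inv]
      field_simp
    simp only [h1]
    rw [lintegral_const_mul' _ _ ENNReal.ofReal_ne_top, lintegral_Ioi_comp_mul_left (by positivity)
      (fun σ : ℝ => (∫⁻ x, ‖f x - NLS.heat σ f x‖ₑ ^ 2) * ENNReal.ofReal ((σ ^ 2)⁻¹)),
      ← mul_assoc, ← ENNReal.ofReal_mul (by positivity), mul_inv_cancel₀ (by positivity)]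
    simp

/-! ### Refined Sobolev inequalities -/

/-- A single dyadic block suffices: length c, integrand at least (r/2)²/(2c)². -/
theorem le_squareFunction {f : R4 → ℂ} {x : R4} {r c : ℝ} (hr : 0 ≤ r) (hc : 0 < c)
    (h : ∀ σ ∈ Ioc c (2 * c), r / 2 ≤ ‖f x - heat σ f x‖) :
    ENNReal.ofReal (r ^ 2 / (16 * c)) ≤ squareFunction f x := by
  calc ENNReal.ofReal (r ^ 2 / (16 * c))
      = ∫⁻ _ in Ioc c (2 * c), ENNReal.ofReal ((r / 2) ^ 2 * ((2 * c) ^ 2)⁻¹) := by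
        rw [setLIntegral_const, Real.volume_Ioc, ← ENNReal.ofReal_mul (by positivity)]
        congr 1; field_simp; ring
    _ ≤ ∫⁻ σ in Ioc c (2 * c), ‖f x - heat σ f x‖ₑ ^ 2 * ENNReal.ofReal ((σ ^ 2)⁻¹) := by
        refine setLIntegral_mono' measurableSet_Ioc fun σ hσ => ?_
        have hσ0 : 0 < σ := hc.trans hσ.1
        rw [← ofReal_norm, ← ENNReal.ofReal_pow (norm_nonneg _), ← ENNReal.ofReal_mul (by positivity)]
        refine ENNReal.ofReal_le_ofReal ?_
        have := h σ hσ
        have h2 := hσ.2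
        gcongr
    _ ≤ _ := lintegral_mono_set fun σ hσ => hc.trans hσ.1

/-- After time c = (2A/|f(x)|)² the flow at x is below |f(x)|/2, so the block (c, 2c] contributes
|f(x)|⁴/(64A²). -/
theorem enorm_pow_four_le_squareFunction {f : R4 → ℂ} {A : ℝ} (hA : 0 < A) {x : R4}
    (h : ∀ σ : ℝ, 0 < σ → √σ * ‖heat σ f x‖ ≤ A) :
    ‖f x‖ₑ ^ 4 ≤ ENNReal.ofReal (64 * A ^ 2) * squareFunction f x := by
  rcases (norm_nonneg (f x)).eq_or_lt with h0 | hr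
  · rw [← ofReal_norm, ← h0]; simp
  set r := ‖f x‖
  have hc : 0 < (2 * A / r) ^ 2 := by positivity
  have := le_squareFunction (f := f) (x := x) hr.le hc fun σ hσ => by
    have h1 : 2 * A / r < √σ := by
      have := Real.sqrt_lt_sqrt hc.le hσ.1
      rwa [Real.sqrt_sq (by positivity)] at this
    have h2 := h σ (hc.trans hσ.1)
    have h3 : ‖heat σ f x‖ ≤ r / 2 := by
      rw [div_lt_iff₀ hr] at h1
      nlinarith [norm_nonneg (heat σ f x)]
    have := norm_sub_norm_le (f x) (heat σ f x)
    linarith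
  calc ‖f x‖ₑ ^ 4 = ENNReal.ofReal (64 * A ^ 2) * ENNReal.ofReal (r ^ 2 / (16 * (2 * A / r) ^ 2)) := by
        rw [← ofReal_norm, ← ENNReal.ofReal_pow (norm_nonneg _), ← ENNReal.ofReal_mul (by positivity)]
        congr 1
        change r ^ 4 = _
        field_simp
        norm_num
    _ ≤ _ := by gcongr

/-- The threshold is now c = 2A/|f(x)|. The block (c, 2c] lies inside (0, s] when |f(x)| > 4A/s; for
smaller values one power of |f(x)| is simply bounded by 4A/s. -/
theorem enorm_pow_three_le_squareFunction {f : R4 → ℂ} {A s : ℝ} (hA : 0 < A) (hs : 0 < s) {x : R4}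
    (h : ∀ σ : ℝ, 0 < σ → σ ≤ s → σ * ‖heat σ f x‖ ≤ A) :
    ‖f x‖ₑ ^ 3 ≤ ENNReal.ofReal (32 * A) * squareFunction f x +
      ENNReal.ofReal (4 * A / s) * ‖f x‖ₑ ^ 2 := by
  rcases (norm_nonneg (f x)).eq_or_lt with h0 | hr
  · rw [← ofReal_norm, ← h0]; simp
  set r := ‖f x‖
  by_cases hrs : r ≤ 4 * A / s
  · refine le_add_left ?_
    rw [pow_succ', ← ofReal_norm]
    gcongr
  refine le_add_right ?_
  have hc : 0 < 2 * A / r := by positivity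
  have h4 : 2 * (2 * A / r) ≤ s := by
    rw [not_le, div_lt_iff₀ hs] at hrs
    rw [mul_div_assoc', div_le_iff₀ hr]
    linarith
  have := le_squareFunction (f := f) (x := x) hr.le hc fun σ hσ => by
    have h1 := hσ.1
    have h2 := h σ (hc.trans hσ.1) (hσ.2.trans h4)
    have h3 : ‖heat σ f x‖ ≤ r / 2 := by
      rw [div_lt_iff₀ hr] at h1
      nlinarith [norm_nonneg (heat σ f x)]
    have := norm_sub_norm_le (f x) (heat σ f x)
    linarith
  calc ‖f x‖ₑ ^ 3 = ENNReal.ofReal (32 * A) * ENNReal.ofReal (r ^ 2 / (16 * (2 * A / r))) := by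
        rw [← ofReal_norm, ← ENNReal.ofReal_pow (norm_nonneg _), ← ENNReal.ofReal_mul (by positivity)]
        congr 1
        change r ^ 3 = _
        field_simp
        norm_num
    _ ≤ _ := by gcongr

/-- A Sobolev inequality refined by a Besov-type norm of negative order: the energy controls the
square function, and the pointwise comparison does the rest. -/
theorem EnergyBound.lintegral_pow_four_le {f : R4 → ℂ} {E : ℝ≥0∞} (hE : EnergyBound f E) {A : ℝ}
    (hA : 0 < A) (h : ∀ σ : ℝ, 0 < σ → ∀ x, √σ * ‖NLS.heat σ f x‖ ≤ A) :
    ∫⁻ x, ‖f x‖ₑ ^ 4 ≤ ENNReal.ofReal (128 * A ^ 2) * E := by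
  calc _ ≤ ∫⁻ x, ENNReal.ofReal (64 * A ^ 2) * squareFunction f x :=
        lintegral_mono fun x => enorm_pow_four_le_squareFunction hA fun σ hσ => h σ hσ x
    _ ≤ ENNReal.ofReal (64 * A ^ 2) * (2 * E) := by
        rw [lintegral_const_mul' _ _ ENNReal.ofReal_ne_top]
        gcongr
        exact hE.square
    _ = _ := by
        rw [← mul_assoc, ← ENNReal.ofReal_ofNat 2, ← ENNReal.ofReal_mul (by positivity)]
        congr 2; ring

theorem EnergyBound.lintegral_pow_three_le {f : R4 → ℂ} (hf : Measurable f) {E : ℝ≥0∞}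
    (hE : EnergyBound f E) {A s : ℝ} (hA : 0 < A) (hs : 0 < s)
    (h : ∀ σ : ℝ, 0 < σ → σ ≤ s → ∀ x, σ * ‖NLS.heat σ f x‖ ≤ A) :
    ∫⁻ x, ‖f x‖ₑ ^ 3 ≤ ENNReal.ofReal (64 * A) * E +
      ENNReal.ofReal (4 * A / s) * ∫⁻ x, ‖f x‖ₑ ^ 2 := by
  calc _ ≤ ∫⁻ x, (ENNReal.ofReal (32 * A) * squareFunction f x +
        ENNReal.ofReal (4 * A / s) * ‖f x‖ₑ ^ 2) :=
        lintegral_mono fun x => enorm_pow_three_le_squareFunction hA hs fun σ hσ hσ' => h σ hσ hσ' x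
    _ ≤ ENNReal.ofReal (32 * A) * (2 * E) + ENNReal.ofReal (4 * A / s) * ∫⁻ x, ‖f x‖ₑ ^ 2 := by
        rw [lintegral_add_left ((measurable_squareFunction hf).const_mul _),
          lintegral_const_mul' _ _ ENNReal.ofReal_ne_top, lintegral_const_mul' _ _ ENNReal.ofReal_ne_top]
        gcongr
        exact hE.square
    _ = _ := by
        congr 1
        rw [← mul_assoc, ← ENNReal.ofReal_ofNat 2, ← ENNReal.ofReal_mul (by positivity)]
        congr 2; ring

/-! ### The cubic nonlinearity and the heat flow -/

/-- The pointwise nonlinearity `p ↦ -|p|² p`. -/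
def cubic (p : ℂ) : ℂ := -((‖p‖ : ℂ) ^ 2 * p)

theorem measurable_cubic : Measurable cubic := by
  unfold cubic
  fun_prop

theorem norm_cubic (p : ℂ) : ‖cubic p‖ = ‖p‖ ^ 3 := by
  rw [cubic, norm_neg, norm_mul, norm_pow, Complex.norm_real, norm_norm]
  ring

theorem norm_cubic_sub_le (p q : ℂ) :
    ‖cubic p - cubic q‖ ≤ ‖p - q‖ * (‖p‖ ^ 2 + ‖p‖ * ‖q‖ + ‖q‖ ^ 2) := by
  have h : cubic p - cubic q = -(((‖p‖ ^ 2 : ℝ) : ℂ) * (p - q) +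
      (((‖p‖ - ‖q‖) * (‖p‖ + ‖q‖) : ℝ) : ℂ) * q) := by
    unfold cubic
    push_cast
    ring
  have h1 := abs_norm_sub_norm_le p q
  rw [h, norm_neg]
  refine (norm_add_le _ _).trans ?_
  rw [norm_mul, norm_mul, Complex.norm_real, Complex.norm_real, norm_mul, norm_pow, norm_norm,
    Real.norm_eq_abs (‖p‖ - ‖q‖), Real.norm_of_nonneg (by positivity : 0 ≤ ‖p‖ + ‖q‖)]
  calc _ ≤ ‖p‖ ^ 2 * ‖p - q‖ + ‖p - q‖ * (‖p‖ + ‖q‖) * ‖q‖ := by gcongr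
    _ = _ := by ring

/-- Young's inequality with a free weight: a is measured in L² and b in L⁴, and θ is chosen later to
balance the two sizes. -/
theorem mul_sq_le_weighted {θ : ℝ} (hθ : 0 < θ) (a b : ℝ) :
    a * b ^ 2 ≤ 1 / 2 * (θ * a ^ 2 + θ⁻¹ * b ^ 4) := by
  have h1 : 0 ≤ θ⁻¹ * (θ * a - b ^ 2) ^ 2 := by positivity
  have h2 : θ⁻¹ * (θ * a - b ^ 2) ^ 2 = θ * a ^ 2 - 2 * (a * b ^ 2) + θ⁻¹ * b ^ 4 := by
    field_simp
    ring
  linarith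

/-- Asymmetric on purpose: the perturbation p − q enters in L³ and L², and q alone in L⁴. The mixed
term |p−q|²|q| is absorbed by completing squares. -/
theorem norm_cubic_sub_le_of_perturbation {θ : ℝ} (hθ : 0 < θ) (p q : ℂ) :
    ‖cubic p - cubic q‖ ≤ 3 * ‖p - q‖ ^ 3 + (5 / 2 * θ * ‖p - q‖ ^ 2 + 5 / 2 * θ⁻¹ * ‖q‖ ^ 4) := by
  have h1 := norm_cubic_sub_le p q
  have h2 : ‖p‖ ≤ ‖p - q‖ + ‖q‖ := by simpa using norm_add_le (p - q) q
  have h3 := mul_sq_le_weighted hθ ‖p - q‖ ‖q‖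
  have ha := norm_nonneg (p - q)
  have hq := norm_nonneg q
  set a := ‖p - q‖
  calc _ ≤ a * ((a + ‖q‖) ^ 2 + (a + ‖q‖) * ‖q‖ + ‖q‖ ^ 2) := h1.trans (by gcongr)
    _ = 3 * a ^ 3 + 5 * (a * ‖q‖ ^ 2) - a * (3 / 2 * (a - ‖q‖) ^ 2 + 1 / 2 * a ^ 2 + 1 / 2 * ‖q‖ ^ 2) := by
      ring
    _ ≤ 3 * a ^ 3 + 5 * (a * ‖q‖ ^ 2) := by
      have : 0 ≤ a * (3 / 2 * (a - ‖q‖) ^ 2 + 1 / 2 * a ^ 2 + 1 / 2 * ‖q‖ ^ 2) := by positivity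
      linarith
    _ ≤ _ := by linarith

theorem norm_cubic_sub_le_symm {θ : ℝ} (hθ : 0 < θ) (p q : ℂ) :
    ‖cubic p - cubic q‖ ≤ 3 / 2 * θ * ‖p - q‖ ^ 2 + 3 / 4 * θ⁻¹ * (‖p‖ ^ 4 + ‖q‖ ^ 4) := by
  have h1 := norm_cubic_sub_le p q
  have h2 := mul_sq_le_weighted hθ ‖p - q‖ ‖q‖
  have h3 := mul_sq_le_weighted hθ ‖p - q‖ ‖p‖
  have ha := norm_nonneg (p - q)
  nlinarith [mul_nonneg ha (sq_nonneg (‖p‖ - ‖q‖))]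

theorem enorm_cubic_sub_le_of_perturbation {θ : ℝ} (hθ : 0 < θ) (p q : ℂ) :
    ‖cubic p - cubic q‖ₑ ≤ ENNReal.ofReal 3 * ‖p - q‖ₑ ^ 3 +
      (ENNReal.ofReal (5 / 2 * θ) * ‖p - q‖ₑ ^ 2 + ENNReal.ofReal (5 / 2 * θ⁻¹) * ‖q‖ₑ ^ 4) := by
  simp only [← ofReal_norm]
  rw [← ENNReal.ofReal_pow (norm_nonneg _), ← ENNReal.ofReal_pow (norm_nonneg _),
    ← ENNReal.ofReal_pow (norm_nonneg _), ← ENNReal.ofReal_mul (by positivity),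
    ← ENNReal.ofReal_mul (by positivity), ← ENNReal.ofReal_mul (by positivity),
    ← ENNReal.ofReal_add (by positivity) (by positivity),
    ← ENNReal.ofReal_add (by positivity) (by positivity)]
  exact ENNReal.ofReal_le_ofReal (norm_cubic_sub_le_of_perturbation hθ p q)

theorem enorm_cubic_sub_le_symm {θ : ℝ} (hθ : 0 < θ) (p q : ℂ) :
    ‖cubic p - cubic q‖ₑ ≤ ENNReal.ofReal (3 / 2 * θ) * ‖p - q‖ₑ ^ 2 +
      (ENNReal.ofReal (3 / 4 * θ⁻¹) * ‖p‖ₑ ^ 4 + ENNReal.ofReal (3 / 4 * θ⁻¹) * ‖q‖ₑ ^ 4) := by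
  simp only [← ofReal_norm]
  rw [← ENNReal.ofReal_pow (norm_nonneg _), ← ENNReal.ofReal_pow (norm_nonneg _),
    ← ENNReal.ofReal_pow (norm_nonneg _), ← ENNReal.ofReal_mul (by positivity),
    ← ENNReal.ofReal_mul (by positivity), ← ENNReal.ofReal_mul (by positivity),
    ← ENNReal.ofReal_add (by positivity) (by positivity),
    ← ENNReal.ofReal_add (by positivity) (by positivity), ← mul_add]
  exact ENNReal.ofReal_le_ofReal (norm_cubic_sub_le_symm hθ p q)

/-! ### The nonlinearity in L¹ -/

theorem heatAdmissible_cubic {f : R4 → ℂ} (hf : Measurable f) (h : ∫⁻ x, ‖f x‖ₑ ^ 4 < ∞) :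
    HeatAdmissible (fun x => cubic (f x)) := by
  refine .of_integrable_pow (measurable_cubic.comp hf) (p := 4 / 3) (by norm_num) ?_
  have h1 : ∀ x, ‖cubic (f x)‖ ^ (4 / 3 : ℝ) = ‖f x‖ ^ 4 := by
    intro x
    rw [norm_cubic, ← Real.rpow_natCast, ← Real.rpow_mul (norm_nonneg _), ← Real.rpow_natCast]
    norm_num
  simp only [h1]
  refine ⟨(hf.norm.pow_const 4).aestronglyMeasurable, ?_⟩
  refine lt_of_le_of_lt (le_of_eq ?_) h
  congr 1; ext x
  rw [enorm_pow, enorm_norm]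

theorem lintegral_enorm_cubic_sub_le {f g : R4 → ℂ} (hf : Measurable f) (hg : Measurable g) {θ : ℝ}
    (hθ : 0 < θ) :
    ∫⁻ x, ‖cubic (f x) - cubic (g x)‖ₑ ≤ ENNReal.ofReal 3 * (∫⁻ x, ‖f x - g x‖ₑ ^ 3) +
      (ENNReal.ofReal (5 / 2 * θ) * (∫⁻ x, ‖f x - g x‖ₑ ^ 2) +
        ENNReal.ofReal (5 / 2 * θ⁻¹) * ∫⁻ x, ‖g x‖ₑ ^ 4) := by
  refine (lintegral_mono fun x => enorm_cubic_sub_le_of_perturbation hθ (f x) (g x)).trans_eq ?_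
  have h1 : Measurable fun x => ‖f x - g x‖ₑ ^ 3 := (hf.sub hg).enorm.pow_const 3
  have h2 : Measurable fun x => ‖f x - g x‖ₑ ^ 2 := (hf.sub hg).enorm.pow_const 2
  rw [lintegral_add_left (h1.const_mul _), lintegral_add_left (h2.const_mul _),
    lintegral_const_mul' _ _ ENNReal.ofReal_ne_top, lintegral_const_mul' _ _ ENNReal.ofReal_ne_top,
    lintegral_const_mul' _ _ ENNReal.ofReal_ne_top]

/-- Averages the translation bound over the heat kernel; the resulting weight ‖y‖² is absorbed by
passing to time 2s. -/
theorem EnergyBound.lintegral_lintegral_heatWeight_le {f : R4 → ℂ} (hf : Measurable f) {E : ℝ≥0∞}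
    (hE : EnergyBound f E) {s : ℝ} (hs : 0 < s) :
    ∫⁻ x, ∫⁻ y, ENNReal.ofReal (realHeatKernel s (x - y)) * ‖f x - f y‖ₑ ^ 2 ≤
      ENNReal.ofReal (32 * s) * E := by
  have hk : Measurable fun y => ENNReal.ofReal (realHeatKernel s y) :=
    ENNReal.measurable_ofReal.comp (continuous_realHeatKernel s).measurable
  calc _ = ∫⁻ x, ∫⁻ y, ENNReal.ofReal (realHeatKernel s y) * ‖f x - f (x - y)‖ₑ ^ 2 := by
        congr 1; ext x
        rw [← lintegral_sub_left_eq_self _ x]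
        simp only [sub_sub_cancel]
    _ = ∫⁻ y, ENNReal.ofReal (realHeatKernel s y) * ∫⁻ x, ‖f x - f (x - y)‖ₑ ^ 2 := by
        rw [lintegral_lintegral_swap]
        · congr 1; ext y
          rw [lintegral_const_mul' _ _ ENNReal.ofReal_ne_top]
        · refine Measurable.aemeasurable (Measurable.mul (hk.comp measurable_snd) ?_)
          exact ((hf.comp measurable_fst).sub (hf.comp (by fun_prop))).enorm.pow_const 2
    _ ≤ ∫⁻ y, ENNReal.ofReal (realHeatKernel (2 * s) y) * (ENNReal.ofReal (32 * s) * E) := by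
        refine lintegral_mono fun y => ?_
        refine (mul_le_mul_right (hE.translate y) _).trans ?_
        rw [← mul_assoc, ← mul_assoc]
        refine mul_le_mul' ?_ le_rfl
        rw [← ofReal_norm, ← ENNReal.ofReal_pow (norm_nonneg _),
          ← ENNReal.ofReal_mul (realHeatKernel_nonneg _ _),
          ← ENNReal.ofReal_mul (realHeatKernel_nonneg _ _)]
        refine ENNReal.ofReal_le_ofReal ?_
        have := norm_sq_mul_realHeatKernel_le hs y
        linarith
    _ = _ := by
        rw [lintegral_mul_const, lintegral_realHeatKernel (by positivity), one_mul]
        exact ENNReal.measurable_ofReal.comp (continuous_realHeatKernel _).measurable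

theorem HeatAdmissible.enorm_sub_heat_le {g : R4 → ℂ} (hg : HeatAdmissible g) {s : ℝ} (hs : 0 < s)
    (x : R4) : ‖g x - NLS.heat s g x‖ₑ ≤
      ∫⁻ y, ENNReal.ofReal (realHeatKernel s (x - y)) * ‖g x - g y‖ₑ := by
  have h1 : g x - NLS.heat s g x = ∫ y, heatKernel s (x - y) * (g x - g y) := by
    have h2 : ∫ y, heatKernel s (x - y) = 1 := by
      simp only [heatKernel_ofReal, integral_complex_ofReal, integral_realHeatKernel_sub hs,
        Complex.ofReal_one]
    have h3 : Integrable fun y => heatKernel s (x - y) := by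
      simp only [heatKernel_ofReal]
      exact (integrable_realHeatKernel_sub hs x).ofReal
    simp only [mul_sub]
    rw [integral_sub (h3.mul_const _) (hg.integrable_heatKernel (by simpa) x), integral_mul_const, h2,
      one_mul]
    rfl
  rw [h1]
  refine (enorm_integral_le_lintegral_enorm _).trans_eq ?_
  congr 1; ext y
  rw [enorm_mul, heatKernel_ofReal, ← ofReal_norm, Complex.norm_real,
    Real.norm_of_nonneg (realHeatKernel_nonneg _ _)]

/-- Since the kernel has mass one, the left side is an average of F(f(x)) − F(f(y)). The symmetric
bound for this difference leaves the translation energy (32s·3/2 = 48) and twice the L⁴ term. -/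
theorem EnergyBound.lintegral_cubic_sub_heat_le {f : R4 → ℂ} (hf : Measurable f)
    (h4 : ∫⁻ x, ‖f x‖ₑ ^ 4 < ∞) {E : ℝ≥0∞} (hE : EnergyBound f E) {s θ : ℝ} (hs : 0 < s) (hθ : 0 < θ) :
    ∫⁻ x, ‖cubic (f x) - NLS.heat s (fun y => cubic (f y)) x‖ₑ ≤
      ENNReal.ofReal (48 * θ * s) * E + ENNReal.ofReal (3 / 2 * θ⁻¹) * ∫⁻ x, ‖f x‖ₑ ^ 4 := by
  have hF := heatAdmissible_cubic hf h4
  set c := ENNReal.ofReal (3 / 4 * θ⁻¹) with hc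
  have hm2 : Measurable fun p : R4 × R4 =>
      ENNReal.ofReal (realHeatKernel s (p.1 - p.2)) * ‖f p.1 - f p.2‖ₑ ^ 2 := by
    refine Measurable.mul ?_ (((hf.comp measurable_fst).sub (hf.comp measurable_snd)).enorm.pow_const 2)
    exact ENNReal.measurable_ofReal.comp ((continuous_realHeatKernel s).measurable.comp (by fun_prop))
  have hpt : ∀ x, ‖cubic (f x) - NLS.heat s (fun y => cubic (f y)) x‖ₑ ≤
      ENNReal.ofReal (3 / 2 * θ) *
        (∫⁻ y, ENNReal.ofReal (realHeatKernel s (x - y)) * ‖f x - f y‖ₑ ^ 2) +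
      (c * ‖f x‖ₑ ^ 4 + c * ∫⁻ y, ENNReal.ofReal (realHeatKernel s (x - y)) * ‖f y‖ₑ ^ 4) := by
    intro x
    refine (hF.enorm_sub_heat_le hs x).trans ?_
    have hma : Measurable fun y => ENNReal.ofReal (realHeatKernel s (x - y)) * ‖f x - f y‖ₑ ^ 2 :=
      (measurable_heatWeight s x).mul ((measurable_const.sub hf).enorm.pow_const 2)
    calc _ ≤ ∫⁻ y, (ENNReal.ofReal (3 / 2 * θ) *
          (ENNReal.ofReal (realHeatKernel s (x - y)) * ‖f x - f y‖ₑ ^ 2) +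
          (ENNReal.ofReal (realHeatKernel s (x - y)) * (c * ‖f x‖ₑ ^ 4) +
            c * (ENNReal.ofReal (realHeatKernel s (x - y)) * ‖f y‖ₑ ^ 4))) := by
          refine lintegral_mono fun y => ?_
          refine (mul_le_mul_right (enorm_cubic_sub_le_symm hθ (f x) (f y)) _).trans_eq ?_
          ring
      _ = _ := by
          rw [lintegral_add_left (hma.const_mul _),
            lintegral_add_left ((measurable_heatWeight s x).mul_const _),
            lintegral_const_mul' _ _ ENNReal.ofReal_ne_top,
            lintegral_const_mul' _ _ ENNReal.ofReal_ne_top,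
            lintegral_mul_const _ (measurable_heatWeight s x), lintegral_heatWeight hs, one_mul]
  refine (lintegral_mono hpt).trans ?_
  rw [lintegral_add_left (hm2.lintegral_prod_right'.const_mul _),
    lintegral_add_left ((hf.enorm.pow_const 4).const_mul _),
    lintegral_const_mul' _ _ ENNReal.ofReal_ne_top, lintegral_const_mul' _ _ ENNReal.ofReal_ne_top,
    lintegral_const_mul' _ _ ENNReal.ofReal_ne_top,
    lintegral_lintegral_heatWeight hs (hf.enorm.pow_const 4), ← add_mul]
  refine add_le_add ?_ (le_of_eq ?_)
  · refine (mul_le_mul_right (hE.lintegral_lintegral_heatWeight_le hf hs) _).trans_eq ?_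
    rw [← mul_assoc, ← ENNReal.ofReal_mul (by positivity)]
    congr 2; ring
  · rw [← ENNReal.ofReal_add (by positivity) (by positivity)]
    congr 2; ring

/-- The nonlinear smoothing estimate: if the heat flow of `f` decays like `β (1 + δ √σ) / σ`, then
`F(f) - e^{sΔ} F(f)` is bounded in `L¹` by `β (1 + δ √s)` times the energy. -/
theorem EnergyBound.lintegral_cubic_sub_heat_le_of_decay {f : R4 → ℂ} (hf : HeatAdmissible f)
    (h4 : ∫⁻ x, ‖f x‖ₑ ^ 4 < ∞) {E : ℝ≥0∞} (hE : EnergyBound f E) {β δ s : ℝ} (hβ : 0 < β)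
    (hδ : 0 ≤ δ) (hs : 0 < s)
    (h : ∀ σ : ℝ, 0 < σ → ∀ x, σ * ‖NLS.heat σ f x‖ ≤ β * (1 + δ * √σ)) :
    ∫⁻ x, ‖cubic (f x) - NLS.heat s (fun y => cubic (f y)) x‖ₑ ≤
      ENNReal.ofReal (5000 * (β * (1 + δ * √s))) * E := by
  have hs' : 0 < (s : ℂ).re := by simpa
  have hss : 0 < √s := Real.sqrt_pos.mpr hs
  have hsq : √s ^ 2 = s := Real.sq_sqrt hs.le
  set k := β * (1 + δ * √s) with hk_def
  have hk : 0 < k := by positivity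
  -- f is split at frequency s^{-1/2}: the smooth part v is good in L⁴, the rough part f − v in L²
  -- and L³.
  set v := NLS.heat s f with hv_def
  have hv : HeatAdmissible v := hf.heat hs'
  have hvm := hv.measurable
  have hEv : EnergyBound v E := hE.heat_flow hf hs
  have hvheat : ∀ σ : ℝ, 0 < σ → ∀ x,
      (σ + s) * ‖NLS.heat σ v x‖ ≤ β * (1 + δ * √(σ + s)) := by
    intro σ hσ x
    have h1 := h (σ + s) (by positivity) x
    rw [hv_def, hf.heat_heat (by simpa) hs']
    simpa using h1
  -- The refined L⁴ inequality with A = k/√s: the flow of v at time σ is that of f at time σ + s,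
  -- and √σ·√s ≤ σ + s.
  have hv4 : ∫⁻ x, ‖v x‖ₑ ^ 4 ≤ ENNReal.ofReal (128 * (k ^ 2 / s)) * E := by
    have := hEv.lintegral_pow_four_le (A := k / √s) (by positivity) fun σ hσ x => by
      have h1 := hvheat σ hσ x
      have hσσ : 0 < √σ := Real.sqrt_pos.mpr hσ
      have hσq : √σ ^ 2 = σ := Real.sq_sqrt hσ.le
      have hw : 0 < √(σ + s) := Real.sqrt_pos.mpr (by positivity)
      have hwq : √(σ + s) ^ 2 = σ + s := Real.sq_sqrt (by positivity)
      have hsw : √σ ≤ √(σ + s) := Real.sqrt_le_sqrt (by linarith)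
      rw [le_div_iff₀ hss]
      have h2 : (√σ * ‖NLS.heat σ v x‖ * √s) * (σ + s) ≤ k * (σ + s) := by
        have h3 : √σ * √s ≤ σ + s := by nlinarith [sq_nonneg (√σ - √s)]
        have h4 : √σ * √s * √(σ + s) ≤ √s * (σ + s) := by
          calc _ = √s * √(σ + s) * √σ := by ring
            _ ≤ √s * √(σ + s) * √(σ + s) := by gcongr
            _ = √s * √(σ + s) ^ 2 := by ring
            _ = _ := by rw [hwq]
        calc _ = √σ * √s * ((σ + s) * ‖NLS.heat σ v x‖) := by ring
          _ ≤ √σ * √s * (β * (1 + δ * √(σ + s))) := by gcongr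
          _ = β * (√σ * √s) + β * δ * (√σ * √s * √(σ + s)) := by ring
          _ ≤ β * (σ + s) + β * δ * (√s * (σ + s)) := by gcongr
          _ = _ := by rw [hk_def]; ring
      exact le_of_mul_le_mul_right h2 (by positivity)
    rwa [div_pow, hsq] at this
  have hv4' : ∫⁻ x, ‖v x‖ₑ ^ 4 < ∞ := (lintegral_enorm_heat_pow_four_le hs hf.measurable).trans_lt h4
  have ha2 := hE.heat s hs
  -- The refined L³ inequality restricted to times up to s, where both flows obey the bound k. The
  -- constant is 64·2·4 = 512 from the energy 4E, plus 4·2 = 8 from the L² term.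
  have ha3 : ∫⁻ x, ‖f x - v x‖ₑ ^ 3 ≤ ENNReal.ofReal (520 * k) * E := by
    have hEa := hE.sub hf hv hEv
    have hEam : Measurable fun x => f x - v x := hf.measurable.sub hvm
    refine (hEa.lintegral_pow_three_le hEam (A := 2 * k) (by positivity) hs
      fun σ hσ hσs x => ?_).trans ?_
    · rw [hf.heat_sub hv (by simpa)]
      have hw : 0 < √(σ + s) := Real.sqrt_pos.mpr (by positivity)
      have hwq : √(σ + s) ^ 2 = σ + s := Real.sq_sqrt (by positivity)
      have hσw : √σ ≤ √s := Real.sqrt_le_sqrt hσs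
      have hwb : √(σ + s) ≤ 2 * √s := by
        rw [Real.sqrt_le_left (by positivity), mul_pow, hsq]; linarith
      have h1 := h σ hσ x
      have h2 := hvheat σ hσ x
      have h3 : σ * ‖NLS.heat σ v x‖ ≤ k := by
        have h5 : 2 * (σ * ‖NLS.heat σ v x‖) ≤ (σ + s) * ‖NLS.heat σ v x‖ := by
          nlinarith [norm_nonneg (NLS.heat σ v x)]
        have h6 : β * (1 + δ * √(σ + s)) ≤ β * (1 + δ * (2 * √s)) := by gcongr
        have h7 : β * (1 + δ * (2 * √s)) ≤ 2 * k := by rw [hk_def]; nlinarith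
        linarith
      have h4 : β * (1 + δ * √σ) ≤ k := by rw [hk_def]; gcongr
      calc _ ≤ σ * (‖NLS.heat σ f x‖ + ‖NLS.heat σ v x‖) := by gcongr; exact norm_sub_le _ _
        _ ≤ _ := by linarith
    · calc _ ≤ ENNReal.ofReal (64 * (2 * k)) * (4 * E) +
            ENNReal.ofReal (4 * (2 * k) / s) * (ENNReal.ofReal s * E) := by gcongr
        _ = _ := by
          rw [← ENNReal.ofReal_ofNat 4, ← mul_assoc (ENNReal.ofReal (64 * (2 * k))),
            ← mul_assoc (ENNReal.ofReal (4 * (2 * k) / s)), ← ENNReal.ofReal_mul (by positivity),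
            ← ENNReal.ofReal_mul (by positivity), ← add_mul,
            ← ENNReal.ofReal_add (by positivity) (by positivity)]
          congr 2
          field_simp
          norm_num
  -- Balances the two Young terms: the L² size is sE and the L⁴ size is a multiple of (k²/s)E, so
  -- θ·s and θ⁻¹·k²/s both equal k.
  set θ := k / s with hθ_def
  have hθ : 0 < θ := by positivity
  have hb : ∫⁻ x, ‖cubic (f x) - cubic (v x)‖ₑ ≤ ENNReal.ofReal (1883 * k) * E := by
    refine (lintegral_enorm_cubic_sub_le hf.measurable hvm hθ).trans ?_
    calc _ ≤ ENNReal.ofReal 3 * (ENNReal.ofReal (520 * k) * E) +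
          (ENNReal.ofReal (5 / 2 * θ) * (ENNReal.ofReal s * E) +
          ENNReal.ofReal (5 / 2 * θ⁻¹) * (ENNReal.ofReal (128 * (k ^ 2 / s)) * E)) := by gcongr
      _ = ENNReal.ofReal (3 * (520 * k) + (5 / 2 * θ * s + 5 / 2 * θ⁻¹ * (128 * (k ^ 2 / s)))) * E := by
        simp only [← mul_assoc (ENNReal.ofReal _)]
        rw [← ENNReal.ofReal_mul (by positivity), ← ENNReal.ofReal_mul (by positivity),
          ← ENNReal.ofReal_mul (by positivity), ← add_mul, ← add_mul,
          ← ENNReal.ofReal_add (by positivity) (by positivity),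
          ← ENNReal.ofReal_add (by positivity) (by positivity)]
      _ ≤ _ := by
        gcongr
        have h1 : 5 / 2 * θ * s + 5 / 2 * θ⁻¹ * (128 * (k ^ 2 / s)) = 5 / 2 * 129 * k := by
          rw [hθ_def]; field_simp; ring
        linarith
  have hc : ∫⁻ x, ‖cubic (v x) - NLS.heat s (fun y => cubic (v y)) x‖ₑ ≤ ENNReal.ofReal (240 * k) * E := by
    refine (hEv.lintegral_cubic_sub_heat_le hvm hv4' hs hθ).trans ?_
    calc _ ≤ ENNReal.ofReal (48 * θ * s) * E +
          ENNReal.ofReal (3 / 2 * θ⁻¹) * (ENNReal.ofReal (128 * (k ^ 2 / s)) * E) := by gcongr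
      _ = _ := by
        rw [← mul_assoc, ← ENNReal.ofReal_mul (by positivity), ← add_mul,
          ← ENNReal.ofReal_add (by positivity) (by positivity)]
        congr 2
        rw [hθ_def]; field_simp; norm_num
  have hFf := heatAdmissible_cubic hf.measurable h4
  have hFv := heatAdmissible_cubic hvm hv4'
  have hd := hFf.sub hFv
  have hdm : Measurable fun x => ‖cubic (f x) - cubic (v x)‖ₑ := hd.measurable.enorm
  have hcm : Measurable fun x => ‖cubic (v x) - NLS.heat s (fun y => cubic (v y)) x‖ₑ :=
    (hFv.measurable.sub (measurable_heat s hFv.measurable)).enorm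
  calc _ ≤ ∫⁻ x, (‖cubic (f x) - cubic (v x)‖ₑ +
        (‖cubic (v x) - NLS.heat s (fun y => cubic (v y)) x‖ₑ +
          ‖NLS.heat s (fun y => cubic (f y) - cubic (v y)) x‖ₑ)) := by
        refine lintegral_mono fun x => ?_
        have e : cubic (f x) - NLS.heat s (fun y => cubic (f y)) x =
            (cubic (f x) - cubic (v x)) + ((cubic (v x) - NLS.heat s (fun y => cubic (v y)) x) -
              NLS.heat s (fun y => cubic (f y) - cubic (v y)) x) := by
          rw [hFf.heat_sub hFv hs']
          ring
        rw [e]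
        refine (enorm_add_le _ _).trans ?_
        gcongr
        rw [sub_eq_add_neg]
        refine (enorm_add_le _ _).trans ?_
        rw [enorm_neg]
    _ ≤ ENNReal.ofReal (1883 * k) * E + (ENNReal.ofReal (240 * k) * E + ENNReal.ofReal (1883 * k) * E) := by
        rw [lintegral_add_left hdm, lintegral_add_left hcm]
        gcongr
        exact (lintegral_enorm_heat_le hs hd.measurable).trans hb
    _ ≤ _ := by
        rw [← add_mul, ← add_mul, ← ENNReal.ofReal_add (by positivity) (by positivity),
          ← ENNReal.ofReal_add (by positivity) (by positivity)]
        gcongr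
        linarith

/-! ### Duhamel's formula from infinity -/

/-- Duhamel's formula tested on a difference of two heat kernels centred at x. A difference, rather
than one kernel, is used so that only F − e^{sΔ}F appears and the linear term can be made small from
the energy alone. -/
theorem heat_smoothed_duhamel {u : ℝ → HDot1} (hu : IsGlobalSolution u) {w : ℝ → R4 → ℂ}
    (hw : ∀ t, (u t : R4 → ℂ) =ᵐ[volume] w t) (t₀ t : ℝ) {s : ℝ} (hs : 0 < s) (x : R4) :
    heat s (w t) x - heat (2 * s : ℝ) (w t) x =
      (heat (s + (t - t₀ : ℝ) * Complex.I) (w t₀) x -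
        heat ((2 * s : ℝ) + (t - t₀ : ℝ) * Complex.I) (w t₀) x) -
      Complex.I * ∫ τ in t₀..t, (heat (s + (t - τ : ℝ) * Complex.I) (fun y => cubic (w τ y)) x -
        heat ((2 * s : ℝ) + (t - τ : ℝ) * Complex.I) (fun y => cubic (w τ y)) x) := by
  have hs2 : 0 < 2 * s := by positivity
  have hF : ∀ τ, (focusingCubic (HDot1.toL4 (u τ)) : R4 → ℂ) =ᵐ[volume] fun y => cubic (w τ y) := by
    intro τ
    refine (MemLp.coeFn_toLp _).trans ?_
    filter_upwards [hw τ] with y hy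
    rw [← hy]
    rfl
  have h := hu.duhamel t₀ t (heatSchwartz s hs x - heatSchwartz (2 * s) hs2 x)
  simp only [map_sub, Lp_apply_heatSchwartz, schrodingerGroup_Lp_heatSchwartz,
    heat_congr_ae (hw _), heat_congr_ae (hF _)] at h
  exact h

theorem integral_inv_sq_add_sq_le {s : ℝ} (hs : 0 < s) (t T : ℝ) :
    ∫ τ in t..T, (s ^ 2 + (t - τ) ^ 2)⁻¹ ≤ Real.pi / (2 * s) := by
  have hd : ∀ τ ∈ uIcc t T, HasDerivAt (fun τ => s⁻¹ * Real.arctan ((τ - t) / s))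
      ((s ^ 2 + (t - τ) ^ 2)⁻¹) τ := by
    intro τ _
    have h1 := ((((hasDerivAt_id τ).sub_const t).div_const s).arctan).const_mul s⁻¹
    refine h1.congr_deriv ?_
    simp only [id]
    have : 0 < s ^ 2 + (t - τ) ^ 2 := by positivity
    field_simp
    ring
  have hc : Continuous fun τ : ℝ => (s ^ 2 + (t - τ) ^ 2)⁻¹ :=
    Continuous.inv₀ (by fun_prop) fun τ => by positivity
  rw [intervalIntegral.integral_eq_sub_of_hasDerivAt hd (hc.intervalIntegrable _ _)]
  simp only [sub_self, zero_div, Real.arctan_zero, mul_zero, sub_zero]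
  have := (Real.arctan_lt_pi_div_two ((T - t) / s)).le
  calc _ ≤ s⁻¹ * (Real.pi / 2) := by gcongr
    _ = _ := by field_simp

/-- Write e^{(2s+iθ)Δ} = e^{(s+iθ)Δ}e^{sΔ} and apply the dispersive estimate to g − e^{sΔ}g. The
decay |s+iθ|⁻² is integrable in θ even through θ = 0, thanks to the smoothing. -/
theorem HeatAdmissible.norm_heat_sub_heat_le {g : R4 → ℂ} (hg : HeatAdmissible g) {s K : ℝ} (hs : 0 < s)
    (hK : 0 ≤ K) (h : ∫⁻ y, ‖g y - NLS.heat s g y‖ₑ ≤ ENNReal.ofReal K) (θ : ℝ) (x : R4) :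
    ‖NLS.heat (s + θ * Complex.I) g x - NLS.heat ((2 * s : ℝ) + θ * Complex.I) g x‖ ≤
      K / 16 * (s ^ 2 + θ ^ 2)⁻¹ * (Real.pi ^ 2)⁻¹ := by
  have hz : 0 < (s + θ * Complex.I).re := by simpa
  have hs' : 0 < (s : ℂ).re := by simpa
  have h1 : NLS.heat ((2 * s : ℝ) + θ * Complex.I) g x =
      NLS.heat (s + θ * Complex.I) (NLS.heat s g) x := by
    rw [hg.heat_heat hz hs']
    congr 1
    push_cast
    ring
  have h2 : ‖(s + θ * Complex.I : ℂ)‖ ^ 2 = s ^ 2 + θ ^ 2 := by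
    rw [← Complex.normSq_eq_norm_sq, Complex.normSq_add_mul_I]
  rw [h1, ← hg.heat_sub (hg.heat hs') hz]
  have h3 := (enorm_heat_le_lintegral hz (fun y => g y - NLS.heat s g y) x).trans
    (mul_le_mul_right h _)
  rw [← ofReal_norm, ← ENNReal.ofReal_mul (by positivity), mul_pow, h2,
    ENNReal.ofReal_le_ofReal_iff (by positivity)] at h3
  refine h3.trans_eq ?_
  have : 0 < s ^ 2 + θ ^ 2 := by positivity
  field_simp
  ring

/-- If the smoothed linear evolutions of `w T` vanish as `T → ∞`, a uniform `L¹` bound on `F(w) - e^{sΔ}F(w)`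
controls `e^{sΔ}w - e^{2sΔ}w` pointwise. -/
theorem mul_norm_heat_sub_heat_two_mul_le {u : ℝ → HDot1} (hu : IsGlobalSolution u) {w : ℝ → R4 → ℂ}
    (hw : ∀ t, (u t : R4 → ℂ) =ᵐ[volume] w t)
    (hadm : ∀ t, HeatAdmissible fun y => cubic (w t y))
    (hlim : ∀ s : ℝ, 0 < s → ∀ t x,
      Tendsto (fun T : ℝ => heat (s + (t - T : ℝ) * Complex.I) (w T) x -
        heat ((2 * s : ℝ) + (t - T : ℝ) * Complex.I) (w T) x) atTop (𝓝 0))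
    {s K : ℝ} (hs : 0 < s) (hK : 0 ≤ K)
    (h : ∀ τ, ∫⁻ y, ‖cubic (w τ y) - heat s (fun y => cubic (w τ y)) y‖ₑ ≤ ENNReal.ofReal K)
    (t : ℝ) (x : R4) : s * ‖heat s (w t) x - heat (2 * s : ℝ) (w t) x‖ ≤ K := by
  -- The constant is K/(16π²) times the bound π/(2s) for the time integral over (t, T), which does
  -- not depend on T.
  have hl : Tendsto (fun T : ℝ => ‖heat (s + (t - T : ℝ) * Complex.I) (w T) x -
      heat ((2 * s : ℝ) + (t - T : ℝ) * Complex.I) (w T) x‖ + K / (32 * Real.pi * s)) atTop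
      (𝓝 (‖(0 : ℂ)‖ + K / (32 * Real.pi * s))) :=
    (hlim s hs t x).norm.add_const _
  have hb : ‖heat s (w t) x - heat (2 * s : ℝ) (w t) x‖ ≤ ‖(0 : ℂ)‖ + K / (32 * Real.pi * s) := by
    refine ge_of_tendsto hl ?_
    filter_upwards [eventually_ge_atTop t] with T hT
    rw [heat_smoothed_duhamel hu hw T t hs x]
    refine (norm_sub_le _ _).trans ?_
    gcongr
    rw [norm_mul, Complex.norm_I, one_mul, intervalIntegral.integral_symm, norm_neg]
    have hc : Continuous fun τ : ℝ => K / 16 * (s ^ 2 + (t - τ) ^ 2)⁻¹ * (Real.pi ^ 2)⁻¹ :=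
      (continuous_const.mul (Continuous.inv₀ (by fun_prop) fun τ => by positivity)).mul continuous_const
    refine (intervalIntegral.norm_integral_le_of_norm_le hT
      (ae_of_all _ fun τ _ => (hadm τ).norm_heat_sub_heat_le hs hK (h τ) (t - τ) x)
      (hc.intervalIntegrable _ _)).trans ?_
    rw [intervalIntegral.integral_mul_const, intervalIntegral.integral_const_mul]
    have := integral_inv_sq_add_sq_le hs t T
    calc _ ≤ K / 16 * (Real.pi / (2 * s)) * (Real.pi ^ 2)⁻¹ := by gcongr
      _ = _ := by
        have := Real.pi_pos
        field_simp
        ring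
  have h1 : K / (32 * Real.pi * s) ≤ K / s := by
    gcongr
    nlinarith [Real.pi_gt_three]
  rw [norm_zero, zero_add] at hb
  calc _ ≤ s * (K / s) := by gcongr; exact hb.trans h1
    _ = K := by field_simp

/-! ### Elements of `Ḣ¹` -/

theorem HDot1.hasWeakGradient (v : HDot1) :
    HasWeakGradient v (fun j => HDot1.partialFun j v) where
  measurable := (Lp.stronglyMeasurable _).measurable
  memLp := Lp.memLp _
  measurable_grad _ := (Lp.stronglyMeasurable _).measurable
  memLp_grad _ := Lp.memLp _
  integral_eq j φ := by
    have h := congrArg (fun T : 𝓢'(R4, ℂ) => T φ) (HDot1.partialFun_spec j v)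
    simp only [TemperedDistribution.lineDerivOp_apply_apply, Lp.toTemperedDistribution_apply,
      smul_eq_mul] at h
    simp only [mul_comm _ (φ _), ← h, ← integral_neg]
    congr 1; ext x
    simp [mul_comm]

theorem HDot1.gradEnergy_eq (v : HDot1) :
    gradEnergy (fun j => HDot1.partialFun j v) = ENNReal.ofReal (‖v‖ ^ 2) := by
  rw [HDot1.norm_def, PiLp.norm_sq_eq_of_L2, ENNReal.ofReal_sum_of_nonneg fun _ _ => by positivity]
  unfold gradEnergy
  congr 1; ext j
  rw [← eLpNorm_two_sq, ENNReal.ofReal_pow (norm_nonneg _), ofReal_norm, Lp.enorm_def]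
  rfl

theorem HDot1.partialFun_sub (v w : HDot1) (j : Fin 4) :
    (HDot1.partialFun j (v - w) : R4 → ℂ) =ᵐ[volume]
      fun x => HDot1.partialFun j v x - HDot1.partialFun j w x := by
  have h : HDot1.partialFun j (v - w) = HDot1.partialFun j v - HDot1.partialFun j w := by
    have := congrArg (fun F => F j) (map_sub HDot1.grad v w)
    exact this
  rw [h]
  exact Lp.coeFn_sub _ _

theorem HDot1.coe_sub (v w : HDot1) :
    ((v - w : HDot1) : R4 → ℂ) =ᵐ[volume] fun x => v x - w x := by
  rw [map_sub]
  exact Lp.coeFn_sub _ _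

theorem HDot1.energyBound (v : HDot1) : EnergyBound v (ENNReal.ofReal (‖v‖ ^ 2)) := by
  rw [← v.gradEnergy_eq]
  exact v.hasWeakGradient.energyBound

/-! ### Uniform tightness of compact subsets of `Ḣ¹` -/

theorem exists_integrable_approx {g : R4 → ℂ} (hg : MemLp g 2) {ε : ℝ≥0∞} (hε : ε ≠ 0) :
    ∃ w : R4 → ℂ, Measurable w ∧ Integrable w ∧ ∫⁻ x, ‖g x - w x‖ₑ ^ 2 ≤ ε := by
  obtain ⟨w, hc, hw, hcont, -⟩ := hg.exists_hasCompactSupport_eLpNorm_sub_le (by simp)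
    (ε := ε ^ (1 / 2 : ℝ)) (by simp [hε])
  refine ⟨w, hcont.measurable, hcont.integrable_of_hasCompactSupport hc, ?_⟩
  have h1 : ∫⁻ x, ‖g x - w x‖ₑ ^ 2 = eLpNorm (g - w) 2 volume ^ 2 := (eLpNorm_two_sq _).symm
  rw [h1]
  calc _ ≤ (ε ^ (1 / 2 : ℝ)) ^ 2 := by gcongr
    _ = ε := by rw [← ENNReal.rpow_two, ← ENNReal.rpow_mul]; norm_num

/-- ‖·‖₂² ≤ ‖·‖_∞·‖·‖₁, with the dispersive bound for the first factor and the L¹ contraction for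
the second. -/
theorem lintegral_enorm_heat_sq_le_of_integrable {s : ℝ} (hs : 0 < s) {w : R4 → ℂ} (hw : Measurable w) :
    ∫⁻ x, ‖heat s w x‖ₑ ^ 2 ≤ ENNReal.ofReal (((4 * Real.pi * s) ^ 2)⁻¹) * (∫⁻ x, ‖w x‖ₑ) ^ 2 := by
  have h1 : ∀ x, ‖heat s w x‖ₑ ≤ ENNReal.ofReal (((4 * Real.pi * s) ^ 2)⁻¹) * ∫⁻ y, ‖w y‖ₑ := by
    intro x
    have := enorm_heat_le_lintegral (z := s) (by simpa) w x
    rwa [Complex.norm_real, Real.norm_of_nonneg hs.le] at this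
  calc _ ≤ ∫⁻ x, (ENNReal.ofReal (((4 * Real.pi * s) ^ 2)⁻¹) * ∫⁻ y, ‖w y‖ₑ) * ‖heat s w x‖ₑ := by
        refine lintegral_mono fun x => ?_
        rw [sq]
        gcongr
        exact h1 x
    _ ≤ (ENNReal.ofReal (((4 * Real.pi * s) ^ 2)⁻¹) * ∫⁻ y, ‖w y‖ₑ) * ∫⁻ x, ‖w x‖ₑ := by
        rw [lintegral_const_mul _ (measurable_heat s hw).enorm]
        exact mul_le_mul' le_rfl (lintegral_enorm_heat_le hs hw)
    _ = _ := by ring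

theorem lintegral_enorm_add_sq_le {f g : R4 → ℂ} (hf : Measurable f) :
    ∫⁻ x, ‖f x + g x‖ₑ ^ 2 ≤ 2 * (∫⁻ x, ‖f x‖ₑ ^ 2) + 2 * ∫⁻ x, ‖g x‖ₑ ^ 2 := by
  rw [← lintegral_const_mul' _ _ (by simp), ← lintegral_const_mul' _ _ (by simp),
    ← lintegral_add_left ((hf.enorm.pow_const 2).const_mul 2)]
  refine lintegral_mono fun x => ?_
  simpa using enorm_sub_sq_le (f x) (-g x)

/-- For integrable functions the L² norm decays at an explicit rate; the general case follows by L²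
density and contraction. -/
theorem tendsto_lintegral_enorm_heat_sq {g : R4 → ℂ} (hg : Measurable g) (h2 : MemLp g 2) :
    Tendsto (fun s : ℝ => ∫⁻ x, ‖heat s g x‖ₑ ^ 2) atTop (𝓝 0) := by
  rw [ENNReal.tendsto_nhds_zero]
  intro ε hε
  have hε4 : ε / 4 ≠ 0 := by simp [hε.ne']
  obtain ⟨w, hw, hwi, hgw⟩ := exists_integrable_approx h2 hε4
  have hlim : Tendsto (fun s : ℝ => ENNReal.ofReal (((4 * Real.pi * s) ^ 2)⁻¹) * (∫⁻ x, ‖w x‖ₑ) ^ 2)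
      atTop (𝓝 0) := by
    have h1 : Tendsto (fun s : ℝ => ((4 * Real.pi * s) ^ 2)⁻¹) atTop (𝓝 0) := by
      refine tendsto_inv_atTop_zero.comp ((tendsto_pow_atTop (by norm_num)).comp ?_)
      exact tendsto_id.const_mul_atTop (by positivity)
    have h3 := ENNReal.Tendsto.mul_const (b := (∫⁻ x, ‖w x‖ₑ) ^ 2) (ENNReal.tendsto_ofReal h1)
      (Or.inr (ENNReal.pow_ne_top hwi.hasFiniteIntegral.ne))
    simpa using h3
  rw [ENNReal.tendsto_nhds_zero] at hlim
  filter_upwards [hlim (ε / 4) (pos_iff_ne_zero.mpr hε4), eventually_gt_atTop 0] with s hs1 hs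
  have hwA : HeatAdmissible w := .of_memLp hw le_rfl (by simp) (memLp_one_iff_integrable.mpr hwi)
  have hgA : HeatAdmissible g := .of_memLp hg (by norm_num) (by simp) h2
  have e : ∀ x, heat s g x = heat s (fun y => g y - w y) x + heat s w x := by
    intro x
    rw [hgA.heat_sub hwA (by simpa)]
    ring
  simp only [e]
  refine (lintegral_enorm_add_sq_le (measurable_heat s (hg.sub hw))).trans ?_
  calc _ ≤ 2 * (ε / 4) + 2 * (ε / 4) := by
        gcongr
        · exact (lintegral_enorm_heat_sq_le hs (hg.sub hw)).trans hgw
        · exact (lintegral_enorm_heat_sq_le_of_integrable hs hw).trans hs1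
    _ = ε := by
        rw [← two_mul, ← mul_assoc, show (2 : ℝ≥0∞) * 2 = 4 by norm_num]
        exact ENNReal.mul_div_cancel (by norm_num) (by norm_num)

theorem gradEnergy_heat_le_add (v w : HDot1) {s : ℝ} (hs : 0 < s) :
    gradEnergy (fun j => heat s (HDot1.partialFun j v)) ≤
      2 * ENNReal.ofReal (‖v - w‖ ^ 2) + 2 * gradEnergy (fun j => heat s (HDot1.partialFun j w)) := by
  rw [← HDot1.gradEnergy_eq]
  unfold gradEnergy
  rw [Finset.mul_sum, Finset.mul_sum, ← Finset.sum_add_distrib]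
  refine Finset.sum_le_sum fun j _ => ?_
  have hA : ∀ v : HDot1, HeatAdmissible (HDot1.partialFun j v) := fun v =>
    .of_memLp (v.hasWeakGradient.measurable_grad j) (by norm_num) (by simp)
      (v.hasWeakGradient.memLp_grad j)
  have e : ∀ x, heat s (HDot1.partialFun j v) x = heat s (HDot1.partialFun j (v - w)) x +
      heat s (HDot1.partialFun j w) x := by
    intro x
    rw [heat_congr_ae (HDot1.partialFun_sub v w j), (hA v).heat_sub (hA w) (by simpa)]
    ring
  simp only [e]
  refine (lintegral_enorm_add_sq_le (measurable_heat s (hA _).measurable)).trans ?_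
  exact add_le_add (mul_le_mul' le_rfl (lintegral_enorm_heat_sq_le hs (hA _).measurable)) le_rfl

/-- On a compact subset of `Ḣ¹` the low frequencies carry uniformly little energy. -/
theorem IsCompact.exists_energyBound_heat {K : Set HDot1} (hK : IsCompact K) {ε : ℝ} (hε : 0 < ε) :
    ∃ r₀ : ℝ, 0 < r₀ ∧ ∀ r, r₀ ≤ r → ∀ v ∈ K, EnergyBound (heat r (v : R4 → ℂ)) (ENNReal.ofReal ε) := by
  -- The radius is such that the two squared errors, each at most ε/4 and doubled by the triangle
  -- inequality, add up to ε.
  obtain ⟨t, -, htf, hcov⟩ := hK.finite_cover_balls (e := √(ε / 4)) (by positivity)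
  have hev : ∀ᶠ r : ℝ in atTop, ∀ w ∈ t,
      gradEnergy (fun j => heat r (HDot1.partialFun j w)) ≤ ENNReal.ofReal (ε / 4) := by
    rw [htf.eventually_all]
    intro w _
    have h1 : Tendsto (fun r : ℝ => gradEnergy (fun j => heat r (HDot1.partialFun j w))) atTop
        (𝓝 (∑ _ : Fin 4, 0)) :=
      tendsto_finsetSum _ fun j _ => tendsto_lintegral_enorm_heat_sq
        (w.hasWeakGradient.measurable_grad j) (w.hasWeakGradient.memLp_grad j)
    rw [Finset.sum_const_zero, ENNReal.tendsto_nhds_zero] at h1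
    exact h1 _ (by simpa using hε)
  obtain ⟨r₀, hr₀⟩ := eventually_atTop.mp (hev.and (eventually_gt_atTop 0))
  refine ⟨max r₀ 1, by positivity, fun r hr v hv => ?_⟩
  obtain ⟨h1, h0⟩ := hr₀ r ((le_max_left _ _).trans hr)
  obtain ⟨w, hw, hvw⟩ := mem_iUnion₂.mp (hcov hv)
  refine (v.hasWeakGradient.energyBound_heat h0).mono ((gradEnergy_heat_le_add v w h0).trans ?_)
  have h3 : ‖v - w‖ ^ 2 ≤ ε / 4 := by
    rw [Metric.mem_ball, dist_eq_norm] at hvw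
    exact (Real.le_sqrt (norm_nonneg _) (by positivity)).mp hvw.le
  calc _ ≤ 2 * ENNReal.ofReal (ε / 4) + 2 * ENNReal.ofReal (ε / 4) := by
        gcongr
        exact h1 w hw
    _ = _ := by
        rw [← add_mul, ← ENNReal.ofReal_ofNat 2, ← ENNReal.ofReal_add (by norm_num) (by norm_num),
          ← ENNReal.ofReal_mul (by norm_num)]
        congr 1; ring

/-- On a compact subset of `Ḣ¹` the high frequency parts are uniformly approximated in `L²` by
functions that are bounded in `L¹`. -/
theorem IsCompact.exists_integrable_approx {K : Set HDot1} (hK : IsCompact K) {R ε : ℝ} (hR : 0 < R)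
    (hε : 0 < ε) : ∃ L : ℝ, 0 ≤ L ∧ ∀ v ∈ K, ∃ w : R4 → ℂ, Measurable w ∧ Integrable w ∧
      ∫⁻ x, ‖w x‖ₑ ≤ ENNReal.ofReal L ∧
      ∫⁻ x, ‖v x - heat R v x - w x‖ₑ ^ 2 ≤ ENNReal.ofReal ε := by
  -- The extra factor R is the price of passing from the energy of v − w to the L² norm of its part
  -- above frequency R^{-1/2}.
  obtain ⟨t, -, htf, hcov⟩ := hK.finite_cover_balls (e := √(ε / (4 * R))) (by positivity)
  have hAdm : ∀ v : HDot1, HeatAdmissible v := fun v => v.hasWeakGradient.heatAdmissible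
  have hR' : 0 < (R : ℂ).re := by simpa
  have hex : ∀ v : HDot1, ∃ w : R4 → ℂ, Measurable w ∧ Integrable w ∧
      ∫⁻ x, ‖v x - heat R v x - w x‖ₑ ^ 2 ≤ ENNReal.ofReal (ε / 4) := by
    intro v
    refine NLS.exists_integrable_approx (g := fun x => v x - heat R v x) ?_ (by simpa using hε)
    refine (memLp_two_iff ((hAdm v).measurable.sub (measurable_heat R (hAdm v).measurable))).mpr ?_
    exact (v.energyBound.heat R hR).trans_lt (by finiteness)
  choose W hWm hWi hW using hex
  obtain ⟨L, hL⟩ : ∃ L : ℝ, ∀ v ∈ t, ∫ x, ‖W v x‖ ≤ L := by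
    obtain ⟨L, hL⟩ := (htf.image fun v => ∫ x, ‖W v x‖).bddAbove
    exact ⟨L, fun v hv => hL (mem_image_of_mem _ hv)⟩
  refine ⟨max L 0, le_max_right _ _, fun v hv => ?_⟩
  obtain ⟨w, hw, hvw⟩ := mem_iUnion₂.mp (hcov hv)
  refine ⟨W w, hWm w, hWi w, ?_, ?_⟩
  · rw [← ofReal_integral_norm_eq_lintegral_enorm (hWi w)]
    exact ENNReal.ofReal_le_ofReal ((hL w hw).trans (le_max_left _ _))
  · have h3 : R * ‖v - w‖ ^ 2 ≤ ε / 4 := by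
      rw [Metric.mem_ball, dist_eq_norm] at hvw
      have := (Real.le_sqrt (norm_nonneg _) (by positivity)).mp hvw.le
      calc _ ≤ R * (ε / (4 * R)) := by gcongr
        _ = _ := by field_simp
    have e : ∀ᵐ x, v x - heat R v x - W w x =
        ((v - w : HDot1) x - heat R ((v - w : HDot1) : R4 → ℂ) x) + (w x - heat R w x - W w x) := by
      filter_upwards [HDot1.coe_sub v w] with x hx
      rw [hx, heat_congr_ae (HDot1.coe_sub v w), (hAdm v).heat_sub (hAdm w) hR']
      ring
    rw [lintegral_congr_ae (e.mono fun x hx => by rw [hx])]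
    refine (lintegral_enorm_add_sq_le
      ((hAdm (v - w)).measurable.sub (measurable_heat R (hAdm (v - w)).measurable))).trans ?_
    calc _ ≤ 2 * ENNReal.ofReal (ε / 4) + 2 * ENNReal.ofReal (ε / 4) := by
          gcongr
          · refine ((v - w).energyBound.heat R hR).trans ?_
            rw [← ENNReal.ofReal_mul hR.le]
            exact ENNReal.ofReal_le_ofReal h3
          · exact hW w
      _ = _ := by
          rw [← add_mul, ← ENNReal.ofReal_ofNat 2, ← ENNReal.ofReal_add (by norm_num) (by norm_num),
            ← ENNReal.ofReal_mul (by norm_num)]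
          congr 1; ring

/-! ### Vanishing of the linear evolution -/

theorem norm_heat_le_of_lintegral_sq_le {z : ℂ} {s b : ℝ} (hs : 0 < s) (hz : s ≤ z.re) {g : R4 → ℂ}
    (hg : Measurable g) (hb : 0 ≤ b) (h : ∫⁻ y, ‖g y‖ₑ ^ 2 ≤ ENNReal.ofReal b) (x : R4) :
    ‖heat z g x‖ ≤ √b / s := by
  have h1 := (enorm_heat_sq_le_lintegral (hs.trans_le hz) hg x).trans (mul_le_mul_right h _)
  rw [← ofReal_norm, ← ENNReal.ofReal_pow (norm_nonneg _), ← ENNReal.ofReal_mul (by positivity),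
    ENNReal.ofReal_le_ofReal_iff (by positivity)] at h1
  have h2 : s ≤ 4 * Real.pi * z.re := by nlinarith [Real.pi_gt_three]
  have h3 : ‖heat z g x‖ ^ 2 ≤ (√b / s) ^ 2 := by
    rw [div_pow, Real.sq_sqrt hb, div_eq_inv_mul]
    exact h1.trans (by gcongr)
  exact (pow_le_pow_iff_left₀ (norm_nonneg _) (by positivity) two_ne_zero).mp h3

theorem norm_heat_le_of_lintegral_le {z : ℂ} (hz : 0 < z.re) {g : R4 → ℂ} {L : ℝ} (hL : 0 ≤ L)
    (h : ∫⁻ y, ‖g y‖ₑ ≤ ENNReal.ofReal L) {θ : ℝ} (hθ : 0 < θ) (hzθ : θ ≤ ‖z‖) (x : R4) :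
    ‖heat z g x‖ ≤ L / θ ^ 2 := by
  have h1 := (enorm_heat_le_lintegral hz g x).trans (mul_le_mul_right h _)
  rw [← ofReal_norm, ← ENNReal.ofReal_mul (by positivity),
    ENNReal.ofReal_le_ofReal_iff (by positivity)] at h1
  refine h1.trans ?_
  rw [div_eq_inv_mul]
  have h2 : θ ≤ 4 * Real.pi * ‖z‖ := by nlinarith [Real.pi_gt_three]
  gcongr

theorem lintegral_enorm_rescale {N : ℝ} (hN : 0 < N) (a : R4) (f : R4 → ℂ) :
    ∫⁻ x, ‖rescale N a f x‖ₑ = ENNReal.ofReal ((N ^ 3)⁻¹) * ∫⁻ x, ‖f x‖ₑ := by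
  simp only [enorm_rescale hN]
  rw [lintegral_const_mul' _ _ (by finiteness), lintegral_comp_affine hN a (fun x => ‖f x‖ₑ),
    ← mul_assoc, ← ENNReal.ofReal_mul (by positivity)]
  congr 2
  field_simp

theorem lintegral_enorm_rescale_pow_four {N : ℝ} (hN : 0 < N) (a : R4) (f : R4 → ℂ) :
    ∫⁻ x, ‖rescale N a f x‖ₑ ^ 4 = ∫⁻ x, ‖f x‖ₑ ^ 4 := by
  simp only [enorm_rescale hN, mul_pow]
  rw [lintegral_const_mul' _ _ (by finiteness), lintegral_comp_affine hN a (fun x => ‖f x‖ₑ ^ 4),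
    ← mul_assoc, ← ENNReal.ofReal_pow hN.le, ← ENNReal.ofReal_mul (by positivity),
    mul_inv_cancel₀ (by positivity)]
  simp

/-- The smoothed linear evolution of a rescaled function `f`, in terms of a decomposition of `f` into
parts of low energy, of small `L²` norm and of bounded `L¹` norm. -/
theorem norm_heat_sub_heat_rescale_le {f w : R4 → ℂ} (hf : HeatAdmissible f) (hw : HeatAdmissible w)
    {R ε L : ℝ} (hR : 0 < R) (hε : 0 ≤ ε) (hL : 0 ≤ L)
    (hlow : EnergyBound (heat R f) (ENNReal.ofReal ε))
    (hmid : ∫⁻ x, ‖f x - heat R f x - w x‖ₑ ^ 2 ≤ ENNReal.ofReal ε)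
    (hhigh : ∫⁻ x, ‖w x‖ₑ ≤ ENNReal.ofReal L) {N : ℝ} (hN : 1 ≤ N) (a : R4) {s θ : ℝ} (hs : 0 < s)
    (hθ : θ ≠ 0) (x : R4) :
    ‖heat (s + θ * Complex.I) (rescale N a f) x -
      heat ((2 * s : ℝ) + θ * Complex.I) (rescale N a f) x‖ ≤
      √(s * ε) / s + 2 * (√ε / s) + 2 * (L / |θ| ^ 2) := by
  have hN0 : 0 < N := by linarith
  have hs' : 0 < (s : ℂ).re := by simpa
  have hz : 0 < (s + θ * Complex.I).re := by simpa
  have hz2 : 0 < ((2 * s : ℝ) + θ * Complex.I).re := by simpa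
  have hθ' : 0 < |θ| := abs_pos.mpr hθ
  have hlowA := (hf.heat (w := R) (by simpa)).rescale hN0 a
  have hmidA := ((hf.sub (hf.heat (w := R) (by simpa))).sub hw).rescale hN0 a
  have hhighA := hw.rescale hN0 a
  -- The low part is small only in energy, which is scale invariant; the difference between
  -- smoothing by s and by 2s turns this into an L² norm of size √(sε).
  have h1 : ‖heat (s + θ * Complex.I)
      (fun y => rescale N a (heat R f) y - heat s (rescale N a (heat R f)) y) x‖ ≤ √(s * ε) / s := by
    refine norm_heat_le_of_lintegral_sq_le hs (by simp)
      (hlowA.measurable.sub (measurable_heat s hlowA.measurable)) (by positivity) ?_ x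
    rw [ENNReal.ofReal_mul hs.le]
    exact (hlow.rescale (measurable_heat R hf.measurable) hN0 a).heat s hs
  -- Rescaling multiplies the L² norm by N⁻¹ ≤ 1, and below the L¹ norm by N⁻³ ≤ 1: this is where N
  -- ≥ 1 enters.
  have h2 : ∀ z : ℂ, s ≤ z.re →
      ‖heat z (rescale N a fun y => f y - heat R f y - w y) x‖ ≤ √ε / s := by
    intro z hzs
    refine norm_heat_le_of_lintegral_sq_le hs hzs hmidA.measurable hε ?_ x
    rw [lintegral_enorm_rescale_sq hN0]
    refine le_trans (mul_le_of_le_one_left' ?_) hmid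
    rw [ENNReal.ofReal_le_one]
    exact inv_le_one_of_one_le₀ (one_le_pow₀ hN)
  -- The only part that uses dispersion, and the only one that improves as |θ| grows.
  have h3 : ∀ z : ℂ, 0 < z.re → |θ| ≤ ‖z‖ → ‖heat z (rescale N a w) x‖ ≤ L / |θ| ^ 2 := by
    intro z hz hzθ
    refine norm_heat_le_of_lintegral_le hz hL ?_ hθ' hzθ x
    rw [lintegral_enorm_rescale hN0]
    refine le_trans (mul_le_of_le_one_left' ?_) hhigh
    rw [ENNReal.ofReal_le_one]
    exact inv_le_one_of_one_le₀ (one_le_pow₀ hN)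
  have hsum : rescale N a f = fun y => (rescale N a (heat R f) y +
      rescale N a (fun y => f y - heat R f y - w y) y) + rescale N a w y := by
    ext y
    simp only [rescale]
    ring
  have hdecomp : ∀ z : ℂ, 0 < z.re → heat z (rescale N a f) x = heat z (rescale N a (heat R f)) x +
      heat z (rescale N a (fun y => f y - heat R f y - w y)) x + heat z (rescale N a w) x := by
    intro z hz
    rw [hsum, (hlowA.add hmidA).heat_add hhighA hz, hlowA.heat_add hmidA hz]
  have hlow2 : heat ((2 * s : ℝ) + θ * Complex.I) (rescale N a (heat R f)) x =
      heat (s + θ * Complex.I) (heat s (rescale N a (heat R f))) x := by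
    rw [hlowA.heat_heat hz hs']
    congr 1
    push_cast
    ring
  have him1 : |θ| ≤ ‖(s + θ * Complex.I : ℂ)‖ := by
    simpa using Complex.abs_im_le_norm (s + θ * Complex.I)
  have him2 : |θ| ≤ ‖((2 * s : ℝ) + θ * Complex.I : ℂ)‖ := by
    simpa using Complex.abs_im_le_norm ((2 * s : ℝ) + θ * Complex.I)
  have hm1 := h2 (s + θ * Complex.I) (by simp)
  have hm2 := h2 ((2 * s : ℝ) + θ * Complex.I) (by simp; linarith)
  have hh1 := h3 _ hz him1
  have hh2 := h3 _ hz2 him2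
  rw [hlowA.heat_sub (hlowA.heat hs') hz, ← hlow2] at h1
  rw [hdecomp _ hz, hdecomp _ hz2]
  have key : ∀ a b c a' b' c' : ℂ, ‖a + b + c - (a' + b' + c')‖ ≤
      ‖a - a'‖ + (‖b‖ + ‖b'‖) + (‖c‖ + ‖c'‖) := by
    intro a b c a' b' c'
    rw [show a + b + c - (a' + b' + c') = (a - a') + (b - b') + (c - c') by ring]
    refine (norm_add₃_le).trans ?_
    gcongr <;> exact norm_sub_le _ _
  refine (key _ _ _ _ _ _).trans ?_
  linarith

/-- The order of choices matters: ε makes the low and middle parts small uniformly in T, then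
compactness fixes R and an L¹ bound L, and only then does T → ∞ remove L/|t−T|². -/
theorem tendsto_heat_sub_heat {K : Set HDot1} (hK : IsCompact K) {v : ℝ → HDot1} (hv : ∀ t, v t ∈ K)
    {N : ℝ → ℝ} (hN : ∀ t, 1 ≤ N t) (a : ℝ → R4) {s : ℝ} (hs : 0 < s) (t : ℝ) (x : R4) :
    Tendsto (fun T : ℝ => heat (s + (t - T : ℝ) * Complex.I) (rescale (N T) (a T) (v T)) x -
      heat ((2 * s : ℝ) + (t - T : ℝ) * Complex.I) (rescale (N T) (a T) (v T)) x) atTop (𝓝 0) := by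
  rw [Metric.tendsto_nhds]
  intro η hη
  simp only [dist_zero_right]
  obtain ⟨ε, hε, hεη⟩ : ∃ ε : ℝ, 0 < ε ∧ √(s * ε) / s + 2 * (√ε / s) < η / 2 := by
    have hc : Tendsto (fun ε : ℝ => √(s * ε) / s + 2 * (√ε / s)) (𝓝[>] 0) (𝓝 0) := by
      have : Continuous fun ε : ℝ => √(s * ε) / s + 2 * (√ε / s) := by fun_prop
      have h0 := this.tendsto 0
      simp only [mul_zero, Real.sqrt_zero, zero_div, add_zero] at h0
      exact h0.mono_left nhdsWithin_le_nhds
    have h1 := hc.eventually_lt_const (half_pos hη)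
    obtain ⟨ε, h2, h3⟩ := (h1.and self_mem_nhdsWithin).exists
    exact ⟨ε, h3, h2⟩
  obtain ⟨R, hR, hlow⟩ := IsCompact.exists_energyBound_heat hK hε
  obtain ⟨L, hL, hhigh⟩ := IsCompact.exists_integrable_approx hK hR hε
  have hlim : Tendsto (fun T : ℝ => 2 * (L / |t - T| ^ 2)) atTop (𝓝 (2 * 0)) := by
    refine Tendsto.const_mul _ (Tendsto.const_div_atTop ?_ L)
    refine (tendsto_pow_atTop two_ne_zero).comp (tendsto_abs_atBot_atTop.comp ?_)
    exact tendsto_atBot_add_const_left _ t tendsto_neg_atTop_atBot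
  rw [mul_zero] at hlim
  filter_upwards [hlim.eventually_lt_const (half_pos hη), eventually_gt_atTop t] with T hT hTt
  obtain ⟨w, hwm, hwi, hwL, hwε⟩ := hhigh (v T) (hv T)
  have := norm_heat_sub_heat_rescale_le (v T).hasWeakGradient.heatAdmissible
    (.of_memLp hwm le_rfl (by simp) (memLp_one_iff_integrable.mpr hwi)) hR hε.le hL
    (hlow R le_rfl _ (hv T)) hwε hwL (hN T) (a T) hs (θ := t - T) (by linarith) x
  linarith

/-! ### The Sobolev inequality -/

theorem sqrt_mul_norm_heat_le {f : R4 → ℂ} (hf : Measurable f) {A : ℝ} (hA : 0 ≤ A)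
    (h : ∫⁻ x, ‖f x‖ₑ ^ 4 ≤ ENNReal.ofReal (A ^ 4)) {s : ℝ} (hs : 0 < s) (x : R4) :
    √s * ‖heat s f x‖ ≤ A := by
  have h1 := ((enorm_heat_pow_four_le hs hf x).trans (lintegral_heatWeight_le hs _ x)).trans
    (mul_le_mul_right h _)
  rw [← ofReal_norm, ← ENNReal.ofReal_pow (norm_nonneg _), ← ENNReal.ofReal_mul (by positivity),
    ENNReal.ofReal_le_ofReal_iff (by positivity)] at h1
  have h2 : (√s * ‖heat s f x‖) ^ 4 ≤ A ^ 4 := by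
    rw [mul_pow, show √s ^ 4 = s ^ 2 by rw [show (4 : ℕ) = 2 * 2 by norm_num, pow_mul,
      Real.sq_sqrt hs.le]]
    calc _ ≤ s ^ 2 * (((4 * Real.pi * s) ^ 2)⁻¹ * A ^ 4) := by gcongr
      _ ≤ s ^ 2 * ((s ^ 2)⁻¹ * A ^ 4) := by
        gcongr
        nlinarith [Real.pi_gt_three]
      _ = _ := by field_simp
  exact (pow_le_pow_iff_left₀ (by positivity) hA (by norm_num)).mp h2

/-- The refined inequality improves itself: with A = ‖f‖₄ the flow satisfies √σ·|e^{σΔ}f| ≤ A, so A⁴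
≤ 128·A²·E. Finiteness of A, assumed beforehand, allows the division by A². -/
theorem EnergyBound.sobolev {f : R4 → ℂ} (hf : Measurable f) (h4 : ∫⁻ x, ‖f x‖ₑ ^ 4 < ∞) {E : ℝ}
    (hE0 : 0 ≤ E) (hE : EnergyBound f (ENNReal.ofReal E)) :
    ∫⁻ x, ‖f x‖ₑ ^ 4 ≤ ENNReal.ofReal ((128 * E) ^ 2) := by
  set M := (∫⁻ x, ‖f x‖ₑ ^ 4).toReal with hM
  have hMe : ∫⁻ x, ‖f x‖ₑ ^ 4 = ENNReal.ofReal M := (ENNReal.ofReal_toReal h4.ne).symm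
  rw [hMe]
  refine ENNReal.ofReal_le_ofReal ?_
  have hM0 : 0 ≤ M := ENNReal.toReal_nonneg
  rcases hM0.eq_or_lt with h0 | h0
  · rw [← h0]; positivity
  set A := √√M with hA
  have hA0 : 0 < A := by positivity
  have hA2 : A ^ 2 = √M := Real.sq_sqrt (Real.sqrt_nonneg _)
  have hA4 : A ^ 4 = M := by
    rw [show (4 : ℕ) = 2 * 2 by norm_num, pow_mul, hA2, Real.sq_sqrt h0.le]
  have h1 := hE.lintegral_pow_four_le hA0 fun σ hσ x =>
    sqrt_mul_norm_heat_le hf hA0.le (by rw [hMe, hA4]) hσ x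
  rw [hMe, ← ENNReal.ofReal_mul (by positivity), ENNReal.ofReal_le_ofReal_iff (by positivity), ← hA4] at h1
  have h2 : A ^ 2 ≤ 128 * E := by
    refine le_of_mul_le_mul_right ?_ (by positivity : 0 < A ^ 2)
    linarith
  rw [← hA4, show (4 : ℕ) = 2 * 2 by norm_num, pow_mul]
  gcongr

/-- Letting s → ∞ in the pointwise bound removes the |f|² term before integrating, so f need not lie
in L². -/
theorem EnergyBound.lintegral_pow_three_le_of_forall {f : R4 → ℂ} {E : ℝ≥0∞} (hE : EnergyBound f E)
    {A : ℝ} (hA : 0 < A) (h : ∀ σ : ℝ, 0 < σ → ∀ x, σ * ‖NLS.heat σ f x‖ ≤ A) :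
    ∫⁻ x, ‖f x‖ₑ ^ 3 ≤ ENNReal.ofReal (64 * A) * E := by
  have hpt : ∀ x, ‖f x‖ₑ ^ 3 ≤ ENNReal.ofReal (32 * A) * squareFunction f x := by
    intro x
    have hlim : Tendsto (fun s : ℝ => ENNReal.ofReal (32 * A) * squareFunction f x +
        ENNReal.ofReal (4 * A / s) * ‖f x‖ₑ ^ 2) atTop
        (𝓝 (ENNReal.ofReal (32 * A) * squareFunction f x + ENNReal.ofReal 0 * ‖f x‖ₑ ^ 2)) := by
      refine tendsto_const_nhds.add (ENNReal.Tendsto.mul_const (ENNReal.tendsto_ofReal ?_)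
        (Or.inr (by finiteness)))
      exact Tendsto.const_div_atTop tendsto_id _
    rw [ENNReal.ofReal_zero, zero_mul, add_zero] at hlim
    refine ge_of_tendsto hlim ?_
    filter_upwards [eventually_gt_atTop 0] with s hs
    exact enorm_pow_three_le_squareFunction hA hs fun σ hσ _ => h σ hσ x
  calc _ ≤ ∫⁻ x, ENNReal.ofReal (32 * A) * squareFunction f x := lintegral_mono hpt
    _ ≤ ENNReal.ofReal (32 * A) * (2 * E) := by
        rw [lintegral_const_mul' _ _ ENNReal.ofReal_ne_top]
        gcongr
        exact hE.square
    _ = _ := by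
        rw [← mul_assoc, ← ENNReal.ofReal_ofNat 2, ← ENNReal.ofReal_mul (by positivity)]
        congr 2; ring

/-! ### Decay of the heat flow of an almost periodic solution -/

theorem enorm_sub_pow_four_le (a b : ℂ) : ‖a - b‖ₑ ^ 4 ≤ 8 * ‖a‖ₑ ^ 4 + 8 * ‖b‖ₑ ^ 4 := by
  have h : ‖a - b‖ ^ 4 ≤ 8 * ‖a‖ ^ 4 + 8 * ‖b‖ ^ 4 := by
    calc ‖a - b‖ ^ 4 ≤ (‖a‖ + ‖b‖) ^ 4 := by gcongr; exact norm_sub_le a b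
      _ ≤ 8 * ‖a‖ ^ 4 + 8 * ‖b‖ ^ 4 := by
        have := add_pow_le (norm_nonneg a) (norm_nonneg b) 4
        norm_num at this
        linarith
  have := ENNReal.ofReal_le_ofReal h
  rw [ENNReal.ofReal_add (by positivity) (by positivity), ENNReal.ofReal_mul (by norm_num),
    ENNReal.ofReal_mul (by norm_num)] at this
  simpa [ENNReal.ofReal_pow, ofReal_norm] using this

theorem pow_three_le_add (a : ℝ≥0∞) : a ^ 3 ≤ a ^ 2 + a ^ 4 := by
  rcases le_total a 1 with h | h
  · exact le_add_right (pow_le_pow_right_of_le_one' h (by norm_num))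
  · exact le_add_left (pow_le_pow_right₀ h (by norm_num))

/-- Removing the low frequencies changes the nonlinearity by a quantity that is bounded in `L¹`. -/
theorem lintegral_cubic_sub_cubic_heat_le {f : R4 → ℂ} (hf : Measurable f) {E B s : ℝ} (hE0 : 0 ≤ E)
    (hE : EnergyBound f (ENNReal.ofReal E)) (hB : 0 ≤ B) (h4 : ∫⁻ x, ‖f x‖ₑ ^ 4 ≤ ENNReal.ofReal B)
    (hs : 0 < s) :
    ∫⁻ x, ‖cubic (f x) - cubic (heat s f x)‖ₑ ≤ ENNReal.ofReal (6 * (s * E) + 51 * B) := by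
  have hv := measurable_heat s hf
  have hv4 : ∫⁻ x, ‖heat s f x‖ₑ ^ 4 ≤ ENNReal.ofReal B :=
    (lintegral_enorm_heat_pow_four_le hs hf).trans h4
  have h2 : ∫⁻ x, ‖f x - heat s f x‖ₑ ^ 2 ≤ ENNReal.ofReal (s * E) := by
    rw [ENNReal.ofReal_mul hs.le]
    exact hE.heat s hs
  have hm2 : Measurable fun x => ‖f x - heat s f x‖ₑ ^ 2 := (hf.sub hv).enorm.pow_const 2
  -- L³ sits between L², where the energy bounds the difference, and L⁴.
  have h3 : ∫⁻ x, ‖f x - heat s f x‖ₑ ^ 3 ≤ ENNReal.ofReal (s * E + 16 * B) := by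
    calc _ ≤ ∫⁻ x, (‖f x - heat s f x‖ₑ ^ 2 + (8 * ‖f x‖ₑ ^ 4 + 8 * ‖heat s f x‖ₑ ^ 4)) :=
          lintegral_mono fun x => (pow_three_le_add _).trans
            (add_le_add le_rfl (enorm_sub_pow_four_le _ _))
      _ ≤ ENNReal.ofReal (s * E) + (8 * ENNReal.ofReal B + 8 * ENNReal.ofReal B) := by
          rw [lintegral_add_left hm2, lintegral_add_left ((hf.enorm.pow_const 4).const_mul 8),
            lintegral_const_mul' _ _ (by simp), lintegral_const_mul' _ _ (by simp)]
          gcongr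
      _ = _ := by
          rw [← ENNReal.ofReal_ofNat 8, ← ENNReal.ofReal_mul (by positivity),
            ← ENNReal.ofReal_add (by positivity) (by positivity),
            ← ENNReal.ofReal_add (by positivity) (by positivity)]
          congr 1; ring
  refine (lintegral_enorm_cubic_sub_le hf hv one_pos).trans ?_
  calc _ ≤ ENNReal.ofReal 3 * ENNReal.ofReal (s * E + 16 * B) +
        (ENNReal.ofReal (5 / 2 * 1) * ENNReal.ofReal (s * E) +
          ENNReal.ofReal (5 / 2 * 1⁻¹) * ENNReal.ofReal B) := by gcongr
    _ ≤ _ := by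
        have hsE : 0 ≤ s * E := by positivity
        rw [← ENNReal.ofReal_mul (by positivity), ← ENNReal.ofReal_mul (by positivity),
          ← ENNReal.ofReal_mul (by positivity), ← ENNReal.ofReal_add (by positivity) (by positivity),
          ← ENNReal.ofReal_add (by positivity) (by positivity)]
        refine ENNReal.ofReal_le_ofReal ?_
        norm_num
        linarith

/-- The bound β(1+δ√σ)/σ decreases in σ, so it survives the shift of time from σ to σ + s. -/
theorem HeatAdmissible.decay_heat {f : R4 → ℂ} (hf : HeatAdmissible f) {β δ s : ℝ} (hβ : 0 ≤ β)
    (hδ : 0 ≤ δ) (hs : 0 < s)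
    (h : ∀ σ : ℝ, 0 < σ → ∀ x, σ * ‖NLS.heat σ f x‖ ≤ β * (1 + δ * √σ)) {σ : ℝ} (hσ : 0 < σ) (x : R4) :
    σ * ‖NLS.heat σ (NLS.heat s f) x‖ ≤ β * (1 + δ * √σ) := by
  have h1 := h (σ + s) (by positivity) x
  rw [hf.heat_heat (by simpa) (by simpa), ← Complex.ofReal_add]
  have hw : 0 < √(σ + s) := Real.sqrt_pos.mpr (by positivity)
  have hwq : √(σ + s) ^ 2 = σ + s := Real.sq_sqrt (by positivity)
  have hsw : √σ ≤ √(σ + s) := Real.sqrt_le_sqrt (by linarith)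
  have hσq : √σ ^ 2 = σ := Real.sq_sqrt hσ.le
  refine le_of_mul_le_mul_right ?_ (by positivity : 0 < σ + s)
  calc _ = σ * ((σ + s) * ‖NLS.heat ((σ + s : ℝ) : ℂ) f x‖) := by ring
    _ ≤ σ * (β * (1 + δ * √(σ + s))) := by gcongr
    _ = β * (σ + δ * (√σ ^ 2 * √(σ + s))) := by rw [hσq]; ring
    _ ≤ β * ((σ + s) + δ * (√σ * √(σ + s) ^ 2)) := by
        gcongr ?_ * (?_ + ?_ * ?_)
        · linarith
        · calc √σ ^ 2 * √(σ + s) = √σ * √(σ + s) * √σ := by ring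
            _ ≤ √σ * √(σ + s) * √(σ + s) := by gcongr
            _ = _ := by ring
    _ = _ := by rw [hwq]; ring

/-- Compare F(f) with F(e^{s₀Δ}f). The latter has energy 1/40000, which turns the constant 5000 of
the smoothing estimate into 1/8; the comparison error is paid twice, once under e^{sΔ}, and does not
depend on β. -/
theorem lintegral_cubic_sub_heat_cubic_le {f : R4 → ℂ} (hf : HeatAdmissible f) {E B s₀ : ℝ}
    (hE0 : 0 ≤ E) (hE : EnergyBound f (ENNReal.ofReal E)) (hB : 0 ≤ B)
    (h4 : ∫⁻ x, ‖f x‖ₑ ^ 4 ≤ ENNReal.ofReal B) (hs₀ : 0 < s₀)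
    (hlow : EnergyBound (heat s₀ f) (ENNReal.ofReal (1 / 40000))) {β δ s : ℝ} (hβ : 0 < β) (hδ : 0 ≤ δ)
    (hs : 0 < s) (h : ∀ σ : ℝ, 0 < σ → ∀ x, σ * ‖heat σ f x‖ ≤ β * (1 + δ * √σ)) :
    ∫⁻ x, ‖cubic (f x) - heat s (fun y => cubic (f y)) x‖ₑ ≤
      ENNReal.ofReal (1 / 8 * (β * (1 + δ * √s)) + 2 * (6 * (s₀ * E) + 51 * B)) := by
  set C := 6 * (s₀ * E) + 51 * B
  have hC : 0 ≤ C := by positivity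
  have hs' : 0 < (s : ℂ).re := by simpa
  have hv : HeatAdmissible (heat s₀ f) := hf.heat (by simpa)
  have hv4 : ∫⁻ x, ‖heat s₀ f x‖ₑ ^ 4 ≤ ENNReal.ofReal B :=
    (lintegral_enorm_heat_pow_four_le hs₀ hf.measurable).trans h4
  have hFf := heatAdmissible_cubic hf.measurable (h4.trans_lt ENNReal.ofReal_lt_top)
  have hFv := heatAdmissible_cubic hv.measurable (hv4.trans_lt ENNReal.ofReal_lt_top)
  have hd := hFf.sub hFv
  have hdm : Measurable fun x => ‖cubic (f x) - cubic (heat s₀ f x)‖ₑ := hd.measurable.enorm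
  have hcm : Measurable fun x => ‖cubic (heat s₀ f x) - heat s (fun y => cubic (heat s₀ f y)) x‖ₑ :=
    (hFv.measurable.sub (measurable_heat s hFv.measurable)).enorm
  have h1 := lintegral_cubic_sub_cubic_heat_le hf.measurable hE0 hE hB h4 hs₀
  have h2 := hlow.lintegral_cubic_sub_heat_le_of_decay hv (hv4.trans_lt ENNReal.ofReal_lt_top) hβ hδ hs
    fun σ hσ x => hf.decay_heat hβ.le hδ hs₀ h hσ x
  calc _ ≤ ∫⁻ x, (‖cubic (f x) - cubic (heat s₀ f x)‖ₑ +
        (‖cubic (heat s₀ f x) - heat s (fun y => cubic (heat s₀ f y)) x‖ₑ +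
          ‖heat s (fun y => cubic (f y) - cubic (heat s₀ f y)) x‖ₑ)) := by
        refine lintegral_mono fun x => ?_
        have e : cubic (f x) - heat s (fun y => cubic (f y)) x =
            (cubic (f x) - cubic (heat s₀ f x)) +
              ((cubic (heat s₀ f x) - heat s (fun y => cubic (heat s₀ f y)) x) -
              heat s (fun y => cubic (f y) - cubic (heat s₀ f y)) x) := by
          rw [hFf.heat_sub hFv hs']
          ring
        rw [e]
        refine (enorm_add_le _ _).trans ?_
        gcongr
        rw [sub_eq_add_neg]
        refine (enorm_add_le _ _).trans ?_
        rw [enorm_neg]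
    _ ≤ ENNReal.ofReal C + (ENNReal.ofReal (5000 * (β * (1 + δ * √s))) * ENNReal.ofReal (1 / 40000) +
        ENNReal.ofReal C) := by
        rw [lintegral_add_left hdm, lintegral_add_left hcm]
        gcongr
        exact (lintegral_enorm_heat_le hs hd.measurable).trans h1
    _ = _ := by
        rw [← ENNReal.ofReal_mul (by positivity), ← ENNReal.ofReal_add (by positivity) hC,
          ← ENNReal.ofReal_add hC (by positivity)]
        congr 1; ring

/-- The bootstrap: a family of functions of bounded energy, whose low frequencies have little energy
and for which `F(w) - e^{sΔ}F(w)` controls `e^{sΔ}w - e^{2sΔ}w`, has a heat flow decaying like `1/s`. -/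
theorem exists_decay_of_smoothed_bound {w : ℝ → R4 → ℂ} (hw : ∀ t, HeatAdmissible (w t)) {E A s₀ : ℝ}
    (hE0 : 0 ≤ E) (hE : ∀ t, EnergyBound (w t) (ENNReal.ofReal E)) (hA : 0 ≤ A)
    (h4 : ∀ t, ∫⁻ x, ‖w t x‖ₑ ^ 4 ≤ ENNReal.ofReal (A ^ 4)) (hs₀ : 0 < s₀)
    (hlow : ∀ t, EnergyBound (heat s₀ (w t)) (ENNReal.ofReal (1 / 40000)))
    (hduh : ∀ s K : ℝ, 0 < s → 0 ≤ K →
      (∀ τ, ∫⁻ y, ‖cubic (w τ y) - heat s (fun y => cubic (w τ y)) y‖ₑ ≤ ENNReal.ofReal K) →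
      ∀ t x, s * ‖heat s (w t) x - heat (2 * s : ℝ) (w t) x‖ ≤ K) :
    ∃ B : ℝ, 0 < B ∧ ∀ t, ∀ s : ℝ, 0 < s → ∀ x, s * ‖heat s (w t) x‖ ≤ B := by
  -- The added 1 only ensures C > 0, so that the decay constants stay positive.
  set C := 6 * (s₀ * E) + 51 * A ^ 4 + 1 with hC_def
  have hC : 0 < C := by positivity
  -- s|e^{sΔ}w| is at most the smoothed difference plus half of the bound at time 2s. As √(2s) ≤
  -- (3/2)√s, the coefficient of δ√s is 1/8 + 3/4 = 7/8; that of the constant term is only 5/8.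
  have step : ∀ β δ : ℝ, 0 < β → 0 < δ →
      (∀ t, ∀ s : ℝ, 0 < s → ∀ x, s * ‖heat s (w t) x‖ ≤ β * (1 + δ * √s)) →
      ∀ t, ∀ s : ℝ, 0 < s → ∀ x, s * ‖heat s (w t) x‖ ≤ (7 / 8 * β + 2 * C) * (1 + δ * √s) := by
    intro β δ hβ hδ h t s hs x
    have hsq : 0 < √s := Real.sqrt_pos.mpr hs
    have h1 := hduh s (1 / 8 * (β * (1 + δ * √s)) + 2 * C) hs (by positivity) (fun τ =>
      (lintegral_cubic_sub_heat_cubic_le (hw τ) hE0 (hE τ) (by positivity) (h4 τ) hs₀ (hlow τ) hβ hδ.le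
        hs (h τ)).trans (ENNReal.ofReal_le_ofReal (by linarith))) t x
    have h2 := h t (2 * s) (by positivity) x
    have h3 : √(2 * s) ≤ 3 / 2 * √s := by
      rw [Real.sqrt_le_left (by positivity), mul_pow, Real.sq_sqrt hs.le]
      linarith
    have h5 : s * ‖heat s (w t) x‖ ≤ s * ‖heat s (w t) x - heat (2 * s : ℝ) (w t) x‖ +
        s * ‖heat (2 * s : ℝ) (w t) x‖ := by
      rw [← mul_add]
      gcongr
      simpa using norm_add_le (heat s (w t) x - heat (2 * s : ℝ) (w t) x) (heat (2 * s : ℝ) (w t) x)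
    have h6 : β * (1 + δ * √(2 * s)) ≤ β * (1 + δ * (3 / 2 * √s)) := by gcongr
    have h7 : 0 ≤ C * (δ * √s) := by positivity
    linarith
  -- The start is the Sobolev bound A√s = (A/δ)·δ√s, the reason for the weight 1 + δ√s. The number
  -- 16C is the fixed point of β ↦ (7/8)β + 2C.
  have iter : ∀ δ : ℝ, 0 < δ → ∀ n : ℕ, ∀ t, ∀ s : ℝ, 0 < s → ∀ x,
      s * ‖heat s (w t) x‖ ≤ (16 * C + (7 / 8) ^ n * (A / δ)) * (1 + δ * √s) := by
    intro δ hδ n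
    induction n with
    | zero =>
      intro t s hs x
      have h1 := sqrt_mul_norm_heat_le (hw t).measurable hA (h4 t) hs x
      calc s * ‖heat s (w t) x‖ = √s * (√s * ‖heat s (w t) x‖) := by
            rw [← mul_assoc, Real.mul_self_sqrt hs.le]
        _ ≤ √s * A := by gcongr
        _ = A / δ * (δ * √s) := by field_simp
        _ ≤ _ := by
            rw [pow_zero, one_mul]
            gcongr <;> linarith
    | succ n ih =>
      intro t s hs x
      refine (step _ δ (by positivity) hδ ih t s hs x).trans_eq ?_
      rw [pow_succ]
      ring
  refine ⟨16 * C, by positivity, fun t s hs x => ?_⟩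
  -- First n → ∞ with δ fixed, which removes A/δ; only afterwards δ → 0.
  have hδ : ∀ δ : ℝ, 0 < δ → s * ‖heat s (w t) x‖ ≤ 16 * C * (1 + δ * √s) := by
    intro δ hδ
    have hlim : Tendsto (fun n : ℕ => (16 * C + (7 / 8 : ℝ) ^ n * (A / δ)) * (1 + δ * √s)) atTop
        (𝓝 ((16 * C + 0 * (A / δ)) * (1 + δ * √s))) :=
      (((tendsto_pow_atTop_nhds_zero_of_lt_one (by norm_num) (by norm_num)).mul_const _).const_add
        _).mul_const _
    rw [zero_mul, add_zero] at hlim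
    exact ge_of_tendsto' hlim fun n => iter δ hδ n t s hs x
  have hlim : Tendsto (fun δ : ℝ => 16 * C * (1 + δ * √s)) (𝓝[>] 0) (𝓝 (16 * C)) := by
    have : Continuous fun δ : ℝ => 16 * C * (1 + δ * √s) := by fun_prop
    have h0 := this.tendsto 0
    simp only [zero_mul, add_zero, mul_one] at h0
    exact h0.mono_left nhdsWithin_le_nhds
  exact ge_of_tendsto hlim (eventually_nhdsWithin_of_forall fun δ h => hδ δ h)

/-- Inverts the normalisation in almost periodicity. The null set is transported through an affine
map that scales Lebesgue measure. -/
theorem ae_eq_rescale {f v : R4 → ℂ} {N : ℝ} (hN : 0 < N) (x₀ : R4)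
    (h : v =ᵐ[volume] fun x => (N⁻¹ : ℂ) * f (N⁻¹ • (x - x₀))) :
    f =ᵐ[volume] rescale N x₀ v := by
  have hq : Measure.QuasiMeasurePreserving (fun x : R4 => N • x + x₀) volume volume := by
    refine ⟨by fun_prop, Measure.AbsolutelyContinuous.mk fun s hs h0 => ?_⟩
    rw [Measure.map_apply (by fun_prop) hs]
    have := lintegral_comp_affine hN x₀ (s.indicator 1)
    rw [lintegral_indicator_one hs, h0, mul_zero] at this
    rw [← lintegral_indicator_one (hs.preimage (by fun_prop)), ← this]
    rfl
  filter_upwards [hq.ae h] with x hx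
  have hN' : (N : ℂ) ≠ 0 := by exact_mod_cast hN.ne'
  rw [rescale, hx, add_sub_cancel_right, smul_smul, inv_mul_cancel₀ hN.ne', one_smul, ← mul_assoc,
    mul_inv_cancel₀ hN', one_mul]

end NLS

end

/-! ### Proof of the main theorem -/

theorem theorem6p1 (u : ℝ → NLS.HDot1) (hu : NLS.IsGlobalSolution u)
    (N : ℝ → ℝ) (hper : NLS.IsAlmostPeriodic u N) (hN : ∀ t, 1 ≤ N t) :
    NLS.normLinftyLp 3 u < ⊤ := by
  obtain ⟨hN0, x₀, K, hK, hKu⟩ := hper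
  choose v hvK hv using hKu
  -- An everywhere defined representative of u(t), built from an element of the compact set, so that
  -- scale-invariant bounds transfer from K.
  set w : ℝ → NLS.R4 → ℂ := fun t => NLS.rescale (N t) (x₀ t) (v t) with hw_def
  have huw : ∀ t, (u t : NLS.R4 → ℂ) =ᵐ[volume] w t := fun t =>
    NLS.ae_eq_rescale (hN0 t) (x₀ t) (by simpa using hv t)
  have hvA : ∀ t, NLS.HeatAdmissible (v t) := fun t => (v t).hasWeakGradient.heatAdmissible
  have hwA : ∀ t, NLS.HeatAdmissible (w t) := fun t => (hvA t).rescale (hN0 t) (x₀ t)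
  obtain ⟨D, hD⟩ : ∃ D : ℝ, ∀ x ∈ K, ‖x‖ ≤ D := by
    obtain ⟨D, hD⟩ := (hK.image continuous_norm).bddAbove
    exact ⟨D, fun x hx => hD (Set.mem_image_of_mem _ hx)⟩
  have hvE : ∀ t, NLS.EnergyBound (v t) (ENNReal.ofReal (D ^ 2)) := fun t =>
    (v t).energyBound.mono (ENNReal.ofReal_le_ofReal
      (pow_le_pow_left₀ (norm_nonneg _) (hD _ (hvK t)) 2))
  have hE : ∀ t, NLS.EnergyBound (w t) (ENNReal.ofReal (D ^ 2)) := fun t =>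
    (hvE t).rescale (hvA t).measurable (hN0 t) (x₀ t)
  have hv4 : ∀ t, ∫⁻ x, ‖v t x‖ₑ ^ 4 < ⊤ := fun t => by
    have h1 := MeasureTheory.lintegral_rpow_enorm_lt_top_of_eLpNorm_lt_top (p := 4) (by simp) (by simp)
      (v t).hasWeakGradient.memLp.2
    simpa using h1
  set A : ℝ := √(128 * D ^ 2) with hA
  have hA4 : A ^ 4 = (128 * D ^ 2) ^ 2 := by
    rw [show (4 : ℕ) = 2 * 2 by norm_num, pow_mul, hA, Real.sq_sqrt (by positivity)]
  have h4 : ∀ t, ∫⁻ x, ‖w t x‖ₑ ^ 4 ≤ ENNReal.ofReal (A ^ 4) := fun t => by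
    rw [hA4, hw_def, NLS.lintegral_enorm_rescale_pow_four (hN0 t)]
    exact (hvE t).sobolev (hvA t).measurable (hv4 t) (by positivity)
  obtain ⟨s₀, hs₀, hlow⟩ := NLS.IsCompact.exists_energyBound_heat hK (ε := 1 / 40000) (by norm_num)
  -- By scaling, e^{s₀Δ}w(t) is the rescaled e^{N²s₀Δ}v(t), and N ≥ 1 gives N²s₀ ≥ s₀: the low
  -- frequencies of u(t) are uniformly small in energy.
  have hlow' : ∀ t, NLS.EnergyBound (NLS.heat s₀ (w t)) (ENNReal.ofReal (1 / 40000)) := fun t => by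
    rw [hw_def, NLS.heat_rescale (hN0 t)]
    refine (hlow _ ?_ _ (hvK t)).rescale (NLS.measurable_heat _ (hvA t).measurable) (hN0 t) (x₀ t)
    exact le_mul_of_one_le_left hs₀.le (one_le_pow₀ (hN t))
  obtain ⟨B, hB, hdecay⟩ := NLS.exists_decay_of_smoothed_bound hwA (by positivity) hE
    (Real.sqrt_nonneg _) h4 hs₀ hlow' fun s L hs hL h t x =>
      NLS.mul_norm_heat_sub_heat_two_mul_le hu huw
        (fun t => NLS.heatAdmissible_cubic (hwA t).measurable ((h4 t).trans_lt ENNReal.ofReal_lt_top))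
        (fun s hs t x => NLS.tendsto_heat_sub_heat hK hvK hN x₀ hs t x) hs hL h t x
  have h3 : ∀ t, MeasureTheory.eLpNorm (u t : NLS.R4 → ℂ) 3 volume ≤
      (ENNReal.ofReal (64 * B) * ENNReal.ofReal (D ^ 2)) ^ (1 / 3 : ℝ) := fun t => by
    rw [eLpNorm_congr_ae (huw t), eLpNorm_eq_lintegral_rpow_enorm_toReal (by simp) (by simp)]
    have := (hE t).lintegral_pow_three_le_of_forall hB (hdecay t)
    simp only [ENNReal.toReal_ofNat, ENNReal.rpow_ofNat]
    gcongr
  exact (iSup_le h3).trans_lt (ENNReal.rpow_lt_top_of_nonneg (by norm_num) (by finiteness))
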